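/- Let $A<0$, $B,C,L>0$, $\lambda>0$, $\hat L_2\in(-1,\infty)$, let $\ell>0$, let $\Omega=(-\ell,\ell)^2$, and put $s_+=\dfrac{B+\sqrt{B^2+24|A|C}}{4C}$. For $(q_1,q_2,q_3)\in W^{1,2}(\Omega;\mathbb R^3)$ let $$J[q_1,q_2,q_3]=\int_\Omega f_{el}+\frac{\lambda^2}{L}f_b\,\mathrm dA,$$ where $$f_b=A(q_1^2+q_2^2+3q_3^2)+C(q_1^2+q_2^2+3q_3^2)^2+2Bq_3(q_1^2+q_2^2-q_3^2),$$ $$\begin{aligned}f_{el}={}&\Bigl(1+\tfrac{\hat L_2}{2}\Bigr)|\nabla q_1|^2+\Bigl(1+\tfrac{\hat L_2}{2}\Bigr)|\nabla q_2|^2+\Bigl(3+\tfrac{\hat L_2}{2}\Bigr)|\nabla q_3|^2\\&+\hat L_2\,(q_{1,y}q_{3,y}-q_{1,x}q_{3,x}-q_{2,y}q_{3,x}-q_{2,x}q_{3,y})+|\hat L_2|\,(q_{2,y}q_{1,x}-q_{1,y}q_{2,x}).\end{aligned}$$ Let $q_b:\partial\Omega\to\mathbb R$ be a tangent boundary datum: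 there are $0<d<\ell$ and an even, continuous, piecewise $C^1$ function $\tau:[-\ell,\ell]\to\mathbb R$ with $\tau=s_+/2$ on $[-(\ell-d),\ell-d]$ such that $q_b(t,\pm\ell)=\tau(t)$ and $q_b(\pm\ell,t)=-\tau(t)$ for $|t|\le\ell$ (so that $q_b=0$ at the vertices). Let $$\mathcal A_0=\{(q_1,q_2,q_3)\in W^{1,2}(\Omega;\mathbb R^3): q_1=q_b,\ q_2=0,\ q_3=-s_+/6\ \text{on}\ \partial\Omega\},$$ with boundary values in the sense of traces. Then $J$ has a critical point $(q_1^s,q_2^s,q_3^s)$ in $\mathcal A_0$ (that is, $J$ is finite on $\mathcal A_0$ and its first variation at $(q_1^s,q_2^s,q_3^s)$ vanishes in every direction of $W^{1,2}_0(\Omega;\mathbb R^3)$) such that $q_1^s$ is odd under reflection about each of the diagonals $y=x$, $y=-x$ and even under reflection about each of the $x$- and $y$-axes; $q_2^s$ is even under reflection about the diagonals and odd under reflection about the axes; and $q_3^s$ is even under reflection about the diagonals and about the axes. Consequently $q_1^s$ vanishes on the diagonals $y=\pm x$, and $q_2^s$ vanishes on the coordinate axes $x=0$ and $y=0$, both pointwise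 for a suitable representative that has these parities at every point of $\Omega$ and in the sense of traces. -/

import Mathlib

open MeasureTheory
open scoped ContDiff NNReal

noncomputable section

namespace NematicSquare

/-- The open square of half-side `ℓ` centred at the origin, with edges parallel to the axes. -/
def square (ℓ : ℝ) : Set (ℝ × ℝ) := Set.Ioo (-ℓ) ℓ ×ˢ Set.Ioo (-ℓ) ℓ

/-- A smooth test function with compact support in `Ω`. -/
structure IsTest (Ω : Set (ℝ × ℝ)) (φ : ℝ × ℝ → ℝ) : Prop where
  smooth : ContDiff ℝ ∞ φ
  compact : HasCompactSupport φ
  support : tsupport φ ⊆ Ω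

/-- `g` is the weak derivative of `u` on `Ω` in the direction `e`. -/
def IsWeakDeriv (Ω : Set (ℝ × ℝ)) (e : ℝ × ℝ) (u g : ℝ × ℝ → ℝ) : Prop :=
  ∀ φ : ℝ × ℝ → ℝ, IsTest Ω φ →
    ∫ p in Ω, u p * fderiv ℝ φ p e = -∫ p in Ω, g p * φ p

/-- An element of the Sobolev space `W^{1,2}(Ω)`: a function that is square integrable on `Ω`,
together with its two weak partial derivatives, which are square integrable on `Ω`.
(The values outside `Ω` play no role; the derivatives are determined up to null sets.) -/
@[ext] structure W12 (Ω : Set (ℝ × ℝ)) where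
  /-- the function -/
  toFun : ℝ × ℝ → ℝ
  /-- the weak derivative in `x` -/
  dx : ℝ × ℝ → ℝ
  /-- the weak derivative in `y` -/
  dy : ℝ × ℝ → ℝ
  memLp_toFun : MemLp toFun 2 (volume.restrict Ω)
  memLp_dx : MemLp dx 2 (volume.restrict Ω)
  memLp_dy : MemLp dy 2 (volume.restrict Ω)
  weak_dx : IsWeakDeriv Ω (1, 0) toFun dx
  weak_dy : IsWeakDeriv Ω (0, 1) toFun dy

theorem IsTest.memLp {Ω : Set (ℝ × ℝ)} {φ : ℝ × ℝ → ℝ} (h : IsTest Ω φ) :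
    MemLp φ 2 (volume.restrict Ω) :=
  (h.smooth.continuous.memLp_of_hasCompactSupport h.compact).restrict Ω

theorem IsTest.memLp_fderiv {Ω : Set (ℝ × ℝ)} {φ : ℝ × ℝ → ℝ} (h : IsTest Ω φ) (e : ℝ × ℝ) :
    MemLp (fun p => fderiv ℝ φ p e) 2 (volume.restrict Ω) := by
  have hc : Continuous (fun p => fderiv ℝ φ p e) :=
    (h.smooth.continuous_fderiv (by simp)).clm_apply continuous_const
  have hs : HasCompactSupport (fun p => fderiv ℝ φ p e) := h.compact.fderiv_apply (𝕜 := ℝ) e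
  exact (hc.memLp_of_hasCompactSupport hs).restrict Ω

theorem IsWeakDeriv.lin {Ω : Set (ℝ × ℝ)} {e : ℝ × ℝ} {u v g h : ℝ × ℝ → ℝ}
    (hu : MemLp u 2 (volume.restrict Ω)) (hv : MemLp v 2 (volume.restrict Ω))
    (hg : MemLp g 2 (volume.restrict Ω)) (hh : MemLp h 2 (volume.restrict Ω))
    (hug : IsWeakDeriv Ω e u g) (hvh : IsWeakDeriv Ω e v h) (c : ℝ) :
    IsWeakDeriv Ω e (fun p => u p + c * v p) (fun p => g p + c * h p) := by
  intro φ hφ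
  have i1 : Integrable (fun p => u p * fderiv ℝ φ p e) (volume.restrict Ω) :=
    hu.integrable_mul (hφ.memLp_fderiv e)
  have i2 : Integrable (fun p => c * (v p * fderiv ℝ φ p e)) (volume.restrict Ω) :=
    (hv.integrable_mul (hφ.memLp_fderiv e)).const_mul c
  have j1 : Integrable (fun p => g p * φ p) (volume.restrict Ω) := hg.integrable_mul hφ.memLp
  have j2 : Integrable (fun p => c * (h p * φ p)) (volume.restrict Ω) :=
    (hh.integrable_mul hφ.memLp).const_mul c
  have e1 : ∫ p in Ω, (u p + c * v p) * fderiv ℝ φ p e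
      = (∫ p in Ω, u p * fderiv ℝ φ p e) + c * ∫ p in Ω, v p * fderiv ℝ φ p e := by
    rw [← integral_const_mul, ← integral_add i1 i2]
    congr 1; funext p; ring
  have e2 : ∫ p in Ω, (g p + c * h p) * φ p
      = (∫ p in Ω, g p * φ p) + c * ∫ p in Ω, h p * φ p := by
    rw [← integral_const_mul, ← integral_add j1 j2]
    congr 1; funext p; ring
  rw [e1, e2, hug φ hφ, hvh φ hφ]
  ring

/-- The combination `u + c v` in `W^{1,2}(Ω)`. -/
def W12.lin {Ω : Set (ℝ × ℝ)} (u : W12 Ω) (c : ℝ) (v : W12 Ω) : W12 Ω where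
  toFun p := u.toFun p + c * v.toFun p
  dx p := u.dx p + c * v.dx p
  dy p := u.dy p + c * v.dy p
  memLp_toFun := u.memLp_toFun.add (v.memLp_toFun.const_mul c)
  memLp_dx := u.memLp_dx.add (v.memLp_dx.const_mul c)
  memLp_dy := u.memLp_dy.add (v.memLp_dy.const_mul c)
  weak_dx := IsWeakDeriv.lin u.memLp_toFun v.memLp_toFun u.memLp_dx v.memLp_dx
    u.weak_dx v.weak_dx c
  weak_dy := IsWeakDeriv.lin u.memLp_toFun v.memLp_toFun u.memLp_dy v.memLp_dy
    u.weak_dy v.weak_dy c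

/-- The squared `W^{1,2}(Ω)`-distance. -/
def W12.distSq {Ω : Set (ℝ × ℝ)} (u v : W12 Ω) : ℝ :=
  ∫ p in Ω, ((u.toFun p - v.toFun p) ^ 2 + (u.dx p - v.dx p) ^ 2 + (u.dy p - v.dy p) ^ 2)

/-- `u ∈ W^{1,2}_0(Ω)`, the closure in `W^{1,2}(Ω)` of the smooth functions with compact support
in `Ω`. -/
def W12.IsZeroBoundary {Ω : Set (ℝ × ℝ)} (u : W12 Ω) : Prop :=
  ∀ ε : ℝ, 0 < ε → ∃ φ : W12 Ω, IsTest Ω φ.toFun ∧ u.distSq φ < ε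

/-- `u = g` on `∂Ω` in the sense of `W^{1,2}(Ω)`: `u - G ∈ W^{1,2}_0(Ω)` for a Lipschitz extension
`G` of the boundary datum `g`. -/
def W12.HasBoundaryValue {Ω : Set (ℝ × ℝ)} (u : W12 Ω) (g : ℝ × ℝ → ℝ) : Prop :=
  ∃ G : W12 Ω, (∃ K : ℝ≥0, LipschitzWith K G.toFun) ∧ Set.EqOn G.toFun g (frontier Ω) ∧
    (u.lin (-1) G).IsZeroBoundary

/-- `u` has zero trace on `S` (a union of lines in the applications): `u` is a limit in
`W^{1,2}(Ω)` of Lipschitz functions that vanish on `S`. -/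
def W12.HasZeroTraceOn {Ω : Set (ℝ × ℝ)} (u : W12 Ω) (S : Set (ℝ × ℝ)) : Prop :=
  ∀ ε : ℝ, 0 < ε → ∃ φ : W12 Ω, (∃ K : ℝ≥0, LipschitzWith K φ.toFun) ∧
    (∀ p ∈ S, φ.toFun p = 0) ∧ u.distSq φ < ε

/-- The bulk energy density. -/
def bulk (A B C : ℝ) (q₁ q₂ q₃ : ℝ) : ℝ :=
  A * (q₁ ^ 2 + q₂ ^ 2 + 3 * q₃ ^ 2) + C * (q₁ ^ 2 + q₂ ^ 2 + 3 * q₃ ^ 2) ^ 2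
    + 2 * B * q₃ * (q₁ ^ 2 + q₂ ^ 2 - q₃ ^ 2)

/-- The elastic energy density with anisotropy `M`, as a function of the partial derivatives
`aᵢ = ∂ₓ qᵢ` and `bᵢ = ∂_y qᵢ`. -/
def elastic (M : ℝ) (a₁ b₁ a₂ b₂ a₃ b₃ : ℝ) : ℝ :=
  (1 + M / 2) * (a₁ ^ 2 + b₁ ^ 2) + (1 + M / 2) * (a₂ ^ 2 + b₂ ^ 2)
    + (3 + M / 2) * (a₃ ^ 2 + b₃ ^ 2)
    + M * (b₁ * b₃ - a₁ * a₃ - b₂ * a₃ - a₂ * b₃) + |M| * (b₂ * a₁ - b₁ * a₂)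

/-- The energy density at the point `p`. -/
def density (A B C L lam M : ℝ) {Ω : Set (ℝ × ℝ)} (q₁ q₂ q₃ : W12 Ω) (p : ℝ × ℝ) : ℝ :=
  elastic M (q₁.dx p) (q₁.dy p) (q₂.dx p) (q₂.dy p) (q₃.dx p) (q₃.dy p)
    + lam ^ 2 / L * bulk A B C (q₁.toFun p) (q₂.toFun p) (q₃.toFun p)

/-- The reduced energy `J`. -/
def energy (A B C L lam M : ℝ) {Ω : Set (ℝ × ℝ)} (q₁ q₂ q₃ : W12 Ω) : ℝ :=
  ∫ p in Ω, density A B C L lam M q₁ q₂ q₃ p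

/-- The preferred scalar order parameter `s₊`. -/
def sPlus (A B C : ℝ) : ℝ := (B + √(B ^ 2 + 24 * |A| * C)) / (4 * C)

/-- `f` is continuous on `[a, b]` and piecewise of class `C¹` there: `C¹` up to the end points on
each interval between consecutive points of a finite subdivision. -/
def PiecewiseC1 (f : ℝ → ℝ) (a b : ℝ) : Prop :=
  ContinuousOn f (Set.Icc a b) ∧
    ∃ F : Finset ℝ, a ∈ F ∧ b ∈ F ∧
      ∀ s ∈ F, ∀ t ∈ F, s < t → (∀ r ∈ F, r ∉ Set.Ioo s t) → ContDiffOn ℝ 1 f (Set.Icc s t)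

/-- `g` is a tangent boundary datum for `q₁` on the square of half-side `ℓ`, with order parameter
`s`: outside `d`-neighbourhoods of the vertices it is `s / 2` on the horizontal edges (director
along `x`) and `-s / 2` on the vertical ones (director along `y`); near the vertices these values
are joined in a continuous, piecewise `C¹` way, the same at all vertices. The value at the vertices
is then the average `0`. -/
def IsTangentDatum (ℓ s : ℝ) (g : ℝ × ℝ → ℝ) : Prop :=
  ∃ (τ : ℝ → ℝ) (d : ℝ), 0 < d ∧ d < ℓ ∧
    PiecewiseC1 τ (-ℓ) ℓ ∧ (∀ t ∈ Set.Icc (-ℓ) ℓ, τ (-t) = τ t) ∧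
    (∀ t ∈ Set.Icc (-(ℓ - d)) (ℓ - d), τ t = s / 2) ∧
    ∀ t ∈ Set.Icc (-ℓ) ℓ,
      g (t, ℓ) = τ t ∧ g (t, -ℓ) = τ t ∧ g (ℓ, t) = -τ t ∧ g (-ℓ, t) = -τ t

/-- The admissible class `𝒜₀`: `q₁ = g`, `q₂ = 0`, `q₃ = -s₊ / 6` on `∂Ω`. -/
def IsAdmissible (A B C : ℝ) (g : ℝ × ℝ → ℝ) {Ω : Set (ℝ × ℝ)} (q₁ q₂ q₃ : W12 Ω) : Prop :=
  q₁.HasBoundaryValue g ∧ q₂.HasBoundaryValue (fun _ => 0) ∧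
    q₃.HasBoundaryValue (fun _ => -sPlus A B C / 6)

/-- `(q₁, q₂, q₃)` is a critical point of `J` in the class of all triples with the same boundary
values: for every variation in `W^{1,2}_0(Ω; ℝ³)` the energy integral converges and the first
variation vanishes. -/
def IsCritical (A B C L lam M : ℝ) {Ω : Set (ℝ × ℝ)} (q₁ q₂ q₃ : W12 Ω) : Prop :=
  ∀ v₁ v₂ v₃ : W12 Ω, v₁.IsZeroBoundary → v₂.IsZeroBoundary → v₃.IsZeroBoundary →
    (∀ t : ℝ, IntegrableOn
      (density A B C L lam M (q₁.lin t v₁) (q₂.lin t v₂) (q₃.lin t v₃)) Ω) ∧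
    HasDerivAt
      (fun t : ℝ => energy A B C L lam M (q₁.lin t v₁) (q₂.lin t v₂) (q₃.lin t v₃)) 0 0

/-- `u` is odd on `Ω` with respect to `σ`. -/
def OddUnder (Ω : Set (ℝ × ℝ)) (σ : ℝ × ℝ → ℝ × ℝ) (u : W12 Ω) : Prop :=
  ∀ p ∈ Ω, u.toFun (σ p) = -u.toFun p

/-- `u` is even on `Ω` with respect to `σ`. -/
def EvenUnder (Ω : Set (ℝ × ℝ)) (σ : ℝ × ℝ → ℝ × ℝ) (u : W12 Ω) : Prop :=
  ∀ p ∈ Ω, u.toFun (σ p) = u.toFun p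

/-- Reflection about the `x`-axis. -/
def reflX (p : ℝ × ℝ) : ℝ × ℝ := (p.1, -p.2)

/-- Reflection about the `y`-axis. -/
def reflY (p : ℝ × ℝ) : ℝ × ℝ := (-p.1, p.2)

/-- Reflection about the diagonal `y = x`. -/
def reflD (p : ℝ × ℝ) : ℝ × ℝ := (p.2, p.1)

/-- Reflection about the diagonal `y = -x`. -/
def reflD' (p : ℝ × ℝ) : ℝ × ℝ := (-p.2, -p.1)

/-- The two diagonals of the square of half-side `ℓ`. -/
def diagonals (ℓ : ℝ) : Set (ℝ × ℝ) := {p | p ∈ square ℓ ∧ (p.2 = p.1 ∨ p.2 = -p.1)}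

/-- The parts of the coordinate axes in the square of half-side `ℓ`. -/
def axes (ℓ : ℝ) : Set (ℝ × ℝ) := {p | p ∈ square ℓ ∧ (p.2 = 0 ∨ p.1 = 0)}

end NematicSquare

end

/-!
The critical point is a minimizer of the energy among the triples that have the required parities
and boundary values, and symmetric criticality shows that it is critical among all triples.

*Symmetric competitors.* If `τ` is the tangent datum, extended to an even Lipschitz function on the
line, then `τ(x) - τ(y)` is even about the axes, odd about the diagonals, and has the boundary values
prescribed for `q₁`, because continuity at the vertices forces `τ(±ℓ) = 0`
(`IsTangentDatum.exists_extension`). For `q₂` and `q₃` the constants are symmetric extensions. Averages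
over the dihedral group, twisted by its characters, give a continuous projection (`symmetrize`) of
`W^{1,2}` onto the functions with given parities, which preserves `W^{1,2}_0`. The elements of `W12`
are functions and not classes, so the parities hold at every point.

*Existence.* For `M > -1` the elastic density is a uniformly positive definite quadratic form
(`elastic_ge`), as its anisotropic part is a sum of two squares up to multiples of the `|∇qᵢ|²`. The
bulk density is coercive, and convex up to a multiple of `|q|²`, as the quartic term controls the
second differences of the cubic one (`bulk_midpoint`). Hence the energy of the midpoint of two
competitors lies below the mean of their energies by a multiple of the squared `W^{1,2}`-distance,
up to the squared `L²`-distance (`density_midpoint`). By Rellich's theorem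
(`exists_subseq_integral_sq_lt`), which follows from the Poincaré inequality on the cells of fine
subdivisions, a minimizing sequence has a subsequence that is Cauchy in `L²`, hence Cauchy in
`W^{1,2}`; its limit is a minimizer by Fatou's lemma (`exists_forall_le_of_midpoint`,
`exists_symmetric_minimizer`). No weak convergence is used.

*Criticality.* The Sobolev embedding of `W^{1,2}_0` into `L⁴` (`memLp_four_of_mem_zeroBd`) makes the
energy finite, and on each line a polynomial in the parameter, with the expected derivative
(`hasDerivAt_energy`). At a symmetric triple the derivative density is equivariant under the
reflections, so the first variation in a direction equals the one in the symmetrized direction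
(`integral_dDensity_symmetrizeTriple`), which vanishes for the symmetric minimizer
(`exists_symmetric_critical`).

*Zero sets.* A function that is odd about a line vanishes on it. For traces, `W^{1,2}_0`-parts are
approximated by test functions, and symmetrizing these gives Lipschitz approximations that vanish on
the lines (`hasZeroTraceOn_of_hasParity`).
-/

open Filter Topology
open scoped ENNReal

noncomputable section

namespace NematicSquare

/-! ### `W^{1,2}` as a complete seminormed space -/

section

variable {Ω : Set (ℝ × ℝ)}

namespace W12

instance : Zero (W12 Ω) :=
  ⟨{ toFun := fun _ => 0, dx := fun _ => 0, dy := fun _ => 0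
     memLp_toFun := MemLp.zero', memLp_dx := MemLp.zero', memLp_dy := MemLp.zero'
     weak_dx := fun φ _ => by simp
     weak_dy := fun φ _ => by simp }⟩

instance : Add (W12 Ω) :=
  ⟨fun u v =>
   { toFun := fun p => u.toFun p + v.toFun p
     dx := fun p => u.dx p + v.dx p
     dy := fun p => u.dy p + v.dy p
     memLp_toFun := u.memLp_toFun.add v.memLp_toFun
     memLp_dx := u.memLp_dx.add v.memLp_dx
     memLp_dy := u.memLp_dy.add v.memLp_dy
     weak_dx := by simpa [W12.lin] using (u.lin 1 v).weak_dx
     weak_dy := by simpa [W12.lin] using (u.lin 1 v).weak_dy }⟩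

instance : SMul ℝ (W12 Ω) :=
  ⟨fun c u =>
   { toFun := fun p => c * u.toFun p
     dx := fun p => c * u.dx p
     dy := fun p => c * u.dy p
     memLp_toFun := u.memLp_toFun.const_mul c
     memLp_dx := u.memLp_dx.const_mul c
     memLp_dy := u.memLp_dy.const_mul c
     weak_dx := by
      have h := ((0 : W12 Ω).lin c u).weak_dx
      simp only [W12.lin] at h
      convert h using 2 <;> exact (zero_add _).symm
     weak_dy := by
      have h := ((0 : W12 Ω).lin c u).weak_dy
      simp only [W12.lin] at h
      convert h using 2 <;> exact (zero_add _).symm }⟩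

instance : Neg (W12 Ω) := ⟨fun u => (-1 : ℝ) • u⟩

@[simp] theorem zero_toFun (p : ℝ × ℝ) : (0 : W12 Ω).toFun p = 0 := rfl
@[simp] theorem zero_dx (p : ℝ × ℝ) : (0 : W12 Ω).dx p = 0 := rfl
@[simp] theorem zero_dy (p : ℝ × ℝ) : (0 : W12 Ω).dy p = 0 := rfl
@[simp] theorem add_toFun (u v : W12 Ω) (p : ℝ × ℝ) : (u + v).toFun p = u.toFun p + v.toFun p := rfl
@[simp] theorem add_dx (u v : W12 Ω) (p : ℝ × ℝ) : (u + v).dx p = u.dx p + v.dx p := rfl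
@[simp] theorem add_dy (u v : W12 Ω) (p : ℝ × ℝ) : (u + v).dy p = u.dy p + v.dy p := rfl
@[simp] theorem smul_toFun (c : ℝ) (u : W12 Ω) (p : ℝ × ℝ) : (c • u).toFun p = c * u.toFun p := rfl
@[simp] theorem smul_dx (c : ℝ) (u : W12 Ω) (p : ℝ × ℝ) : (c • u).dx p = c * u.dx p := rfl
@[simp] theorem smul_dy (c : ℝ) (u : W12 Ω) (p : ℝ × ℝ) : (c • u).dy p = c * u.dy p := rfl
@[simp] theorem neg_toFun (u : W12 Ω) (p : ℝ × ℝ) : (-u).toFun p = -u.toFun p := neg_one_mul _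
@[simp] theorem neg_dx (u : W12 Ω) (p : ℝ × ℝ) : (-u).dx p = -u.dx p := neg_one_mul _
@[simp] theorem neg_dy (u : W12 Ω) (p : ℝ × ℝ) : (-u).dy p = -u.dy p := neg_one_mul _

theorem ext_apply {u v : W12 Ω} (h0 : ∀ p, u.toFun p = v.toFun p) (h1 : ∀ p, u.dx p = v.dx p)
    (h2 : ∀ p, u.dy p = v.dy p) : u = v :=
  W12.ext (funext h0) (funext h1) (funext h2)

instance : AddCommGroup (W12 Ω) where
  add_assoc u v w := by apply ext_apply <;> intro p <;> simp <;> ring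
  zero_add u := by apply ext_apply <;> intro p <;> simp
  add_zero u := by apply ext_apply <;> intro p <;> simp
  neg_add_cancel u := by apply ext_apply <;> intro p <;> simp
  add_comm u v := by apply ext_apply <;> intro p <;> simp <;> ring
  nsmul := nsmulRec
  zsmul := zsmulRec

instance : Module ℝ (W12 Ω) where
  one_smul u := by apply ext_apply <;> intro p <;> simp
  mul_smul a b u := by apply ext_apply <;> intro p <;> simp <;> ring
  smul_zero a := by apply ext_apply <;> intro p <;> simp
  smul_add a u v := by apply ext_apply <;> intro p <;> simp <;> ring
  add_smul a b u := by apply ext_apply <;> intro p <;> simp <;> ring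
  zero_smul u := by apply ext_apply <;> intro p <;> simp

@[simp] theorem sub_toFun (u v : W12 Ω) (p : ℝ × ℝ) :
    (u - v).toFun p = u.toFun p - v.toFun p := by simp [sub_eq_add_neg]
@[simp] theorem sub_dx (u v : W12 Ω) (p : ℝ × ℝ) : (u - v).dx p = u.dx p - v.dx p := by
  simp [sub_eq_add_neg]
@[simp] theorem sub_dy (u v : W12 Ω) (p : ℝ × ℝ) : (u - v).dy p = u.dy p - v.dy p := by
  simp [sub_eq_add_neg]

theorem lin_eq (u : W12 Ω) (c : ℝ) (v : W12 Ω) : u.lin c v = u + c • v := rfl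

variable (Ω) in
/-- The linear map `u ↦ (u, ∂ₓ u, ∂_y u)` from `W^{1,2}(Ω)` to the classes in `L²(Ω)³`. -/
def toLp3 : W12 Ω →ₗ[ℝ] Lp ℝ 2 (volume.restrict Ω) × Lp ℝ 2 (volume.restrict Ω) ×
    Lp ℝ 2 (volume.restrict Ω) where
  toFun u := (u.memLp_toFun.toLp _, u.memLp_dx.toLp _, u.memLp_dy.toLp _)
  map_add' _ _ := rfl
  map_smul' _ _ := rfl

/-- The seminorm is the maximum of the `L²`-norms of `u`, `∂ₓ u`, `∂_y u`. It is only a seminorm,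
since elements of `W12 Ω` are functions rather than classes. -/
instance : SeminormedAddCommGroup (W12 Ω) := SeminormedAddCommGroup.induced _ _ (toLp3 Ω)

instance : NormedSpace ℝ (W12 Ω) := NormedSpace.induced ℝ _ _ (toLp3 Ω)

theorem isUniformInducing_toLp3 : IsUniformInducing (toLp3 Ω) := ⟨rfl⟩

theorem norm_eq (u : W12 Ω) : ‖u‖ = ‖toLp3 Ω u‖ := rfl

theorem continuous_toLp3 : Continuous (toLp3 Ω) := isUniformInducing_toLp3.isInducing.continuous

end W12

theorem inner_toLp {μ : Measure (ℝ × ℝ)} {f g : ℝ × ℝ → ℝ} (hf : MemLp f 2 μ)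
    (hg : MemLp g 2 μ) : inner ℝ (hf.toLp f) (hg.toLp g) = ∫ p, f p * g p ∂μ := by
  rw [L2.inner_def]
  refine integral_congr_ae ?_
  filter_upwards [hf.coeFn_toLp, hg.coeFn_toLp] with p h1 h2
  rw [h1, h2]
  simp [mul_comm]

theorem norm_sq_toLp {μ : Measure (ℝ × ℝ)} {f : ℝ × ℝ → ℝ} (hf : MemLp f 2 μ) :
    ‖hf.toLp f‖ ^ 2 = ∫ p, f p ^ 2 ∂μ := by
  rw [← real_inner_self_eq_norm_sq, inner_toLp]
  simp [sq]

namespace W12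

theorem integral_sq_add_sq_add_sq (u : W12 Ω) :
    ∫ p in Ω, (u.toFun p ^ 2 + u.dx p ^ 2 + u.dy p ^ 2)
      = (∫ p in Ω, u.toFun p ^ 2) + (∫ p in Ω, u.dx p ^ 2) + ∫ p in Ω, u.dy p ^ 2 := by
  have h0 := u.memLp_toFun.integrable_sq
  have h1 := u.memLp_dx.integrable_sq
  have h2 := u.memLp_dy.integrable_sq
  have h01 : Integrable (fun p => u.toFun p ^ 2 + u.dx p ^ 2) (volume.restrict Ω) := h0.add h1
  rw [integral_add h01 h2, integral_add h0 h1]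

theorem norm_sq_le (u : W12 Ω) :
    ‖u‖ ^ 2 ≤ ∫ p in Ω, (u.toFun p ^ 2 + u.dx p ^ 2 + u.dy p ^ 2) := by
  have h0 := norm_sq_toLp u.memLp_toFun
  have h1 := norm_sq_toLp u.memLp_dx
  have h2 := norm_sq_toLp u.memLp_dy
  rw [integral_sq_add_sq_add_sq, ← h0, ← h1, ← h2, norm_eq]
  have key : ∀ a b c : ℝ, max a (max b c) ^ 2 ≤ a ^ 2 + b ^ 2 + c ^ 2 := fun a b c => by
    rcases max_choice a (max b c) with h | h <;> rcases max_choice b c with h' | h' <;>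
      rw [h] <;> try rw [h']
    all_goals nlinarith [sq_nonneg a, sq_nonneg b, sq_nonneg c]
  exact key _ _ _

theorem integral_toFun_sq_le (u : W12 Ω) : ∫ p in Ω, u.toFun p ^ 2 ≤ ‖u‖ ^ 2 := by
  rw [← norm_sq_toLp u.memLp_toFun]
  gcongr
  exact le_max_left _ _

theorem integral_dx_sq_le (u : W12 Ω) : ∫ p in Ω, u.dx p ^ 2 ≤ ‖u‖ ^ 2 := by
  rw [← norm_sq_toLp u.memLp_dx]
  gcongr
  exact (le_max_left _ _).trans (le_max_right _ _)

theorem integral_dy_sq_le (u : W12 Ω) : ∫ p in Ω, u.dy p ^ 2 ≤ ‖u‖ ^ 2 := by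
  rw [← norm_sq_toLp u.memLp_dy]
  gcongr
  exact (le_max_right _ _).trans (le_max_right _ _)

theorem distSq_eq (u v : W12 Ω) : u.distSq v =
    ∫ p in Ω, ((u - v).toFun p ^ 2 + (u - v).dx p ^ 2 + (u - v).dy p ^ 2) := by
  simp [distSq]

theorem norm_sub_sq_le_distSq (u v : W12 Ω) : ‖u - v‖ ^ 2 ≤ u.distSq v := by
  rw [distSq_eq]; exact norm_sq_le _

theorem distSq_le_norm_sub_sq (u v : W12 Ω) : u.distSq v ≤ 3 * ‖u - v‖ ^ 2 := by
  have h0 := integral_toFun_sq_le (u - v)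
  have h1 := integral_dx_sq_le (u - v)
  have h2 := integral_dy_sq_le (u - v)
  rw [distSq_eq, integral_sq_add_sq_add_sq]
  linarith

variable (Ω) in
/-- The space of smooth functions with compact support in `Ω`, as a subspace of `W^{1,2}(Ω)`. -/
def tests : Submodule ℝ (W12 Ω) where
  carrier := {φ | IsTest Ω φ.toFun}
  add_mem' {φ ψ} h k :=
    { smooth := h.smooth.add k.smooth
      compact := h.compact.add k.compact
      support := (tsupport_add _ _).trans (Set.union_subset h.support k.support) }
  zero_mem' :=
    { smooth := contDiff_const
      compact := HasCompactSupport.zero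
      support := by
        change tsupport (fun _ => (0 : ℝ)) ⊆ Ω
        simp [tsupport] }
  smul_mem' c φ h :=
    { smooth := contDiff_const.mul h.smooth
      compact := h.compact.mul_left
      support := (closure_mono (Function.support_mul_subset_right _ _)).trans h.support }

variable (Ω) in
/-- The space `W^{1,2}_0(Ω)`. -/
def zeroBd : Submodule ℝ (W12 Ω) := (tests Ω).topologicalClosure

theorem mem_closure_iff_distSq {S : Set (W12 Ω)} {u : W12 Ω} :
    u ∈ closure S ↔ ∀ ε : ℝ, 0 < ε → ∃ φ ∈ S, u.distSq φ < ε := by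
  rw [Metric.mem_closure_iff]
  constructor
  · intro h ε hε
    obtain ⟨φ, hφ, hd⟩ := h (√(ε / 3)) (by positivity)
    refine ⟨φ, hφ, (distSq_le_norm_sub_sq u φ).trans_lt ?_⟩
    rw [dist_eq_norm, Real.lt_sqrt (norm_nonneg _)] at hd
    linarith
  · intro h ε hε
    obtain ⟨φ, hφ, hd⟩ := h (ε ^ 2) (by positivity)
    refine ⟨φ, hφ, ?_⟩
    rw [dist_eq_norm]
    exact lt_of_pow_lt_pow_left₀ 2 hε.le ((norm_sub_sq_le_distSq u φ).trans_lt hd)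

theorem isZeroBoundary_iff {u : W12 Ω} : u.IsZeroBoundary ↔ u ∈ zeroBd Ω :=
  mem_closure_iff_distSq.symm

/-- Completeness of `W^{1,2}`: the weak derivative relation tested with one function is an equation
between `L²`-pairings, hence closed. -/
theorem isClosed_range_toLp3 : IsClosed (Set.range (toLp3 Ω)) := by
  have key : Set.range (toLp3 Ω) = ⋂ (φ : ℝ × ℝ → ℝ) (h : IsTest Ω φ),
      ({x | inner ℝ x.1 ((h.memLp_fderiv (1, 0)).toLp _) = -inner ℝ x.2.1 (h.memLp.toLp _)} ∩
       {x | inner ℝ x.1 ((h.memLp_fderiv (0, 1)).toLp _) = -inner ℝ x.2.2 (h.memLp.toLp _)}) := by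
    ext x
    simp only [Set.mem_range, Set.mem_iInter, Set.mem_inter_iff, Set.mem_ofPred_eq]
    constructor
    · rintro ⟨u, rfl⟩ φ h
      constructor
      · exact (inner_toLp u.memLp_toFun (h.memLp_fderiv (1, 0))).trans
          ((u.weak_dx φ h).trans (congrArg Neg.neg (inner_toLp u.memLp_dx h.memLp).symm))
      · exact (inner_toLp u.memLp_toFun (h.memLp_fderiv (0, 1))).trans
          ((u.weak_dy φ h).trans (congrArg Neg.neg (inner_toLp u.memLp_dy h.memLp).symm))
    · intro hx
      refine ⟨⟨x.1, x.2.1, x.2.2, Lp.memLp _, Lp.memLp _, Lp.memLp _, ?_, ?_⟩, ?_⟩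
      · intro φ h
        have := (hx φ h).1
        rw [← Lp.toLp_coeFn x.1 (Lp.memLp _), ← Lp.toLp_coeFn x.2.1 (Lp.memLp _), inner_toLp,
          inner_toLp] at this
        exact this
      · intro φ h
        have := (hx φ h).2
        rw [← Lp.toLp_coeFn x.1 (Lp.memLp _), ← Lp.toLp_coeFn x.2.2 (Lp.memLp _), inner_toLp,
          inner_toLp] at this
        exact this
      · exact Prod.ext (Lp.toLp_coeFn _ (Lp.memLp _))
          (Prod.ext (Lp.toLp_coeFn _ (Lp.memLp _)) (Lp.toLp_coeFn _ (Lp.memLp _)))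
  rw [key]
  refine isClosed_iInter fun φ => isClosed_iInter fun h => IsClosed.inter ?_ ?_
  · exact isClosed_eq (by fun_prop) (by fun_prop)
  · exact isClosed_eq (by fun_prop) (by fun_prop)

instance : CompleteSpace (W12 Ω) :=
  (completeSpace_iff_isComplete_range isUniformInducing_toLp3).2 isClosed_range_toLp3.isComplete

theorem memLp_of_lipschitz (hΩ : IsOpen Ω) (hb : Bornology.IsBounded Ω) {f : ℝ × ℝ → ℝ}
    {K : ℝ≥0} (hf : LipschitzWith K f) (r : ℝ≥0∞) : MemLp f r (volume.restrict Ω) := by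
  have : IsFiniteMeasure (volume.restrict Ω) :=
    ⟨by rw [Measure.restrict_apply_univ]; exact hb.measure_lt_top⟩
  obtain ⟨R, hR⟩ := hb.exists_norm_le
  refine MemLp.of_bound hf.continuous.aestronglyMeasurable (‖f 0‖ + K * R) ?_
  refine (ae_restrict_iff' hΩ.measurableSet).2 (Eventually.of_forall fun p hp => ?_)
  have h1 := hf.dist_le_mul p 0
  rw [dist_eq_norm, dist_zero_right] at h1
  have h2 : ‖f p‖ ≤ ‖f 0‖ + ‖f p - f 0‖ := by
    simpa using norm_add_le (f 0) (f p - f 0)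
  have h3 : (K : ℝ) * ‖p‖ ≤ K * R := by gcongr; exact hR p hp
  linarith

/-- A globally Lipschitz function as an element of `W^{1,2}(Ω)`, for bounded `Ω`. Rademacher's
theorem provides the derivatives. -/
theorem exists_of_lipschitz (hΩ : IsOpen Ω) (hb : Bornology.IsBounded Ω) {f : ℝ × ℝ → ℝ}
    {K : ℝ≥0} (hf : LipschitzWith K f) :
    ∃ u : W12 Ω, u.toFun = f ∧ (∀ p, u.dx p = lineDeriv ℝ f p (1, 0)) ∧
      ∀ p, u.dy p = lineDeriv ℝ f p (0, 1) := by
  have : IsFiniteMeasure (volume.restrict Ω) :=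
    ⟨by rw [Measure.restrict_apply_univ]; exact hb.measure_lt_top⟩
  have hline : ∀ e, MemLp (fun p => lineDeriv ℝ f p e) 2 (volume.restrict Ω) := fun e =>
    MemLp.of_bound (measurable_lineDeriv hf.continuous).aestronglyMeasurable (K * ‖e‖)
      (Eventually.of_forall fun p => norm_lineDeriv_le_of_lipschitz ℝ hf)
  have hweak : ∀ e, IsWeakDeriv Ω e f (fun p => lineDeriv ℝ f p e) := by
    intro e φ h
    obtain ⟨D, hD⟩ := (h.smooth.of_le (by simp)).lipschitzWith_of_hasCompactSupport h.compact
      (n := 1) (by simp)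
    have := hf.integral_lineDeriv_mul_eq (μ := volume) hD h.compact e
    have e1 : ∫ p in Ω, f p * fderiv ℝ φ p e = ∫ p, f p * fderiv ℝ φ p e := by
      refine setIntegral_eq_integral_of_forall_compl_eq_zero fun p hp => ?_
      have : fderiv ℝ φ p = 0 := by
        have : p ∉ tsupport (fderiv ℝ φ) := fun h' => hp (h.support (tsupport_fderiv_subset ℝ h'))
        exact image_eq_zero_of_notMem_tsupport this
      simp [this]
    have e2 : ∫ p in Ω, lineDeriv ℝ f p e * φ p = ∫ p, lineDeriv ℝ f p e * φ p := by
      refine setIntegral_eq_integral_of_forall_compl_eq_zero fun p hp => ?_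
      have : φ p = 0 := image_eq_zero_of_notMem_tsupport fun h' => hp (h.support h')
      simp [this]
    rw [e1, e2, this, ← integral_neg]
    congr 1; funext p
    rw [((h.smooth.differentiable (by simp)) p).lineDeriv_eq_fderiv]
    simp [mul_comm]
  exact ⟨⟨f, _, _, memLp_of_lipschitz hΩ hb hf 2, hline _, hline _, hweak _, hweak _⟩, rfl, fun _ => rfl, fun _ => rfl⟩

end W12

theorem IsWeakDeriv.ae_eq (hΩ : IsOpen Ω) {e : ℝ × ℝ} {u g h : ℝ × ℝ → ℝ}
    (hg : MemLp g 2 (volume.restrict Ω)) (hh : MemLp h 2 (volume.restrict Ω))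
    (hug : IsWeakDeriv Ω e u g) (huh : IsWeakDeriv Ω e u h) :
    ∀ᵐ p ∂volume.restrict Ω, g p = h p := by
  have hloc : LocallyIntegrableOn (fun p => g p - h p) Ω volume := by
    have := (hg.sub hh).locallyIntegrable (by norm_num)
    exact (locallyIntegrableOn_of_locallyIntegrable_restrict this)
  have := hΩ.ae_eq_zero_of_integral_contDiff_smul_eq_zero (μ := volume) hloc (fun φ h1 h2 h3 => by
    have ht : IsTest Ω φ := ⟨h1, h2, h3⟩
    have hm := ht.memLp
    have e0 : ∫ p in Ω, g p * φ p = ∫ p in Ω, h p * φ p := by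
      have := hug φ ht
      rw [huh φ ht] at this
      linarith
    have e1 : ∫ p, φ p • (g p - h p) = ∫ p in Ω, φ p • (g p - h p) := by
      refine (setIntegral_eq_integral_of_forall_compl_eq_zero fun p hp => ?_).symm
      have : φ p = 0 := image_eq_zero_of_notMem_tsupport fun h' => hp (h3 h')
      simp [this]
    rw [e1]
    have e2 : ∫ p in Ω, φ p • (g p - h p)
        = (∫ p in Ω, g p * φ p) - ∫ p in Ω, h p * φ p := by
      rw [← integral_sub (f := fun p => g p * φ p) (g := fun p => h p * φ p)
        (hg.integrable_mul hm) (hh.integrable_mul hm)]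
      congr 1; funext p; simp; ring
    rw [e2, e0, sub_self])
  rw [ae_restrict_iff' hΩ.measurableSet]
  filter_upwards [this] with p hp hpΩ
  exact sub_eq_zero.1 (hp hpΩ)

/-- The classical derivatives of a test function are its weak derivatives. -/
theorem IsTest.isWeakDeriv {φ : ℝ × ℝ → ℝ} (h : IsTest Ω φ) (e : ℝ × ℝ) :
    IsWeakDeriv Ω e φ (fun p => fderiv ℝ φ p e) := by
  intro ψ k
  have e1 : ∫ p in Ω, φ p * fderiv ℝ ψ p e = ∫ p, φ p * fderiv ℝ ψ p e := by
    refine setIntegral_eq_integral_of_forall_compl_eq_zero fun p hp => ?_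
    have : φ p = 0 := image_eq_zero_of_notMem_tsupport fun h' => hp (h.support h')
    simp [this]
  have e2 : ∫ p in Ω, fderiv ℝ φ p e * ψ p = ∫ p, fderiv ℝ φ p e * ψ p := by
    refine setIntegral_eq_integral_of_forall_compl_eq_zero fun p hp => ?_
    have : ψ p = 0 := image_eq_zero_of_notMem_tsupport fun h' => hp (k.support h')
    simp [this]
  have hdφ : Continuous (fun p => fderiv ℝ φ p e) :=
    (h.smooth.continuous_fderiv (by simp)).clm_apply continuous_const
  have hdψ : Continuous (fun p => fderiv ℝ ψ p e) :=
    (k.smooth.continuous_fderiv (by simp)).clm_apply continuous_const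
  rw [e1, e2]
  refine integral_mul_fderiv_eq_neg_fderiv_mul_of_integrable ?_ ?_ ?_
    (fun p _ => h.smooth.differentiable (by simp) p)
    (fun p _ => k.smooth.differentiable (by simp) p)
  · exact (hdφ.mul k.smooth.continuous).integrable_of_hasCompactSupport k.compact.mul_left
  · exact (h.smooth.continuous.mul hdψ).integrable_of_hasCompactSupport h.compact.mul_right
  · exact (h.smooth.continuous.mul k.smooth.continuous).integrable_of_hasCompactSupport
      h.compact.mul_right

end

/-! ### Reflections and symmetrization -/

section

variable {Ω : Set (ℝ × ℝ)}

/-- A linear, measure preserving involution of the plane that maps `Ω` to itself. -/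
structure Reflection (Ω : Set (ℝ × ℝ)) where
  /-- the linear map -/
  map : (ℝ × ℝ) →L[ℝ] ℝ × ℝ
  invol : ∀ p, map (map p) = p
  measurePreserving : MeasurePreserving map volume volume
  mem_iff : ∀ p, map p ∈ Ω ↔ p ∈ Ω

namespace Reflection

variable (σ : Reflection Ω)

theorem measurableEmbedding : MeasurableEmbedding σ.map :=
  (MeasurableEquiv.mk (Equiv.mk σ.map σ.map σ.invol σ.invol)
    σ.map.continuous.measurable σ.map.continuous.measurable).measurableEmbedding

theorem measurePreserving_restrict :
    MeasurePreserving σ.map (volume.restrict Ω) (volume.restrict Ω) := by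
  have h := σ.measurePreserving.restrict_preimage_emb σ.measurableEmbedding Ω
  rwa [show σ.map ⁻¹' Ω = Ω from Set.ext σ.mem_iff] at h

theorem setIntegral_comp (f : ℝ × ℝ → ℝ) : ∫ p in Ω, f (σ.map p) = ∫ p in Ω, f p :=
  σ.measurePreserving_restrict.integral_comp σ.measurableEmbedding f

theorem memLp_comp {f : ℝ × ℝ → ℝ} (hf : MemLp f 2 (volume.restrict Ω)) :
    MemLp (fun p => f (σ.map p)) 2 (volume.restrict Ω) :=
  hf.comp_measurePreserving σ.measurePreserving_restrict

theorem isTest_comp {φ : ℝ × ℝ → ℝ} (h : IsTest Ω φ) : IsTest Ω (fun p => φ (σ.map p)) where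
  smooth := h.smooth.comp σ.map.contDiff
  compact := by
    exact h.compact.comp_isClosedEmbedding (Homeomorph.isClosedEmbedding
      ⟨Equiv.mk σ.map σ.map σ.invol σ.invol, σ.map.continuous, σ.map.continuous⟩)
  support := fun p hp => by
    have : σ.map p ∈ tsupport φ := tsupport_comp_subset_preimage φ σ.map.continuous hp
    exact (σ.mem_iff p).1 (h.support this)

theorem eq_smul_add_smul (v : ℝ × ℝ) : v = v.1 • ((1 : ℝ), (0 : ℝ)) + v.2 • ((0 : ℝ), (1 : ℝ)) := by
  ext <;> simp

/-- The chain rule for weak derivatives. -/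
theorem isWeakDeriv_comp (u : W12 Ω) (e : ℝ × ℝ) :
    IsWeakDeriv Ω e (fun p => u.toFun (σ.map p))
      (fun p => (σ.map e).1 * u.dx (σ.map p) + (σ.map e).2 * u.dy (σ.map p)) := by
  intro φ h
  have hψ := σ.isTest_comp h
  have hD : ∀ p, fderiv ℝ φ (σ.map p) e
      = (σ.map e).1 * fderiv ℝ (fun p => φ (σ.map p)) p (1, 0)
        + (σ.map e).2 * fderiv ℝ (fun p => φ (σ.map p)) p (0, 1) := by
    intro p
    have hc : fderiv ℝ (fun p => φ (σ.map p)) p = (fderiv ℝ φ (σ.map p)).comp σ.map :=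
      ((h.smooth.differentiable (by simp) _).hasFDerivAt.comp p σ.map.hasFDerivAt).fderiv
    rw [← smul_eq_mul, ← smul_eq_mul, ← map_smul, ← map_smul, ← map_add, ← eq_smul_add_smul, hc]
    simp [σ.invol]
  have e1 := σ.setIntegral_comp (fun p => u.toFun (σ.map p) * fderiv ℝ φ p e)
  have e2 := σ.setIntegral_comp
    (fun p => ((σ.map e).1 * u.dx (σ.map p) + (σ.map e).2 * u.dy (σ.map p)) * φ p)
  simp only [σ.invol] at e1 e2
  rw [← e1, ← e2]
  have a1 := u.weak_dx _ hψ
  have a2 := u.weak_dy _ hψ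
  have i1 : Integrable (fun p => u.toFun p * fderiv ℝ (fun p => φ (σ.map p)) p (1, 0))
    (volume.restrict Ω) := u.memLp_toFun.integrable_mul (hψ.memLp_fderiv _)
  have i2 : Integrable (fun p => u.toFun p * fderiv ℝ (fun p => φ (σ.map p)) p (0, 1))
    (volume.restrict Ω) := u.memLp_toFun.integrable_mul (hψ.memLp_fderiv _)
  have j1 : Integrable (fun p => u.dx p * φ (σ.map p)) (volume.restrict Ω) :=
    u.memLp_dx.integrable_mul hψ.memLp
  have j2 : Integrable (fun p => u.dy p * φ (σ.map p)) (volume.restrict Ω) :=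
    u.memLp_dy.integrable_mul hψ.memLp
  calc ∫ p in Ω, u.toFun p * fderiv ℝ φ (σ.map p) e
      = ∫ p in Ω, ((σ.map e).1 * (u.toFun p * fderiv ℝ (fun p => φ (σ.map p)) p (1, 0))
        + (σ.map e).2 * (u.toFun p * fderiv ℝ (fun p => φ (σ.map p)) p (0, 1))) := by
        congr 1; funext p; rw [hD]; ring
    _ = (σ.map e).1 * -(∫ p in Ω, u.dx p * φ (σ.map p))
        + (σ.map e).2 * -∫ p in Ω, u.dy p * φ (σ.map p) := by
        rw [integral_add (i1.const_mul _) (i2.const_mul _), integral_const_mul,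
          integral_const_mul, a1, a2]
    _ = -∫ p in Ω, ((σ.map e).1 * (u.dx p * φ (σ.map p))
        + (σ.map e).2 * (u.dy p * φ (σ.map p))) := by
        rw [integral_add (j1.const_mul _) (j2.const_mul _), integral_const_mul,
          integral_const_mul]
        ring
    _ = _ := by congr 2; funext p; ring

/-- The composition `u ∘ σ`, as a linear map on `W^{1,2}(Ω)`. -/
def pullₗ : W12 Ω →ₗ[ℝ] W12 Ω where
  toFun u :=
  { toFun := fun p => u.toFun (σ.map p)
    dx := fun p => (σ.map (1, 0)).1 * u.dx (σ.map p) + (σ.map (1, 0)).2 * u.dy (σ.map p)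
    dy := fun p => (σ.map (0, 1)).1 * u.dx (σ.map p) + (σ.map (0, 1)).2 * u.dy (σ.map p)
    memLp_toFun := σ.memLp_comp u.memLp_toFun
    memLp_dx := ((σ.memLp_comp u.memLp_dx).const_mul _).add ((σ.memLp_comp u.memLp_dy).const_mul _)
    memLp_dy := ((σ.memLp_comp u.memLp_dx).const_mul _).add ((σ.memLp_comp u.memLp_dy).const_mul _)
    weak_dx := σ.isWeakDeriv_comp u _
    weak_dy := σ.isWeakDeriv_comp u _ }
  map_add' u v := by apply W12.ext_apply <;> intro p <;> simp <;> ring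
  map_smul' c u := by apply W12.ext_apply <;> intro p <;> simp <;> ring

theorem norm_pullₗ_le (u : W12 Ω) : ‖σ.pullₗ u‖ ≤ √(1 + 8 * ‖σ.map‖ ^ 2) * ‖u‖ := by
  refine abs_le_of_sq_le_sq' ?_ (by positivity) |>.2
  rw [mul_pow, Real.sq_sqrt (by positivity)]
  refine (W12.norm_sq_le _).trans ?_
  have hN : ∀ e : ℝ × ℝ, ‖e‖ ≤ 1 → |(σ.map e).1| ≤ ‖σ.map‖ ∧ |(σ.map e).2| ≤ ‖σ.map‖ := by
    intro e he
    have h := (σ.map.le_opNorm e).trans (mul_le_of_le_one_right (norm_nonneg _) he)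
    exact ⟨(norm_fst_le (σ.map e)).trans h, (norm_snd_le (σ.map e)).trans h⟩
  obtain ⟨ha, hb⟩ := hN (1, 0) (by simp [Prod.norm_def])
  obtain ⟨hc, hd⟩ := hN (0, 1) (by simp [Prod.norm_def])
  have key : ∀ a b x y : ℝ, |a| ≤ ‖σ.map‖ → |b| ≤ ‖σ.map‖ →
      (a * x + b * y) ^ 2 ≤ 2 * ‖σ.map‖ ^ 2 * x ^ 2 + 2 * ‖σ.map‖ ^ 2 * y ^ 2 := by
    intro a b x y ha hb
    have h1 : a ^ 2 ≤ ‖σ.map‖ ^ 2 := sq_le_sq.2 (by rwa [abs_norm])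
    have h2 : b ^ 2 ≤ ‖σ.map‖ ^ 2 := sq_le_sq.2 (by rwa [abs_norm])
    nlinarith [sq_nonneg (a * x - b * y), mul_le_mul_of_nonneg_right h1 (sq_nonneg x),
      mul_le_mul_of_nonneg_right h2 (sq_nonneg y)]
  set N := ‖σ.map‖
  have i0 : Integrable (fun p => u.toFun p ^ 2) (volume.restrict Ω) := u.memLp_toFun.integrable_sq
  have i1 : Integrable (fun p => u.dx p ^ 2) (volume.restrict Ω) := u.memLp_dx.integrable_sq
  have i2 : Integrable (fun p => u.dy p ^ 2) (volume.restrict Ω) := u.memLp_dy.integrable_sq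
  have h12 := (i1.const_mul (4 * N ^ 2)).add (i2.const_mul (4 * N ^ 2))
  have hint : Integrable (fun p => u.toFun p ^ 2 + (4 * N ^ 2 * u.dx p ^ 2
      + 4 * N ^ 2 * u.dy p ^ 2)) (volume.restrict Ω) := i0.add h12
  calc ∫ p in Ω, ((σ.pullₗ u).toFun p ^ 2 + (σ.pullₗ u).dx p ^ 2 + (σ.pullₗ u).dy p ^ 2)
      ≤ ∫ p in Ω, (fun p => u.toFun p ^ 2 + (4 * N ^ 2 * u.dx p ^ 2
        + 4 * N ^ 2 * u.dy p ^ 2)) (σ.map p) := by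
        refine integral_mono (((σ.pullₗ u).memLp_toFun.integrable_sq.add
          (σ.pullₗ u).memLp_dx.integrable_sq).add (σ.pullₗ u).memLp_dy.integrable_sq)
          (σ.measurePreserving_restrict.integrable_comp_of_integrable hint) fun p => ?_
        have k1 := key _ _ (u.dx (σ.map p)) (u.dy (σ.map p)) ha hb
        have k2 := key _ _ (u.dx (σ.map p)) (u.dy (σ.map p)) hc hd
        simp only [pullₗ, LinearMap.coe_mk, AddHom.coe_mk]
        linarith
    _ = (∫ p in Ω, u.toFun p ^ 2) + (4 * N ^ 2 * (∫ p in Ω, u.dx p ^ 2)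
        + 4 * N ^ 2 * ∫ p in Ω, u.dy p ^ 2) := by
        refine (σ.setIntegral_comp _).trans ((integral_add i0 h12).trans ?_)
        simp only [Pi.add_apply]
        rw [integral_add (i1.const_mul _) (i2.const_mul _), integral_const_mul, integral_const_mul]
    _ ≤ ‖u‖ ^ 2 + (4 * N ^ 2 * ‖u‖ ^ 2 + 4 * N ^ 2 * ‖u‖ ^ 2) := by
        gcongr
        · exact u.integral_toFun_sq_le
        · exact u.integral_dx_sq_le
        · exact u.integral_dy_sq_le
    _ = (1 + 8 * N ^ 2) * ‖u‖ ^ 2 := by ring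

/-- The composition `u ∘ σ`, as a continuous linear map on `W^{1,2}(Ω)`. -/
def pull : W12 Ω →L[ℝ] W12 Ω := σ.pullₗ.mkContinuous _ σ.norm_pullₗ_le

@[simp] theorem pull_toFun (u : W12 Ω) (p : ℝ × ℝ) :
    (σ.pull u).toFun p = u.toFun (σ.map p) := rfl

theorem pull_dx (u : W12 Ω) (p : ℝ × ℝ) : (σ.pull u).dx p
    = (σ.map (1, 0)).1 * u.dx (σ.map p) + (σ.map (1, 0)).2 * u.dy (σ.map p) := rfl

theorem pull_dy (u : W12 Ω) (p : ℝ × ℝ) : (σ.pull u).dy p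
    = (σ.map (0, 1)).1 * u.dx (σ.map p) + (σ.map (0, 1)).2 * u.dy (σ.map p) := rfl

theorem pull_mem_tests {u : W12 Ω} (h : u ∈ W12.tests Ω) : σ.pull u ∈ W12.tests Ω :=
  σ.isTest_comp h

theorem pull_mem_zeroBd {u : W12 Ω} (h : u ∈ W12.zeroBd Ω) : σ.pull u ∈ W12.zeroBd Ω :=
  map_mem_closure σ.pull.continuous h fun _ h => σ.pull_mem_tests h

theorem pull_pull (u : W12 Ω) : σ.pull (σ.pull u) = u := by
  have h1 := σ.invol (1, 0)
  have h2 := σ.invol (0, 1)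
  rw [eq_smul_add_smul (σ.map (1, 0)), map_add, map_smul, map_smul, Prod.ext_iff] at h1
  rw [eq_smul_add_smul (σ.map (0, 1)), map_add, map_smul, map_smul, Prod.ext_iff] at h2
  simp only [Prod.fst_add, Prod.snd_add, Prod.smul_fst, Prod.smul_snd, smul_eq_mul] at h1 h2
  apply W12.ext_apply <;> intro p
  · simp [σ.invol]
  · simp only [pull_dx, pull_dy, σ.invol]
    linear_combination u.dx p * h1.1 + u.dy p * h1.2
  · simp only [pull_dx, pull_dy, σ.invol]
    linear_combination u.dx p * h2.1 + u.dy p * h2.2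

/-- The average `(u + ε u ∘ σ) / 2`, where `ε` is the parity (`1` or `-1`). -/
def avg (ε : ℝ) : W12 Ω →L[ℝ] W12 Ω :=
  (1 / 2 : ℝ) • (ContinuousLinearMap.id ℝ (W12 Ω) + ε • σ.pull)

theorem avg_apply (ε : ℝ) (u : W12 Ω) : σ.avg ε u = (1 / 2 : ℝ) • (u + ε • σ.pull u) := rfl

theorem avg_mem_tests (ε : ℝ) {u : W12 Ω} (h : u ∈ W12.tests Ω) : σ.avg ε u ∈ W12.tests Ω :=
  Submodule.smul_mem _ _ (Submodule.add_mem _ h (Submodule.smul_mem _ _ (σ.pull_mem_tests h)))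

theorem avg_mem_zeroBd (ε : ℝ) {u : W12 Ω} (h : u ∈ W12.zeroBd Ω) : σ.avg ε u ∈ W12.zeroBd Ω :=
  Submodule.smul_mem _ _ (Submodule.add_mem _ h (Submodule.smul_mem _ _ (σ.pull_mem_zeroBd h)))

/-- The average has the parity `ε`. -/
theorem pull_avg {ε : ℝ} (hε : ε * ε = 1) (u : W12 Ω) : σ.pull (σ.avg ε u) = ε • σ.avg ε u := by
  rw [avg_apply, map_smul, map_add, map_smul, pull_pull]
  rw [smul_comm ε (1 / 2 : ℝ), smul_add ε, smul_smul ε ε, hε, one_smul, add_comm]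

theorem avg_of_pull_eq {ε : ℝ} (hε : ε * ε = 1) {u : W12 Ω} (h : σ.pull u = ε • u) :
    σ.avg ε u = u := by
  rw [avg_apply, h, smul_smul, hε, one_smul, ← two_smul ℝ u, smul_smul]
  norm_num

/-- A parity under `σ` passes, through the average over another reflection `ρ`, to a parity under
the conjugate of `σ` by `ρ`. -/
theorem pull_avg_of_conj {σ σ' ρ : Reflection Ω} {ε : ℝ} (δ : ℝ) {u : W12 Ω}
    (hconj : σ.pull (ρ.pull u) = ρ.pull (σ'.pull u))
    (h : σ.pull u = ε • u) (h' : σ'.pull u = ε • u) :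
    σ.pull (ρ.avg δ u) = ε • ρ.avg δ u := by
  rw [avg_apply, map_smul, map_add, map_smul, hconj, h, h', map_smul, smul_comm ε (1 / 2 : ℝ),
    smul_add ε, smul_comm ε δ]

end Reflection

theorem square_mem_iff {ℓ : ℝ} (p : ℝ × ℝ) :
    p ∈ square ℓ ↔ (-ℓ < p.1 ∧ p.1 < ℓ) ∧ (-ℓ < p.2 ∧ p.2 < ℓ) := Iff.rfl

/-- The reflection about the `x`-axis. -/
def symX (ℓ : ℝ) : Reflection (square ℓ) where
  map := (ContinuousLinearMap.fst ℝ ℝ ℝ).prod (-ContinuousLinearMap.snd ℝ ℝ ℝ)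
  invol p := by simp
  measurePreserving := (MeasurePreserving.id volume).prod (Measure.measurePreserving_neg volume)
  mem_iff p := by
    simp only [square_mem_iff, ContinuousLinearMap.prod_apply, ContinuousLinearMap.coe_fst',
      neg_apply, ContinuousLinearMap.coe_snd']
    constructor <;> rintro ⟨⟨_, _⟩, _, _⟩ <;> refine ⟨⟨?_, ?_⟩, ?_, ?_⟩ <;> linarith

/-- The reflection about the `y`-axis. -/
def symY (ℓ : ℝ) : Reflection (square ℓ) where
  map := (-ContinuousLinearMap.fst ℝ ℝ ℝ).prod (ContinuousLinearMap.snd ℝ ℝ ℝ)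
  invol p := by simp
  measurePreserving := (Measure.measurePreserving_neg volume).prod (MeasurePreserving.id volume)
  mem_iff p := by
    simp only [square_mem_iff, ContinuousLinearMap.prod_apply, ContinuousLinearMap.coe_fst',
      neg_apply, ContinuousLinearMap.coe_snd']
    constructor <;> rintro ⟨⟨_, _⟩, _, _⟩ <;> refine ⟨⟨?_, ?_⟩, ?_, ?_⟩ <;> linarith

/-- The reflection about the diagonal `y = x`. -/
def symD (ℓ : ℝ) : Reflection (square ℓ) where
  map := (ContinuousLinearMap.snd ℝ ℝ ℝ).prod (ContinuousLinearMap.fst ℝ ℝ ℝ)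
  invol p := by simp
  measurePreserving := Measure.measurePreserving_swap
  mem_iff p := by
    simp only [square_mem_iff, ContinuousLinearMap.prod_apply, ContinuousLinearMap.coe_fst',
      ContinuousLinearMap.coe_snd']
    exact and_comm

section Symmetrization

variable {ℓ : ℝ}

@[simp] theorem symX_map (p : ℝ × ℝ) : (symX ℓ).map p = (p.1, -p.2) := rfl
@[simp] theorem symY_map (p : ℝ × ℝ) : (symY ℓ).map p = (-p.1, p.2) := rfl
@[simp] theorem symD_map (p : ℝ × ℝ) : (symD ℓ).map p = (p.2, p.1) := rfl

open Reflection

@[simp] theorem symX_pull_dx (u : W12 (square ℓ)) (p : ℝ × ℝ) :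
    ((symX ℓ).pull u).dx p = u.dx (p.1, -p.2) := by simp [pull_dx]
@[simp] theorem symX_pull_dy (u : W12 (square ℓ)) (p : ℝ × ℝ) :
    ((symX ℓ).pull u).dy p = -u.dy (p.1, -p.2) := by simp [pull_dy]
@[simp] theorem symY_pull_dx (u : W12 (square ℓ)) (p : ℝ × ℝ) :
    ((symY ℓ).pull u).dx p = -u.dx (-p.1, p.2) := by simp [pull_dx]
@[simp] theorem symY_pull_dy (u : W12 (square ℓ)) (p : ℝ × ℝ) :
    ((symY ℓ).pull u).dy p = u.dy (-p.1, p.2) := by simp [pull_dy]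
@[simp] theorem symD_pull_dx (u : W12 (square ℓ)) (p : ℝ × ℝ) :
    ((symD ℓ).pull u).dx p = u.dy (p.2, p.1) := by simp [pull_dx]
@[simp] theorem symD_pull_dy (u : W12 (square ℓ)) (p : ℝ × ℝ) :
    ((symD ℓ).pull u).dy p = u.dx (p.2, p.1) := by simp [pull_dy]

/-- The projection of `W^{1,2}` of the square onto the functions with parity `ε` under the
reflections about the axes and parity `δ` under those about the diagonals: the average over the
dihedral group, twisted by the corresponding character. -/
def symmetrize (ℓ ε δ : ℝ) : W12 (square ℓ) →L[ℝ] W12 (square ℓ) :=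
  (symD ℓ).avg δ ∘L (symY ℓ).avg ε ∘L (symX ℓ).avg ε

/-- `u` has parity `ε` under the reflections about the axes, and `δ` under the one about `y = x`,
as an identity of functions that covers the derivatives too. -/
structure HasParity (ε δ : ℝ) (u : W12 (square ℓ)) : Prop where
  pullX : (symX ℓ).pull u = ε • u
  pullY : (symY ℓ).pull u = ε • u
  pullD : (symD ℓ).pull u = δ • u

theorem hasParity_symmetrize {ε δ : ℝ} (hε : ε * ε = 1) (hδ : δ * δ = 1) (u : W12 (square ℓ)) :
    HasParity ε δ (symmetrize ℓ ε δ u) := by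
  have hx := (symX ℓ).pull_avg hε u
  have hy := (symY ℓ).pull_avg hε ((symX ℓ).avg ε u)
  have hx' : (symX ℓ).pull ((symY ℓ).avg ε ((symX ℓ).avg ε u))
      = ε • (symY ℓ).avg ε ((symX ℓ).avg ε u) :=
    pull_avg_of_conj (σ' := symX ℓ) ε (by apply W12.ext_apply <;> intro p <;> simp) hx hx
  exact ⟨pull_avg_of_conj (σ' := symY ℓ) δ (by apply W12.ext_apply <;> intro p <;> simp) hx' hy,
    pull_avg_of_conj (σ' := symX ℓ) δ (by apply W12.ext_apply <;> intro p <;> simp) hy hx',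
    (symD ℓ).pull_avg hδ _⟩

theorem HasParity.symmetrize_eq {ε δ : ℝ} (hε : ε * ε = 1) (hδ : δ * δ = 1) {u : W12 (square ℓ)}
    (h : HasParity ε δ u) : symmetrize ℓ ε δ u = u := by
  change (symD ℓ).avg δ ((symY ℓ).avg ε ((symX ℓ).avg ε u)) = u
  rw [avg_of_pull_eq _ hε h.pullX, avg_of_pull_eq _ hε h.pullY, avg_of_pull_eq _ hδ h.pullD]

theorem symmetrize_mem_tests (ε δ : ℝ) {u : W12 (square ℓ)} (h : u ∈ W12.tests (square ℓ)) :
    symmetrize ℓ ε δ u ∈ W12.tests (square ℓ) :=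
  avg_mem_tests _ _ (avg_mem_tests _ _ (avg_mem_tests _ _ h))

theorem symmetrize_mem_zeroBd (ε δ : ℝ) {u : W12 (square ℓ)} (h : u ∈ W12.zeroBd (square ℓ)) :
    symmetrize ℓ ε δ u ∈ W12.zeroBd (square ℓ) :=
  avg_mem_zeroBd _ _ (avg_mem_zeroBd _ _ (avg_mem_zeroBd _ _ h))

namespace HasParity

variable {ε δ : ℝ} {u v : W12 (square ℓ)}

theorem add (hu : HasParity ε δ u) (hv : HasParity ε δ v) : HasParity ε δ (u + v) :=
  ⟨by rw [map_add, hu.pullX, hv.pullX, smul_add], by rw [map_add, hu.pullY, hv.pullY, smul_add],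
    by rw [map_add, hu.pullD, hv.pullD, smul_add]⟩

theorem smul (hu : HasParity ε δ u) (c : ℝ) : HasParity ε δ (c • u) :=
  ⟨by rw [map_smul, hu.pullX, smul_comm], by rw [map_smul, hu.pullY, smul_comm],
    by rw [map_smul, hu.pullD, smul_comm]⟩

theorem toFun_reflX (h : HasParity ε δ u) (p : ℝ × ℝ) : u.toFun (reflX p) = ε * u.toFun p :=
  congrFun (congrArg W12.toFun h.pullX) p

theorem toFun_reflY (h : HasParity ε δ u) (p : ℝ × ℝ) : u.toFun (reflY p) = ε * u.toFun p :=
  congrFun (congrArg W12.toFun h.pullY) p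

theorem toFun_reflD (h : HasParity ε δ u) (p : ℝ × ℝ) : u.toFun (reflD p) = δ * u.toFun p :=
  congrFun (congrArg W12.toFun h.pullD) p

theorem toFun_reflD' (hε : ε * ε = 1) (h : HasParity ε δ u) (p : ℝ × ℝ) :
    u.toFun (reflD' p) = δ * u.toFun p := by
  have e : reflD' p = reflX (reflY (reflD p)) := by simp [reflD', reflX, reflY, reflD]
  rw [e, h.toFun_reflX, h.toFun_reflY, h.toFun_reflD, ← mul_assoc, hε, one_mul]

/-- A function that is odd about the diagonals vanishes on them. -/
theorem eq_zero_of_mem_diagonals (hε : ε * ε = 1) (h : HasParity ε (-1) u) {p : ℝ × ℝ}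
    (hp : p ∈ diagonals ℓ) : u.toFun p = 0 := by
  rcases hp.2 with h2 | h2
  · have := h.toFun_reflD p
    rw [show reflD p = p from Prod.ext h2 h2.symm] at this
    linarith
  · have := h.toFun_reflD' hε p
    rw [show reflD' p = p from Prod.ext (by simp [reflD', h2]) (by simp [reflD', h2])] at this
    linarith

/-- A function that is odd about the axes vanishes on them. -/
theorem eq_zero_of_mem_axes (h : HasParity (-1) δ u) {p : ℝ × ℝ} (hp : p ∈ axes ℓ) :
    u.toFun p = 0 := by
  rcases hp.2 with h2 | h2
  · have := h.toFun_reflX p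
    rw [show reflX p = p from Prod.ext rfl (by simp [reflX, h2])] at this
    linarith
  · have := h.toFun_reflY p
    rw [show reflY p = p from Prod.ext (by simp [reflY, h2]) rfl] at this
    linarith

end HasParity

end Symmetrization

end

/-! ### Compactness of `W^{1,2}_0` in `L²` -/

theorem integral_linear_combination {α : Type*} [MeasurableSpace α] {μ : Measure α}
    [IsFiniteMeasure μ] {f g : α → ℝ} (hf : Integrable f μ) (hg : Integrable g μ) (a b c : ℝ) :
    ∫ x, (a * f x + b * g x + c) ∂μ
      = a * (∫ x, f x ∂μ) + b * (∫ x, g x ∂μ) + c * μ.real Set.univ := by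
  have h : Integrable (fun x => a * f x + b * g x) μ := (hf.const_mul a).add (hg.const_mul b)
  rw [integral_add h (integrable_const c), integral_add (hf.const_mul a) (hg.const_mul b),
    integral_const_mul, integral_const_mul, integral_const, smul_eq_mul, mul_comm c]

theorem integrable_linear_combination {α : Type*} [MeasurableSpace α] {μ : Measure α}
    [IsFiniteMeasure μ] {f g : α → ℝ} (hf : Integrable f μ) (hg : Integrable g μ) (a b c : ℝ) :
    Integrable (fun x => a * f x + b * g x + c) μ :=
  ((hf.const_mul a).add (hg.const_mul b)).add (integrable_const c)

/-- The Cauchy–Schwarz inequality against the constant function `1`. -/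
theorem sq_integral_le {α : Type*} [MeasurableSpace α] {μ : Measure α} [IsFiniteMeasure μ]
    {f : α → ℝ} (hf : MemLp f 2 μ) :
    (∫ x, f x ∂μ) ^ 2 ≤ μ.real Set.univ * ∫ x, f x ^ 2 ∂μ := by
  have h1 : MemLp (fun _ => (1 : ℝ)) 2 μ := memLp_const 1
  have i1 : Integrable f μ := hf.integrable (by norm_num)
  have i2 : Integrable (fun x => f x ^ 2) μ := hf.integrable_sq
  set c := μ.real Set.univ
  set m := ∫ x, f x ∂μ
  have hc : 0 ≤ c := measureReal_nonneg
  rcases hc.eq_or_lt with h | h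
  · have : μ = 0 := by
      rw [← Measure.measure_univ_eq_zero]
      exact (measureReal_eq_zero_iff).1 h.symm
    simp [m, this]
  -- the variance of `f` is nonnegative
  have key : 0 ≤ ∫ x, (c * f x - m) ^ 2 ∂μ := integral_nonneg fun x => sq_nonneg _
  have e : ∫ x, (c * f x - m) ^ 2 ∂μ = c * (c * (∫ x, f x ^ 2 ∂μ) - m ^ 2) := by
    have := integral_linear_combination i2 i1 (c ^ 2) (-(2 * c * m)) (m ^ 2)
    calc ∫ x, (c * f x - m) ^ 2 ∂μ
        = ∫ x, (c ^ 2 * f x ^ 2 + -(2 * c * m) * f x + m ^ 2) ∂μ := by congr 1; funext x; ring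
      _ = c ^ 2 * (∫ x, f x ^ 2 ∂μ) + -(2 * c * m) * m + m ^ 2 * c := this
      _ = _ := by ring
  rw [e] at key
  linarith [nonneg_of_mul_nonneg_right key h]

/-- Pointwise oscillation bound in one variable, from the fundamental theorem of calculus and the
Cauchy–Schwarz inequality. -/
theorem sq_sub_le_integral_deriv_sq {f : ℝ → ℝ} (hf : ContDiff ℝ 1 f) {a b s t : ℝ}
    (hs : s ∈ Set.Icc a b) (ht : t ∈ Set.Icc a b) :
    (f s - f t) ^ 2 ≤ (b - a) * ∫ x in Set.Ioc a b, deriv f x ^ 2 := by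
  wlog hst : t ≤ s generalizing s t
  · have := this ht hs (le_of_not_ge hst)
    calc (f s - f t) ^ 2 = (f t - f s) ^ 2 := by ring
      _ ≤ _ := this
  have hd : Continuous (deriv f) := hf.continuous_deriv le_rfl
  have h1 : ∫ x in Set.Ioc t s, deriv f x = f s - f t := by
    rw [← intervalIntegral.integral_of_le hst]
    exact intervalIntegral.integral_deriv_eq_sub (fun x _ => hf.differentiable (by simp) x)
      (hd.intervalIntegrable _ _)
  have hm : MemLp (deriv f) 2 (volume.restrict (Set.Ioc t s)) :=
    (memLp_two_iff_integrable_sq hd.aestronglyMeasurable).2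
      ((hd.pow 2).integrableOn_Ioc)
  have h2 := sq_integral_le hm
  rw [h1] at h2
  refine h2.trans ?_
  have h3 : (volume.restrict (Set.Ioc t s)).real Set.univ = s - t := by
    simp [measureReal_def, hst]
  rw [h3]
  have h4 : ∫ x in Set.Ioc t s, deriv f x ^ 2 ≤ ∫ x in Set.Ioc a b, deriv f x ^ 2 :=
    setIntegral_mono_set (hd.pow 2).integrableOn_Ioc
      (Eventually.of_forall fun x => sq_nonneg _)
      (Set.Ioc_subset_Ioc ht.1 hs.2).eventuallyLE
  have h5 : 0 ≤ ∫ x in Set.Ioc t s, deriv f x ^ 2 := integral_nonneg fun x => sq_nonneg _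
  have h6 : s - t ≤ b - a := by linarith [hs.2, ht.1]
  have h7 : 0 ≤ s - t := by linarith
  exact mul_le_mul h6 h4 h5 (h7.trans h6)

/-- The Poincaré inequality on a square of side `h`. -/
theorem integral_sq_le_of_cell {φ : ℝ × ℝ → ℝ} (hφ : ContDiff ℝ 1 φ) (a b : ℝ) {h : ℝ}
    (hh : 0 < h) :
    ∫ p in Set.Ioc a (a + h) ×ˢ Set.Ioc b (b + h), φ p ^ 2
      ≤ h ^ 2 * (∫ p in Set.Ioc a (a + h) ×ˢ Set.Ioc b (b + h),
          (fderiv ℝ φ p (1, 0) ^ 2 + fderiv ℝ φ p (0, 1) ^ 2))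
        + (h ^ 2)⁻¹ * (∫ p in Set.Ioc a (a + h) ×ˢ Set.Ioc b (b + h), φ p) ^ 2 := by
  set μ : Measure ℝ := volume.restrict (Set.Ioc a (a + h))
  set ν : Measure ℝ := volume.restrict (Set.Ioc b (b + h))
  have hvol : (volume : Measure (ℝ × ℝ)).restrict (Set.Ioc a (a + h) ×ˢ Set.Ioc b (b + h))
      = μ.prod ν := (Measure.prod_restrict _ _).symm
  have hμ1 : μ.real Set.univ = h := by simp [μ, measureReal_def, hh.le]
  have hν1 : ν.real Set.univ = h := by simp [ν, measureReal_def, hh.le]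
  have hint : ∀ f : ℝ × ℝ → ℝ, Continuous f → Integrable f (μ.prod ν) := by
    intro f hf
    rw [← hvol]
    refine IntegrableOn.mono_set (hf.continuousOn.integrableOn_compact
      (isCompact_Icc.prod isCompact_Icc : IsCompact (Set.Icc a (a + h) ×ˢ Set.Icc b (b + h)))) ?_
    exact Set.prod_mono Set.Ioc_subset_Icc_self Set.Ioc_subset_Icc_self
  have hmem : ∀ᵐ p ∂μ.prod ν, p ∈ Set.Ioc a (a + h) ×ˢ Set.Ioc b (b + h) := by
    rw [← hvol]
    exact ae_restrict_mem (measurableSet_Ioc.prod measurableSet_Ioc)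
  have hcx : Continuous (fun p => fderiv ℝ φ p (1, 0)) :=
    (hφ.continuous_fderiv (by simp)).clm_apply continuous_const
  have hcy : Continuous (fun p => fderiv ℝ φ p (0, 1)) :=
    (hφ.continuous_fderiv (by simp)).clm_apply continuous_const
  rw [hvol]
  set Dx : ℝ × ℝ → ℝ := fun p => fderiv ℝ φ p (1, 0)
  set Dy : ℝ × ℝ → ℝ := fun p => fderiv ℝ φ p (0, 1)
  have hDx : ∀ x y, HasDerivAt (fun s => φ (s, y)) (Dx (x, y)) x := fun x y =>
    (hφ.differentiable (by simp) (x, y)).hasFDerivAt.comp_hasDerivAt x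
      ((hasDerivAt_id x).prodMk (hasDerivAt_const x y))
  have hDy : ∀ x y, HasDerivAt (fun s => φ (x, s)) (Dy (x, y)) y := fun x y =>
    (hφ.differentiable (by simp) (x, y)).hasFDerivAt.comp_hasDerivAt y
      ((hasDerivAt_const y x).prodMk (hasDerivAt_id y))
  set F : ℝ → ℝ := fun y => ∫ x, Dx (x, y) ^ 2 ∂μ
  set G : ℝ → ℝ := fun x => ∫ y, Dy (x, y) ^ 2 ∂ν
  have iF : Integrable F ν := (hint _ (hcx.pow 2)).integral_prod_right
  have iG : Integrable G μ := (hint _ (hcy.pow 2)).integral_prod_left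
  -- move from `p` to `q` horizontally, then vertically
  have osc : ∀ p ∈ Set.Ioc a (a + h) ×ˢ Set.Ioc b (b + h),
      ∀ q ∈ Set.Ioc a (a + h) ×ˢ Set.Ioc b (b + h),
      (φ p - φ q) ^ 2 ≤ 2 * h * F p.2 + 2 * h * G q.1 := by
    rintro ⟨x, y⟩ ⟨hx, hy⟩ ⟨x', y'⟩ ⟨hx', hy'⟩
    have k1 := sq_sub_le_integral_deriv_sq (f := fun s => φ (s, y))
      (hφ.comp (contDiff_id.prodMk contDiff_const)) (Set.Ioc_subset_Icc_self hx)
      (Set.Ioc_subset_Icc_self hx')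
    have k2 := sq_sub_le_integral_deriv_sq (f := fun s => φ (x', s))
      (hφ.comp (contDiff_const.prodMk contDiff_id)) (Set.Ioc_subset_Icc_self hy)
      (Set.Ioc_subset_Icc_self hy')
    simp only [(hDx _ y).deriv, add_sub_cancel_left] at k1
    simp only [(hDy x' _).deriv, add_sub_cancel_left] at k2
    change (φ (x, y) - φ (x', y)) ^ 2 ≤ h * F y at k1
    change (φ (x', y) - φ (x', y')) ^ 2 ≤ h * G x' at k2
    change (φ (x, y) - φ (x', y')) ^ 2 ≤ 2 * h * F y + 2 * h * G x'
    nlinarith [sq_nonneg ((φ (x, y) - φ (x', y)) - (φ (x', y) - φ (x', y')))]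
  set S := ∫ p, φ p ^ 2 ∂μ.prod ν
  set m := ∫ p, φ p ∂μ.prod ν
  set X := ∫ p, Dx p ^ 2 ∂μ.prod ν
  set Y := ∫ p, Dy p ^ 2 ∂μ.prod ν
  have hX : ∫ y, F y ∂ν = X := (integral_prod_symm _ (hint _ (hcx.pow 2))).symm
  have hY : ∫ x, G x ∂μ = Y := (integral_prod _ (hint _ (hcy.pow 2))).symm
  have hXY : ∫ p, (Dx p ^ 2 + Dy p ^ 2) ∂μ.prod ν = X + Y :=
    integral_add (hint _ (hcx.pow 2)) (hint _ (hcy.pow 2))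
  have iφ := hint _ hφ.continuous
  have iφ2 : Integrable (fun p => φ p ^ 2) (μ.prod ν) := hint _ (hφ.continuous.pow 2)
  have hone : (μ.prod ν).real Set.univ = h * h := by
    rw [← Set.univ_prod_univ, measureReal_prod_prod, hμ1, hν1]
  -- integrate the oscillation bound in `q`, then in `p`
  have step : ∀ p ∈ Set.Ioc a (a + h) ×ˢ Set.Ioc b (b + h),
      h ^ 2 * φ p ^ 2 - 2 * m * φ p + S ≤ 2 * h ^ 3 * F p.2 + 2 * h ^ 2 * Y := by
    intro p hp
    have e1 : ∫ q, (φ p - φ q) ^ 2 ∂μ.prod ν = h ^ 2 * φ p ^ 2 - 2 * m * φ p + S := by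
      have := integral_linear_combination iφ2 iφ 1 (-(2 * φ p)) (φ p ^ 2)
      rw [hone] at this
      calc ∫ q, (φ p - φ q) ^ 2 ∂μ.prod ν
          = ∫ q, (1 * φ q ^ 2 + -(2 * φ p) * φ q + φ p ^ 2) ∂μ.prod ν := by
            congr 1; funext q; ring
        _ = 1 * S + -(2 * φ p) * m + φ p ^ 2 * (h * h) := this
        _ = _ := by ring
    have e2 : ∫ q, (0 * φ q + 2 * h * G q.1 + 2 * h * F p.2) ∂μ.prod ν
        = 2 * h ^ 3 * F p.2 + 2 * h ^ 2 * Y := by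
      rw [integral_linear_combination iφ (iG.comp_fst ν), hone,
        show ∫ q : ℝ × ℝ, G q.1 ∂μ.prod ν = h * Y by
          rw [integral_fun_fst, hν1, hY, smul_eq_mul]]
      ring
    rw [← e1, ← e2]
    refine integral_mono_ae (hint _ ((continuous_const.sub hφ.continuous).pow 2))
      (integrable_linear_combination iφ (iG.comp_fst ν) _ _ _) ?_
    filter_upwards [hmem] with q hq
    have := osc p hp q hq
    linarith
  have fin : ∫ p, (h ^ 2 * φ p ^ 2 + -(2 * m) * φ p + S) ∂μ.prod ν
      ≤ ∫ p, (0 * φ p + 2 * h ^ 3 * F p.2 + 2 * h ^ 2 * Y) ∂μ.prod ν := by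
    refine integral_mono_ae (integrable_linear_combination iφ2 iφ _ _ _)
      (integrable_linear_combination iφ (iF.comp_snd μ) _ _ _) ?_
    filter_upwards [hmem] with p hp
    have := step p hp
    linarith
  have e3 : ∫ p, (h ^ 2 * φ p ^ 2 + -(2 * m) * φ p + S) ∂μ.prod ν
      = 2 * h ^ 2 * S - 2 * m ^ 2 := by
    rw [integral_linear_combination iφ2 iφ, hone]
    change h ^ 2 * S + -(2 * m) * m + S * (h * h) = _
    ring
  have e4 : ∫ p, (0 * φ p + 2 * h ^ 3 * F p.2 + 2 * h ^ 2 * Y) ∂μ.prod ν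
      = 2 * h ^ 4 * (X + Y) := by
    rw [integral_linear_combination iφ (iF.comp_snd μ), hone,
      show ∫ q : ℝ × ℝ, F q.2 ∂μ.prod ν = h * X by
        rw [integral_fun_snd, hμ1, hX, smul_eq_mul]]
    ring
  rw [e3, e4] at fin
  rw [hXY]
  have h2 : 0 < h ^ 2 := by positivity
  have : h ^ 2 * (h ^ 2 * (X + Y) + (h ^ 2)⁻¹ * m ^ 2) = h ^ 4 * (X + Y) + m ^ 2 := by
    field_simp
  exact le_of_mul_le_mul_left (by linarith) h2

/-- The left end point of the `i`-th of `N` equal subintervals of `(-ℓ, ℓ]`. -/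
def node (ℓ : ℝ) (N i : ℕ) : ℝ := -ℓ + i * (2 * ℓ / N)

/-- The cells of the subdivision of the square of half-side `ℓ` into `N²` equal squares. -/
def cell (ℓ : ℝ) (N : ℕ) (i : ℕ × ℕ) : Set (ℝ × ℝ) :=
  Set.Ioc (node ℓ N i.1) (node ℓ N (i.1 + 1)) ×ˢ Set.Ioc (node ℓ N i.2) (node ℓ N (i.2 + 1))

theorem node_succ (ℓ : ℝ) (N i : ℕ) : node ℓ N (i + 1) = node ℓ N i + 2 * ℓ / N := by
  simp [node]; ring

theorem measurableSet_cell (ℓ : ℝ) (N : ℕ) (i : ℕ × ℕ) : MeasurableSet (cell ℓ N i) :=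
  measurableSet_Ioc.prod measurableSet_Ioc

/-- The open square may be replaced by the half-open one, which the cells fill exactly. -/
theorem restrict_square (ℓ : ℝ) : (volume : Measure (ℝ × ℝ)).restrict (square ℓ)
    = volume.restrict (Set.Ioc (-ℓ) ℓ ×ˢ Set.Ioc (-ℓ) ℓ) := by
  have h : (volume : Measure ℝ).restrict (Set.Ioo (-ℓ) ℓ) = volume.restrict (Set.Ioc (-ℓ) ℓ) :=
    Measure.restrict_congr_set Ioo_ae_eq_Ioc
  rw [square, Measure.volume_eq_prod, ← Measure.prod_restrict, ← Measure.prod_restrict, h]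

theorem isOpen_square (ℓ : ℝ) : IsOpen (square ℓ) := isOpen_Ioo.prod isOpen_Ioo

theorem isBounded_square (ℓ : ℝ) : Bornology.IsBounded (square ℓ) :=
  (Metric.isBounded_Ioo _ _).prod (Metric.isBounded_Ioo _ _)

instance (ℓ : ℝ) : IsFiniteMeasure ((volume : Measure (ℝ × ℝ)).restrict (square ℓ)) :=
  ⟨by rw [Measure.restrict_apply_univ]; exact (isBounded_square ℓ).measure_lt_top⟩

theorem biUnion_cell {ℓ : ℝ} (hℓ : 0 < ℓ) {N : ℕ} (hN : 0 < N) :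
    ⋃ i ∈ Finset.range N ×ˢ Finset.range N, cell ℓ N i = Set.Ioc (-ℓ) ℓ ×ˢ Set.Ioc (-ℓ) ℓ := by
  have hmono : Monotone (node ℓ N) :=
    monotone_nat_of_le_succ fun i => by rw [node_succ]; linarith [show 0 ≤ 2 * ℓ / N by positivity]
  have h := hmono.biUnion_Ico_Ioc_map_succ 0 N
  have e0 : node ℓ N 0 = -ℓ := by simp [node]
  have e1 : node ℓ N N = ℓ := by
    have : (N : ℝ) ≠ 0 := by positivity
    simp only [node]; field_simp; ring
  rw [e0, e1] at h
  ext ⟨x, y⟩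
  rw [← h]
  simp only [Set.mem_iUnion, Finset.mem_product, Finset.mem_range, Set.mem_prod, cell,
    Set.mem_Ico, Order.succ_eq_add_one, exists_prop, Prod.exists, zero_le, true_and]
  constructor
  · rintro ⟨i, j, ⟨hi, hj⟩, hx, hy⟩
    exact ⟨⟨i, hi, hx⟩, j, hj, hy⟩
  · rintro ⟨⟨i, hi, hx⟩, j, hj, hy⟩
    exact ⟨i, j, ⟨hi, hj⟩, hx, hy⟩

theorem pairwise_disjoint_cell {ℓ : ℝ} (hℓ : 0 < ℓ) (N : ℕ) :
    Pairwise (Function.onFun Disjoint (cell ℓ N)) := by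
  have hmono : Monotone (node ℓ N) :=
    monotone_nat_of_le_succ fun i => by rw [node_succ]; linarith [show 0 ≤ 2 * ℓ / N by positivity]
  have h := hmono.pairwise_disjoint_on_Ioc_succ
  rintro ⟨i, j⟩ ⟨i', j'⟩ hne
  by_cases hi : i = i'
  · have hj : j ≠ j' := fun hj => hne (by rw [hi, hj])
    exact Set.disjoint_prod.2 (Or.inr (h hj))
  · exact Set.disjoint_prod.2 (Or.inl (h hi))

theorem setIntegral_square_eq_sum {ℓ : ℝ} (hℓ : 0 < ℓ) {N : ℕ} (hN : 0 < N) {f : ℝ × ℝ → ℝ}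
    (hf : IntegrableOn f (square ℓ)) :
    ∫ p in square ℓ, f p = ∑ i ∈ Finset.range N ×ˢ Finset.range N, ∫ p in cell ℓ N i, f p := by
  rw [IntegrableOn, restrict_square, ← biUnion_cell hℓ hN] at hf
  rw [restrict_square, ← biUnion_cell hℓ hN]
  refine integral_biUnion_finset _ (fun i _ => measurableSet_cell _ _ _)
    ((pairwise_disjoint_cell hℓ N).set_pairwise _) fun i hi => IntegrableOn.mono_set hf ?_
  exact Set.subset_biUnion_of_mem (u := fun i => cell ℓ N i) (Finset.mem_coe.2 hi)

theorem restrict_square_cell {ℓ : ℝ} (hℓ : 0 < ℓ) {N : ℕ} (hN : 0 < N) {i : ℕ × ℕ}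
    (hi : i ∈ Finset.range N ×ˢ Finset.range N) :
    ((volume : Measure (ℝ × ℝ)).restrict (square ℓ)).restrict (cell ℓ N i)
      = volume.restrict (cell ℓ N i) := by
  rw [restrict_square, Measure.restrict_restrict_of_subset]
  rw [← biUnion_cell hℓ hN]
  exact Set.subset_biUnion_of_mem (u := fun i => cell ℓ N i) (Finset.mem_coe.2 hi)

/-- The integral of `u` over a measurable part `Q` of the square, as a functional of `u`. -/
def integralOn (ℓ : ℝ) (Q : Set (ℝ × ℝ)) : W12 (square ℓ) →L[ℝ] ℝ :=
  LinearMap.mkContinuous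
    { toFun := fun u => ∫ p in Q, u.toFun p ∂(volume.restrict (square ℓ))
      map_add' := fun u v => integral_add
        (u.memLp_toFun.restrict Q |>.integrable (by norm_num))
        (v.memLp_toFun.restrict Q |>.integrable (by norm_num))
      map_smul' := fun c u => integral_const_mul c _ }
    (√((volume.restrict (square ℓ)).real Set.univ)) fun u => by
    refine abs_le_of_sq_le_sq ?_ (by positivity)
    rw [mul_pow, Real.sq_sqrt measureReal_nonneg]
    refine (sq_integral_le (u.memLp_toFun.restrict Q)).trans ?_
    refine mul_le_mul ?_ ((integral_mono_measure Measure.restrict_le_self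
      (Eventually.of_forall fun p => sq_nonneg _) u.memLp_toFun.integrable_sq).trans
      u.integral_toFun_sq_le) (integral_nonneg fun p => sq_nonneg _) measureReal_nonneg
    rw [measureReal_restrict_apply_univ]
    exact measureReal_mono (Set.subset_univ _)

theorem integralOn_apply (ℓ : ℝ) (Q : Set (ℝ × ℝ)) (u : W12 (square ℓ)) :
    integralOn ℓ Q u = ∫ p in Q, u.toFun p ∂(volume.restrict (square ℓ)) := rfl

theorem W12.continuous_integral_sq {Ω : Set (ℝ × ℝ)} :
    Continuous (fun u : W12 Ω => ∫ p in Ω, u.toFun p ^ 2) ∧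
    Continuous (fun u : W12 Ω => ∫ p in Ω, u.dx p ^ 2) ∧
    Continuous (fun u : W12 Ω => ∫ p in Ω, u.dy p ^ 2) := by
  have h := W12.continuous_toLp3 (Ω := Ω)
  have h0 : Continuous (fun u => ‖(W12.toLp3 Ω u).1‖ ^ 2) := h.fst.norm.pow 2
  have h1 : Continuous (fun u => ‖(W12.toLp3 Ω u).2.1‖ ^ 2) := h.snd.fst.norm.pow 2
  have h2 : Continuous (fun u => ‖(W12.toLp3 Ω u).2.2‖ ^ 2) := h.snd.snd.norm.pow 2
  refine ⟨?_, ?_, ?_⟩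
  · convert h0 using 2 with u; exact (norm_sq_toLp u.memLp_toFun).symm
  · convert h1 using 2 with u; exact (norm_sq_toLp u.memLp_dx).symm
  · convert h2 using 2 with u; exact (norm_sq_toLp u.memLp_dy).symm

/-- On `W^{1,2}_0` of the square, the `L²`-norm is controlled, up to a small multiple of the
norm of the gradient, by finitely many mean values. -/
theorem integral_sq_le_sum_cells {ℓ : ℝ} (hℓ : 0 < ℓ) {N : ℕ} (hN : 0 < N) {u : W12 (square ℓ)}
    (hu : u ∈ W12.zeroBd (square ℓ)) :
    ∫ p in square ℓ, u.toFun p ^ 2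
      ≤ (2 * ℓ / N) ^ 2 * ((∫ p in square ℓ, u.dx p ^ 2) + ∫ p in square ℓ, u.dy p ^ 2)
        + ((2 * ℓ / N) ^ 2)⁻¹
          * ∑ i ∈ Finset.range N ×ˢ Finset.range N, integralOn ℓ (cell ℓ N i) u ^ 2 := by
  obtain ⟨c0, c1, c2⟩ := W12.continuous_integral_sq (Ω := square ℓ)
  refine closure_minimal (t := {u : W12 (square ℓ) | ∫ p in square ℓ, u.toFun p ^ 2
      ≤ (2 * ℓ / N) ^ 2 * ((∫ p in square ℓ, u.dx p ^ 2) + ∫ p in square ℓ, u.dy p ^ 2)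
        + ((2 * ℓ / N) ^ 2)⁻¹
          * ∑ i ∈ Finset.range N ×ˢ Finset.range N, integralOn ℓ (cell ℓ N i) u ^ 2})
    ?_ (isClosed_le c0 (((c1.add c2).const_mul _).add (Continuous.const_mul
      (continuous_finsetSum _ fun i _ => (integralOn ℓ _).continuous.pow 2) _))) hu
  intro u hu
  change IsTest (square ℓ) u.toFun at hu
  have hx := IsWeakDeriv.ae_eq (isOpen_square ℓ) u.memLp_dx (hu.memLp_fderiv (1, 0)) u.weak_dx
    (hu.isWeakDeriv _)
  have hy := IsWeakDeriv.ae_eq (isOpen_square ℓ) u.memLp_dy (hu.memLp_fderiv (0, 1)) u.weak_dy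
    (hu.isWeakDeriv _)
  have iD : IntegrableOn (fun p => fderiv ℝ u.toFun p (1, 0) ^ 2 + fderiv ℝ u.toFun p (0, 1) ^ 2)
    (square ℓ) := (hu.memLp_fderiv (1, 0)).integrable_sq.add (hu.memLp_fderiv (0, 1)).integrable_sq
  have eD : (∫ p in square ℓ, u.dx p ^ 2) + ∫ p in square ℓ, u.dy p ^ 2
      = ∫ p in square ℓ, (fderiv ℝ u.toFun p (1, 0) ^ 2 + fderiv ℝ u.toFun p (0, 1) ^ 2) := by
    rw [← integral_add u.memLp_dx.integrable_sq u.memLp_dy.integrable_sq]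
    refine integral_congr_ae ?_
    filter_upwards [hx, hy] with p h1 h2
    rw [h1, h2]
  rw [Set.mem_ofPred_eq, eD, setIntegral_square_eq_sum hℓ hN u.memLp_toFun.integrable_sq,
    setIntegral_square_eq_sum hℓ hN iD, Finset.mul_sum, Finset.mul_sum, ← Finset.sum_add_distrib]
  refine Finset.sum_le_sum fun i hi => ?_
  have := integral_sq_le_of_cell (hu.smooth.of_le (by simp)) (node ℓ N i.1) (node ℓ N i.2)
    (show 0 < 2 * ℓ / N by positivity)
  rw [← node_succ, ← node_succ] at this
  rw [integralOn_apply, restrict_square_cell hℓ hN hi]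
  exact this

/-- Rellich's theorem for triples in `W^{1,2}_0` of the square: a bounded sequence has a
subsequence that is Cauchy in `L²`. -/
theorem exists_subseq_integral_sq_lt {ℓ : ℝ} (hℓ : 0 < ℓ) (w : ℕ → Fin 3 → W12 (square ℓ))
    (hw : ∀ n k, w n k ∈ W12.zeroBd (square ℓ)) {R : ℝ} (hR : ∀ n k, ‖w n k‖ ≤ R) :
    ∃ θ : ℕ → ℕ, StrictMono θ ∧ ∀ ε : ℝ, 0 < ε → ∃ M, ∀ n ≥ M, ∀ m ≥ M, ∀ k,
      ∫ p in square ℓ, (w (θ n) k - w (θ m) k).toFun p ^ 2 < ε := by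
  -- a diagonal sequence: all mean values over all cells of all subdivisions converge
  let x : ℕ → (Fin 3 × ℕ × ℕ × ℕ → ℝ) := fun n j => integralOn ℓ (cell ℓ j.2.1 j.2.2) (w n j.1)
  let B : Fin 3 × ℕ × ℕ × ℕ → ℝ := fun j => ‖integralOn ℓ (cell ℓ j.2.1 j.2.2)‖ * R
  have hx : ∀ n, x n ∈ Set.univ.pi fun j => Set.Icc (-B j) (B j) := by
    intro n j _
    have h1 := (integralOn ℓ (cell ℓ j.2.1 j.2.2)).le_opNorm (w n j.1)
    have h2 : ‖integralOn ℓ (cell ℓ j.2.1 j.2.2)‖ * ‖w n j.1‖ ≤ B j :=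
      mul_le_mul_of_nonneg_left (hR n j.1) (norm_nonneg _)
    exact abs_le.1 (h1.trans h2)
  obtain ⟨y, -, θ, hθ, hlim⟩ := (isCompact_univ_pi fun j => isCompact_Icc).tendsto_subseq hx
  refine ⟨θ, hθ, fun ε hε => ?_⟩
  have hR0 : 0 ≤ R := (norm_nonneg _).trans (hR 0 0)
  obtain ⟨N, hN0, hN⟩ : ∃ N : ℕ, 0 < N ∧ (2 * ℓ / N) ^ 2 * (8 * R ^ 2) < ε / 2 := by
    have h1 : Tendsto (fun N : ℕ => (2 * ℓ / N) ^ 2 * (8 * R ^ 2)) atTop (𝓝 (0 ^ 2 * (8 * R ^ 2))) :=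
      ((tendsto_const_div_atTop_nhds_zero_nat _).pow 2).mul_const _
    have h2 := h1.eventually (gt_mem_nhds (show (0 : ℝ) ^ 2 * (8 * R ^ 2) < ε / 2 by simpa using hε))
    obtain ⟨N, h3, h4⟩ := (h2.and (eventually_gt_atTop 0)).exists
    exact ⟨N, h4, h3⟩
  set h := 2 * ℓ / (N : ℝ)
  have hh : 0 < h := by positivity
  have hsum : ∀ k : Fin 3, ∃ M, ∀ n ≥ M, ∀ m ≥ M, (h ^ 2)⁻¹ *
      ∑ i ∈ Finset.range N ×ˢ Finset.range N, (x (θ n) (k, N, i) - x (θ m) (k, N, i)) ^ 2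
        < ε / 2 := by
    intro k
    have hc : ∀ j, Tendsto (fun n => x (θ n) j) atTop (𝓝 (y j)) := tendsto_pi_nhds.1 hlim
    have ht : Tendsto (fun nm : ℕ × ℕ => (h ^ 2)⁻¹ * ∑ i ∈ Finset.range N ×ˢ Finset.range N,
        (x (θ nm.1) (k, N, i) - x (θ nm.2) (k, N, i)) ^ 2) (atTop ×ˢ atTop)
        (𝓝 ((h ^ 2)⁻¹ * ∑ i ∈ Finset.range N ×ˢ Finset.range N,
          (y (k, N, i) - y (k, N, i)) ^ 2)) := by
      refine Tendsto.const_mul _ (tendsto_finsetSum _ fun i _ => Tendsto.pow ?_ 2)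
      exact ((hc _).comp tendsto_fst).sub ((hc _).comp tendsto_snd)
    rw [prod_atTop_atTop_eq] at ht
    have := ht.eventually (gt_mem_nhds (show _ < ε / 2 by simpa using hε))
    obtain ⟨⟨M1, M2⟩, hM⟩ := eventually_atTop.1 this
    exact ⟨max M1 M2, fun n hn m hm => hM (n, m)
      ⟨(le_max_left _ _).trans hn, (le_max_right _ _).trans hm⟩⟩
  choose M hM using hsum
  refine ⟨Finset.univ.sup M, fun n hn m hm k => ?_⟩
  have hMk : M k ≤ Finset.univ.sup M := Finset.le_sup (Finset.mem_univ k)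
  have h1 := hM k n (hMk.trans hn) m (hMk.trans hm)
  have h2 := integral_sq_le_sum_cells hℓ hN0
    (Submodule.sub_mem _ (hw (θ n) k) (hw (θ m) k))
  have h3 : ‖w (θ n) k - w (θ m) k‖ ^ 2 ≤ 4 * R ^ 2 := by
    have := (norm_sub_le (w (θ n) k) (w (θ m) k)).trans (add_le_add (hR _ k) (hR _ k))
    calc _ ≤ (R + R) ^ 2 := pow_le_pow_left₀ (norm_nonneg _) this 2
      _ = _ := by ring
  have h4 := (w (θ n) k - w (θ m) k).integral_dx_sq_le
  have h5 := (w (θ n) k - w (θ m) k).integral_dy_sq_le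
  simp only [map_sub] at h2
  change _ ≤ h ^ 2 * _ + (h ^ 2)⁻¹ * ∑ i ∈ Finset.range N ×ˢ Finset.range N,
    (x (θ n) (k, N, i) - x (θ m) (k, N, i)) ^ 2 at h2
  have h6 : h ^ 2 * ((∫ p in square ℓ, (w (θ n) k - w (θ m) k).dx p ^ 2)
      + ∫ p in square ℓ, (w (θ n) k - w (θ m) k).dy p ^ 2) ≤ h ^ 2 * (8 * R ^ 2) :=
    mul_le_mul_of_nonneg_left (by linarith) (by positivity)
  linarith

/-! ### Integrability and the first variation of the energy -/

section

variable {Ω : Set (ℝ × ℝ)}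

/-- Convergence in `W^{1,2}` implies pointwise convergence almost everywhere, of the functions and
of their derivatives, along a subsequence. -/
theorem exists_subseq_tendsto_ae {u : ℕ → Fin 3 → W12 Ω} {v : Fin 3 → W12 Ω}
    (h : Tendsto u atTop (𝓝 v)) :
    ∃ θ : ℕ → ℕ, StrictMono θ ∧ ∀ᵐ p ∂volume.restrict Ω, ∀ k,
      Tendsto (fun n => (u (θ n) k).toFun p) atTop (𝓝 ((v k).toFun p)) ∧
      Tendsto (fun n => (u (θ n) k).dx p) atTop (𝓝 ((v k).dx p)) ∧
      Tendsto (fun n => (u (θ n) k).dy p) atTop (𝓝 ((v k).dy p)) := by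
  -- the sum of the squares of all differences tends to `0` in `L¹`
  set d : ℕ → ℝ × ℝ → ℝ := fun n p => ∑ k, ((u n k - v k).toFun p ^ 2 + (u n k - v k).dx p ^ 2
    + (u n k - v k).dy p ^ 2) with hd
  have hd0 : ∀ n p, 0 ≤ d n p := fun n p => Finset.sum_nonneg fun k _ => by positivity
  have hik : ∀ n k, Integrable (fun p => (u n k - v k).toFun p ^ 2 + (u n k - v k).dx p ^ 2
      + (u n k - v k).dy p ^ 2) (volume.restrict Ω) := fun n k =>
    ((u n k - v k).memLp_toFun.integrable_sq.add (u n k - v k).memLp_dx.integrable_sq).add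
      (u n k - v k).memLp_dy.integrable_sq
  have hid : ∀ n, Integrable (d n) (volume.restrict Ω) := fun n =>
    integrable_finsetSum _ fun k _ => hik n k
  have hlim : Tendsto (fun n => ∫ p in Ω, d n p) atTop (𝓝 0) := by
    have hb : ∀ n, ∫ p in Ω, d n p ≤ ∑ k, 3 * ‖u n k - v k‖ ^ 2 := by
      intro n
      rw [integral_finsetSum _ fun k _ => hik n k]
      refine Finset.sum_le_sum fun k _ => ?_
      rw [← W12.distSq_eq]
      exact W12.distSq_le_norm_sub_sq _ _
    have hz : Tendsto (fun n => ∑ k, 3 * ‖u n k - v k‖ ^ 2) atTop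
        (𝓝 (∑ k : Fin 3, 3 * ‖v k - v k‖ ^ 2)) :=
      tendsto_finsetSum _ fun k _ =>
        ((((tendsto_pi_nhds.1 h k).sub tendsto_const_nhds).norm).pow 2).const_mul 3
    simp only [sub_self, norm_zero] at hz
    norm_num at hz
    exact squeeze_zero (fun n => integral_nonneg (hd0 n)) hb (by simpa using hz)
  have hL : Tendsto (fun n => eLpNorm (d n - fun _ => (0 : ℝ)) 1 (volume.restrict Ω)) atTop (𝓝 0) := by
    have e : ∀ n, eLpNorm (d n - fun _ => (0 : ℝ)) 1 (volume.restrict Ω)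
        = ENNReal.ofReal (∫ p in Ω, d n p) := by
      intro n
      rw [eLpNorm_one_eq_lintegral_enorm,
        ofReal_integral_eq_lintegral_ofReal (hid n) (Eventually.of_forall (hd0 n))]
      refine lintegral_congr fun p => ?_
      simp only [Pi.sub_apply, sub_zero]
      rw [Real.enorm_eq_ofReal (hd0 n p)]
    simp only [e]
    simpa using ENNReal.tendsto_ofReal hlim
  obtain ⟨θ, hθ, hae⟩ := (tendstoInMeasure_of_tendsto_eLpNorm one_ne_zero
    (fun n => (hid n).aestronglyMeasurable) aestronglyMeasurable_const hL).exists_seq_tendsto_ae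
  refine ⟨θ, hθ, ?_⟩
  filter_upwards [hae] with p hp k
  have hle : ∀ n, (u n k - v k).toFun p ^ 2 + (u n k - v k).dx p ^ 2
    + (u n k - v k).dy p ^ 2 ≤ d n p := fun n =>
      Finset.single_le_sum (f := fun k => (u n k - v k).toFun p ^ 2 + (u n k - v k).dx p ^ 2
        + (u n k - v k).dy p ^ 2) (fun k _ => by positivity) (Finset.mem_univ k)
  have aux : ∀ (f : ℕ → ℝ) (a : ℝ), (∀ n, (f n - a) ^ 2 ≤ d (θ n) p) →
      Tendsto f atTop (𝓝 a) := by
    intro f a hf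
    rw [tendsto_iff_norm_sub_tendsto_zero]
    have h1 : Tendsto (fun n => √(d (θ n) p)) atTop (𝓝 √0) :=
      (Real.continuous_sqrt.tendsto 0).comp hp
    rw [Real.sqrt_zero] at h1
    exact squeeze_zero (fun n => norm_nonneg _) (fun n => Real.abs_le_sqrt (hf n)) h1
  refine ⟨aux _ _ fun n => ?_, aux _ _ fun n => ?_, aux _ _ fun n => ?_⟩ <;>
    refine le_trans ?_ (hle (θ n)) <;> simp only [W12.sub_toFun, W12.sub_dx, W12.sub_dy] <;>
    nlinarith [sq_nonneg ((u (θ n) k).toFun p - (v k).toFun p),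
      sq_nonneg ((u (θ n) k).dx p - (v k).dx p), sq_nonneg ((u (θ n) k).dy p - (v k).dy p)]

theorem W12.eLpNorm_le (u : W12 Ω) :
    eLpNorm u.dx 2 (volume.restrict Ω) ≤ ENNReal.ofReal ‖u‖ ∧
    eLpNorm u.dy 2 (volume.restrict Ω) ≤ ENNReal.ofReal ‖u‖ := by
  constructor
  · rw [← ENNReal.ofReal_toReal u.memLp_dx.eLpNorm_ne_top, ← Lp.norm_toLp _ u.memLp_dx]
    exact ENNReal.ofReal_le_ofReal ((le_max_left _ _).trans (le_max_right _ _))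
  · rw [← ENNReal.ofReal_toReal u.memLp_dy.eLpNorm_ne_top, ← Lp.norm_toLp _ u.memLp_dy]
    exact ENNReal.ofReal_le_ofReal ((le_max_right _ _).trans (le_max_right _ _))

theorem norm_le_abs_add_abs (T : (ℝ × ℝ) →L[ℝ] ℝ) : ‖T‖ ≤ |T (1, 0)| + |T (0, 1)| := by
  refine T.opNorm_le_bound (by positivity) fun v => ?_
  have hT : T v = v.1 * T (1, 0) + v.2 * T (0, 1) := by
    conv_lhs => rw [Reflection.eq_smul_add_smul v]
    rw [map_add, map_smul, map_smul, smul_eq_mul, smul_eq_mul]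
  rw [hT, Real.norm_eq_abs]
  have h1 : |v.1| ≤ ‖v‖ := norm_fst_le v
  have h2 : |v.2| ≤ ‖v‖ := norm_snd_le v
  calc |v.1 * T (1, 0) + v.2 * T (0, 1)| ≤ |v.1| * |T (1, 0)| + |v.2| * |T (0, 1)| := by
        rw [← abs_mul, ← abs_mul]; exact abs_add_le _ _
    _ ≤ ‖v‖ * |T (1, 0)| + ‖v‖ * |T (0, 1)| := by gcongr
    _ = _ := by ring

/-- The Sobolev inequality `W^{1,2}_0 ⊂ L⁴` in the plane, for test functions. -/
theorem exists_eLpNorm_four_le (ℓ : ℝ) : ∃ K : ℝ≥0, ∀ u ∈ W12.tests (square ℓ),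
    eLpNorm u.toFun 4 (volume.restrict (square ℓ)) ≤ K * ENNReal.ofReal ‖u‖ := by
  set μ := (volume : Measure (ℝ × ℝ)).restrict (square ℓ)
  obtain ⟨K₁, hK₁⟩ : ∃ K₁ : ℝ≥0, (K₁ : ℝ≥0∞) = μ Set.univ ^ (1 / (4 / 3 : ℝ) - 1 / 2) :=
    ⟨_, ENNReal.coe_toNNReal (ENNReal.rpow_ne_top_of_nonneg (by norm_num) (measure_ne_top _ _))⟩
  -- `4` is the Sobolev conjugate of `4 / 3` in the plane
  obtain ⟨r, hr⟩ : ∃ r : ℝ≥0, (r : ℝ) = 4 / 3 := ⟨⟨4 / 3, by norm_num⟩, rfl⟩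
  have hr1 : 1 ≤ r := by rw [← NNReal.coe_le_coe, hr]; norm_num
  have hr2 : r ≤ 2 := by rw [← NNReal.coe_le_coe, hr]; norm_num
  have hdim : Module.finrank ℝ (ℝ × ℝ) = 2 := by simp
  obtain ⟨K₀, hK₀⟩ : ∃ K₀ : ℝ≥0, ∀ f : ℝ × ℝ → ℝ, ContDiff ℝ 1 f →
      Function.support f ⊆ square ℓ →
      eLpNorm f ((4 : ℝ≥0) : ℝ≥0∞) volume ≤ K₀ * eLpNorm (fderiv ℝ f) r volume :=
    ⟨_, fun f hf hs => eLpNorm_le_eLpNorm_fderiv_of_le (volume : Measure (ℝ × ℝ)) hf hs hr1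
      (by rw [hdim, ← NNReal.coe_lt_coe, hr]; norm_num)
      (by rw [hdim, NNReal.coe_inv, hr]; norm_num) (isBounded_square ℓ)⟩
  refine ⟨K₀ * (2 * K₁), fun u hu => ?_⟩
  change IsTest (square ℓ) u.toFun at hu
  have h1 := hK₀ u.toFun (hu.smooth.of_le (by simp)) (subset_closure.trans hu.support)
  rw [ENNReal.coe_ofNat] at h1
  have hx := IsWeakDeriv.ae_eq (isOpen_square ℓ) u.memLp_dx (hu.memLp_fderiv (1, 0)) u.weak_dx
    (hu.isWeakDeriv _)
  have hy := IsWeakDeriv.ae_eq (isOpen_square ℓ) u.memLp_dy (hu.memLp_fderiv (0, 1)) u.weak_dy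
    (hu.isWeakDeriv _)
  have hcd : Continuous (fderiv ℝ u.toFun) := hu.smooth.continuous_fderiv (by simp)
  have h2 : eLpNorm (fderiv ℝ u.toFun) r volume = eLpNorm (fderiv ℝ u.toFun) r μ := by
    rw [← eLpNorm_norm (fderiv ℝ u.toFun), ← eLpNorm_norm (fderiv ℝ u.toFun)]
    refine (eLpNorm_restrict_eq_of_support_subset (s := square ℓ) fun p hp => ?_).symm
    refine hu.support (tsupport_fderiv_subset ℝ (subset_tsupport _ fun h0 => hp ?_))
    exact (congrArg norm h0).trans norm_zero
  have h3 : eLpNorm (fderiv ℝ u.toFun) r μ ≤ eLpNorm (fderiv ℝ u.toFun) 2 μ * K₁ := by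
    have := eLpNorm_le_eLpNorm_mul_rpow_measure_univ (p := (r : ℝ≥0∞)) (q := 2)
      (μ := μ) (f := fderiv ℝ u.toFun) (by exact_mod_cast hr2) hcd.aestronglyMeasurable
    rw [ENNReal.coe_toReal, hr, ENNReal.toReal_ofNat, ← hK₁] at this
    exact this
  have h4 : eLpNorm (fderiv ℝ u.toFun) 2 μ ≤ 2 * ENNReal.ofReal ‖u‖ := by
    have hb : ∀ᵐ p ∂μ, ‖fderiv ℝ u.toFun p‖ ≤ ‖‖u.dx p‖ + ‖u.dy p‖‖ := by
      filter_upwards [hx, hy] with p h1 h2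
      rw [h1, h2]
      exact (norm_le_abs_add_abs _).trans (le_abs_self _)
    calc eLpNorm (fderiv ℝ u.toFun) 2 μ
        ≤ eLpNorm ((fun p => ‖u.dx p‖) + fun p => ‖u.dy p‖) 2 μ := eLpNorm_mono_ae hb
      _ ≤ eLpNorm (fun p => ‖u.dx p‖) 2 μ + eLpNorm (fun p => ‖u.dy p‖) 2 μ :=
        eLpNorm_add_le u.memLp_dx.norm.aestronglyMeasurable u.memLp_dy.norm.aestronglyMeasurable
          one_le_two
      _ = eLpNorm u.dx 2 μ + eLpNorm u.dy 2 μ := by rw [eLpNorm_norm, eLpNorm_norm]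
      _ ≤ ENNReal.ofReal ‖u‖ + ENNReal.ofReal ‖u‖ := add_le_add u.eLpNorm_le.1 u.eLpNorm_le.2
      _ = 2 * ENNReal.ofReal ‖u‖ := (two_mul _).symm
  have h6 : eLpNorm u.toFun 4 μ ≤ eLpNorm u.toFun 4 volume := eLpNorm_restrict_le _ _ _ _
  rw [h2] at h1
  calc eLpNorm u.toFun 4 μ ≤ eLpNorm u.toFun 4 volume := h6
    _ ≤ (K₀ : ℝ≥0∞) * eLpNorm (fderiv ℝ u.toFun) r μ := h1
    _ ≤ (K₀ : ℝ≥0∞) * ((2 * ENNReal.ofReal ‖u‖) * K₁) := by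
        gcongr
        exact h3.trans (by gcongr)
    _ = _ := by push_cast; ring

/-- The Sobolev inequality passes from test functions to their closure by Fatou's lemma. -/
theorem memLp_four_of_mem_zeroBd {ℓ : ℝ} {u : W12 (square ℓ)}
    (hu : u ∈ W12.zeroBd (square ℓ)) : MemLp u.toFun 4 (volume.restrict (square ℓ)) := by
  obtain ⟨K, hK⟩ := exists_eLpNorm_four_le ℓ
  obtain ⟨w, hw, hlim⟩ := mem_closure_iff_seq_limit.1
    (show u ∈ closure (W12.tests (square ℓ) : Set (W12 (square ℓ))) from hu)
  obtain ⟨θ, hθ, hae⟩ := exists_subseq_tendsto_ae (u := fun n (_ : Fin 3) => w n)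
    (v := fun _ => u) (tendsto_pi_nhds.2 fun _ => hlim)
  refine ⟨u.memLp_toFun.aestronglyMeasurable, ?_⟩
  have h1 := Lp.eLpNorm_lim_le_liminf_eLpNorm (p := 4)
    (fun n => (w (θ n)).memLp_toFun.aestronglyMeasurable) u.toFun
    (by filter_upwards [hae] with p hp using (hp 0).1)
  refine h1.trans_lt ?_
  have h2 : Tendsto (fun n => (K : ℝ≥0∞) * ENNReal.ofReal ‖w (θ n)‖) atTop
      (𝓝 (K * ENNReal.ofReal ‖u‖)) :=
    ENNReal.Tendsto.const_mul (ENNReal.tendsto_ofReal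
      ((hlim.comp hθ.tendsto_atTop).norm)) (Or.inr ENNReal.coe_ne_top)
  calc _ ≤ liminf (fun n => (K : ℝ≥0∞) * ENNReal.ofReal ‖w (θ n)‖) atTop :=
        liminf_le_liminf (Eventually.of_forall fun n => hK _ (hw _))
    _ = K * ENNReal.ofReal ‖u‖ := h2.liminf_eq
    _ < ⊤ := ENNReal.mul_lt_top ENNReal.coe_lt_top ENNReal.ofReal_lt_top

section Energy

variable (A B C L lam M : ℝ)

theorem integrable_density {q₁ q₂ q₃ : W12 Ω} [IsFiniteMeasure (volume.restrict Ω)]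
    (h₁ : MemLp q₁.toFun 4 (volume.restrict Ω)) (h₂ : MemLp q₂.toFun 4 (volume.restrict Ω))
    (h₃ : MemLp q₃.toFun 4 (volume.restrict Ω)) :
    Integrable (density A B C L lam M q₁ q₂ q₃) (volume.restrict Ω) := by
  have sq : ∀ {f : ℝ × ℝ → ℝ}, MemLp f 4 (volume.restrict Ω) →
      MemLp (fun p => f p ^ 2) 2 (volume.restrict Ω) := by
    intro f hf
    have : ENNReal.HolderTriple 4 4 2 := ⟨by
      rw [← two_mul, ← ENNReal.toReal_eq_toReal_iff' (by finiteness) (by simp)]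
      norm_num⟩
    have := hf.mul (r := 2) hf
    simpa [_root_.sq, Pi.mul_def] using this
  have s1 := sq h₁
  have s2 := sq h₂
  have s3 := sq h₃
  have hS : MemLp (fun p => q₁.toFun p ^ 2 + q₂.toFun p ^ 2 + 3 * q₃.toFun p ^ 2) 2
    (volume.restrict Ω) := (s1.add s2).add (s3.const_mul 3)
  have hT : MemLp (fun p => q₁.toFun p ^ 2 + q₂.toFun p ^ 2 - q₃.toFun p ^ 2) 2
    (volume.restrict Ω) := (s1.add s2).sub s3
  have iT : Integrable (fun p => 2 * B * q₃.toFun p *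
      (q₁.toFun p ^ 2 + q₂.toFun p ^ 2 - q₃.toFun p ^ 2)) (volume.restrict Ω) :=
    (q₃.memLp_toFun.const_mul (2 * B)).integrable_mul hT
  have iS : Integrable (fun p => q₁.toFun p ^ 2 + q₂.toFun p ^ 2 + 3 * q₃.toFun p ^ 2)
    (volume.restrict Ω) := hS.integrable (by norm_num)
  have hbulk : Integrable (fun p => bulk A B C (q₁.toFun p) (q₂.toFun p) (q₃.toFun p))
      (volume.restrict Ω) :=
    ((iS.const_mul A).add (hS.integrable_sq.const_mul C)).add iT
  have m : ∀ {f g : ℝ × ℝ → ℝ}, MemLp f 2 (volume.restrict Ω) → MemLp g 2 (volume.restrict Ω) →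
      Integrable (fun p => f p * g p) (volume.restrict Ω) := fun hf hg => hf.integrable_mul hg
  have sx := fun u : W12 Ω => u.memLp_dx.integrable_sq
  have sy := fun u : W12 Ω => u.memLp_dy.integrable_sq
  have hel : Integrable (fun p => elastic M (q₁.dx p) (q₁.dy p) (q₂.dx p) (q₂.dy p) (q₃.dx p)
      (q₃.dy p)) (volume.restrict Ω) :=
    ((((((sx q₁).add (sy q₁)).const_mul _).add (((sx q₂).add (sy q₂)).const_mul _)).add
      (((sx q₃).add (sy q₃)).const_mul _)).add
      (((((m q₁.memLp_dy q₃.memLp_dy).sub (m q₁.memLp_dx q₃.memLp_dx)).sub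
        (m q₂.memLp_dy q₃.memLp_dx)).sub (m q₂.memLp_dx q₃.memLp_dy)).const_mul _)).add
      (((m q₂.memLp_dy q₁.memLp_dx).sub (m q₁.memLp_dy q₂.memLp_dx)).const_mul _)
  exact hel.add (hbulk.const_mul _)

/-- The derivative of the energy density at `q` in the direction `v`. -/
def dDensity (q v : Fin 3 → W12 Ω) (p : ℝ × ℝ) : ℝ :=
  2 * (1 + M / 2) * ((q 0).dx p * (v 0).dx p + (q 0).dy p * (v 0).dy p)
    + 2 * (1 + M / 2) * ((q 1).dx p * (v 1).dx p + (q 1).dy p * (v 1).dy p)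
    + 2 * (3 + M / 2) * ((q 2).dx p * (v 2).dx p + (q 2).dy p * (v 2).dy p)
    + M * (((q 0).dy p * (v 2).dy p + (v 0).dy p * (q 2).dy p)
      - ((q 0).dx p * (v 2).dx p + (v 0).dx p * (q 2).dx p)
      - ((q 1).dy p * (v 2).dx p + (v 1).dy p * (q 2).dx p)
      - ((q 1).dx p * (v 2).dy p + (v 1).dx p * (q 2).dy p))
    + |M| * (((q 1).dy p * (v 0).dx p + (v 1).dy p * (q 0).dx p)
      - ((q 0).dy p * (v 1).dx p + (v 0).dy p * (q 1).dx p))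
    + lam ^ 2 / L *
      ((2 * A + 4 * C * ((q 0).toFun p ^ 2 + (q 1).toFun p ^ 2 + 3 * (q 2).toFun p ^ 2))
        * ((q 0).toFun p * (v 0).toFun p + (q 1).toFun p * (v 1).toFun p
          + 3 * ((q 2).toFun p * (v 2).toFun p))
      + 2 * B * (v 2).toFun p * ((q 0).toFun p ^ 2 + (q 1).toFun p ^ 2 - (q 2).toFun p ^ 2)
      + 4 * B * (q 2).toFun p * ((q 0).toFun p * (v 0).toFun p + (q 1).toFun p * (v 1).toFun p
          - (q 2).toFun p * (v 2).toFun p))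

/-- The density along the line `q + t v`. -/
def lineDensity (q v : Fin 3 → W12 Ω) (t : ℝ) : ℝ × ℝ → ℝ :=
  density A B C L lam M ((q 0).lin t (v 0)) ((q 1).lin t (v 1)) ((q 2).lin t (v 2))

/-- Along a line, the density is a polynomial of degree four in the parameter, whose linear
coefficient is found from its values at `±1`, `±2`. -/
theorem dDensity_eq (q v : Fin 3 → W12 Ω) (p : ℝ × ℝ) :
    dDensity A B C L lam M q v p = (8 * (lineDensity A B C L lam M q v 1 p
      - lineDensity A B C L lam M q v (-1) p) - (lineDensity A B C L lam M q v 2 p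
      - lineDensity A B C L lam M q v (-2) p)) / 12 := by
  simp only [dDensity, lineDensity, density, elastic, bulk, W12.lin]
  ring

theorem lineDensity_eq (q v : Fin 3 → W12 Ω) (t : ℝ) (p : ℝ × ℝ) :
    lineDensity A B C L lam M q v t p = lineDensity A B C L lam M q v 0 p
      + t * dDensity A B C L lam M q v p
      + t ^ 2 * ((16 * (lineDensity A B C L lam M q v 1 p + lineDensity A B C L lam M q v (-1) p)
        - (lineDensity A B C L lam M q v 2 p + lineDensity A B C L lam M q v (-2) p)
        - 30 * lineDensity A B C L lam M q v 0 p) / 24)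
      + t ^ 3 * (((lineDensity A B C L lam M q v 2 p - lineDensity A B C L lam M q v (-2) p)
        - 2 * (lineDensity A B C L lam M q v 1 p - lineDensity A B C L lam M q v (-1) p)) / 12)
      + t ^ 4 * (((lineDensity A B C L lam M q v 2 p + lineDensity A B C L lam M q v (-2) p)
        - 4 * (lineDensity A B C L lam M q v 1 p + lineDensity A B C L lam M q v (-1) p)
        + 6 * lineDensity A B C L lam M q v 0 p) / 24) := by
  simp only [dDensity, lineDensity, density, elastic, bulk, W12.lin]
  ring

variable [IsFiniteMeasure (volume.restrict Ω)]

theorem integrable_lineDensity {q v : Fin 3 → W12 Ω}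
    (hq : ∀ k, MemLp (q k).toFun 4 (volume.restrict Ω))
    (hv : ∀ k, MemLp (v k).toFun 4 (volume.restrict Ω)) (t : ℝ) :
    Integrable (lineDensity A B C L lam M q v t) (volume.restrict Ω) :=
  integrable_density A B C L lam M ((hq 0).add ((hv 0).const_mul t))
    ((hq 1).add ((hv 1).const_mul t)) ((hq 2).add ((hv 2).const_mul t))

theorem integrable_dDensity {q v : Fin 3 → W12 Ω}
    (hq : ∀ k, MemLp (q k).toFun 4 (volume.restrict Ω))
    (hv : ∀ k, MemLp (v k).toFun 4 (volume.restrict Ω)) :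
    Integrable (dDensity A B C L lam M q v) (volume.restrict Ω) := by
  have h := integrable_lineDensity A B C L lam M hq hv
  rw [show dDensity A B C L lam M q v = _ from funext (dDensity_eq A B C L lam M q v)]
  exact ((((h 1).sub (h (-1))).const_mul 8).sub ((h 2).sub (h (-2)))).div_const 12

/-- The first variation of the energy is the integral of the derivative of the density. -/
theorem hasDerivAt_energy {q v : Fin 3 → W12 Ω}
    (hq : ∀ k, MemLp (q k).toFun 4 (volume.restrict Ω))
    (hv : ∀ k, MemLp (v k).toFun 4 (volume.restrict Ω)) :
    HasDerivAt (fun t => energy A B C L lam M ((q 0).lin t (v 0)) ((q 1).lin t (v 1))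
      ((q 2).lin t (v 2))) (∫ p in Ω, dDensity A B C L lam M q v p) 0 := by
  have h := integrable_lineDensity A B C L lam M hq hv
  have hd := integrable_dDensity A B C L lam M hq hv
  set c₂ : ℝ × ℝ → ℝ := fun p => (16 * (lineDensity A B C L lam M q v 1 p
    + lineDensity A B C L lam M q v (-1) p) - (lineDensity A B C L lam M q v 2 p
    + lineDensity A B C L lam M q v (-2) p) - 30 * lineDensity A B C L lam M q v 0 p) / 24 with hc₂
  set c₃ : ℝ × ℝ → ℝ := fun p => ((lineDensity A B C L lam M q v 2 p
    - lineDensity A B C L lam M q v (-2) p) - 2 * (lineDensity A B C L lam M q v 1 p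
    - lineDensity A B C L lam M q v (-1) p)) / 12 with hc₃
  set c₄ : ℝ × ℝ → ℝ := fun p => ((lineDensity A B C L lam M q v 2 p
    + lineDensity A B C L lam M q v (-2) p) - 4 * (lineDensity A B C L lam M q v 1 p
    + lineDensity A B C L lam M q v (-1) p) + 6 * lineDensity A B C L lam M q v 0 p) / 24 with hc₄
  have i₂ : Integrable c₂ (volume.restrict Ω) :=
    (((((h 1).add (h (-1))).const_mul 16).sub ((h 2).add (h (-2)))).sub
      ((h 0).const_mul 30)).div_const 24
  have i₃ : Integrable c₃ (volume.restrict Ω) :=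
    (((h 2).sub (h (-2))).sub (((h 1).sub (h (-1))).const_mul 2)).div_const 12
  have i₄ : Integrable c₄ (volume.restrict Ω) :=
    ((((h 2).add (h (-2))).sub (((h 1).add (h (-1))).const_mul 4)).add
      ((h 0).const_mul 6)).div_const 24
  have e : ∀ t, energy A B C L lam M ((q 0).lin t (v 0)) ((q 1).lin t (v 1)) ((q 2).lin t (v 2))
      = (∫ p in Ω, lineDensity A B C L lam M q v 0 p)
        + t * (∫ p in Ω, dDensity A B C L lam M q v p) + t ^ 2 * (∫ p in Ω, c₂ p)
        + t ^ 3 * (∫ p in Ω, c₃ p) + t ^ 4 * ∫ p in Ω, c₄ p := by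
    intro t
    have j1 := (h 0).add (hd.const_mul t)
    have j2 := j1.add (i₂.const_mul (t ^ 2))
    have j3 := j2.add (i₃.const_mul (t ^ 3))
    rw [← integral_const_mul, ← integral_const_mul, ← integral_const_mul, ← integral_const_mul,
      ← integral_add (h 0) (hd.const_mul t)]
    refine Eq.trans ?_ (congrArg (· + ∫ p in Ω, t ^ 4 * c₄ p)
      (congrArg (· + ∫ p in Ω, t ^ 3 * c₃ p) (integral_add j1 (i₂.const_mul (t ^ 2)))))
    refine Eq.trans ?_ (congrArg (· + ∫ p in Ω, t ^ 4 * c₄ p)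
      (integral_add j2 (i₃.const_mul (t ^ 3))))
    refine Eq.trans ?_ (integral_add j3 (i₄.const_mul (t ^ 4)))
    exact integral_congr_ae (Eventually.of_forall (lineDensity_eq A B C L lam M q v t))
  rw [funext e]
  have hp : ∀ n : ℕ, HasDerivAt (fun t : ℝ => t ^ n) (n * (0 : ℝ) ^ (n - 1)) 0 :=
    fun n => hasDerivAt_pow n 0
  have := (((((hasDerivAt_const (0 : ℝ) (∫ p in Ω, lineDensity A B C L lam M q v 0 p)).add
    ((hasDerivAt_id (0 : ℝ)).mul_const (∫ p in Ω, dDensity A B C L lam M q v p))).add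
    ((hp 2).mul_const (∫ p in Ω, c₂ p))).add ((hp 3).mul_const (∫ p in Ω, c₃ p))).add
    ((hp 4).mul_const (∫ p in Ω, c₄ p)))
  exact this.congr_deriv (by simp)

end Energy

end

/-! ### Convexity, coercivity, and the direct method -/

/-- For `M > -1` the elastic energy density is uniformly positive definite. -/
theorem elastic_ge (M a₁ b₁ a₂ b₂ a₃ b₃ : ℝ) :
    min 1 (1 + M) * (a₁ ^ 2 + b₁ ^ 2 + a₂ ^ 2 + b₂ ^ 2 + a₃ ^ 2 + b₃ ^ 2)
      ≤ elastic M a₁ b₁ a₂ b₂ a₃ b₃ := by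
  rcases le_total 0 M with h | h
  · -- here the anisotropic part is a sum of two squares
    have e : elastic M a₁ b₁ a₂ b₂ a₃ b₃ = a₁ ^ 2 + b₁ ^ 2 + a₂ ^ 2 + b₂ ^ 2
        + 3 * (a₃ ^ 2 + b₃ ^ 2) + M / 2 * ((a₁ + b₂ - a₃) ^ 2 + (a₂ - b₁ - b₃) ^ 2) := by
      rw [elastic, abs_of_nonneg h]; ring
    rw [e, min_eq_left (by linarith)]
    have : 0 ≤ M / 2 * ((a₁ + b₂ - a₃) ^ 2 + (a₂ - b₁ - b₃) ^ 2) := by positivity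
    nlinarith [sq_nonneg a₃, sq_nonneg b₃]
  · -- here too a sum of two squares splits off, now with opposite sign in `q₃`
    have e : elastic M a₁ b₁ a₂ b₂ a₃ b₃ = (1 + M) * (a₁ ^ 2 + b₁ ^ 2 + a₂ ^ 2 + b₂ ^ 2)
        + (3 + M) * (a₃ ^ 2 + b₃ ^ 2)
        + -M / 2 * ((a₁ + b₂ + a₃) ^ 2 + (a₂ - b₁ + b₃) ^ 2) := by
      rw [elastic, abs_of_nonpos h]; ring
    rw [e, min_eq_right (by linarith)]
    have : 0 ≤ -M / 2 * ((a₁ + b₂ + a₃) ^ 2 + (a₂ - b₁ + b₃) ^ 2) :=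
      mul_nonneg (by linarith) (by positivity)
    nlinarith [sq_nonneg a₃, sq_nonneg b₃]

theorem elastic_midpoint (M : ℝ) (a₁ b₁ a₂ b₂ a₃ b₃ a₁' b₁' a₂' b₂' a₃' b₃' : ℝ) :
    elastic M ((a₁ + a₁') / 2) ((b₁ + b₁') / 2) ((a₂ + a₂') / 2) ((b₂ + b₂') / 2)
        ((a₃ + a₃') / 2) ((b₃ + b₃') / 2)
      + 1 / 4 * elastic M (a₁ - a₁') (b₁ - b₁') (a₂ - a₂') (b₂ - b₂') (a₃ - a₃') (b₃ - b₃')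
      = (elastic M a₁ b₁ a₂ b₂ a₃ b₃ + elastic M a₁' b₁' a₂' b₂' a₃' b₃') / 2 := by
  simp only [elastic]; ring

/-- The quartic part of the bulk energy dominates. -/
theorem bulk_coercive (A B : ℝ) {C : ℝ} (hC : 0 < C) :
    ∃ K : ℝ, ∀ x y z : ℝ, x ^ 2 + y ^ 2 + z ^ 2 - K ≤ bulk A B C x y z := by
  refine ⟨(|A| + 4 * B ^ 2 / C + 1) ^ 2 / (3 * C), fun x y z => ?_⟩
  set N := x ^ 2 + y ^ 2 + 3 * z ^ 2 with hN
  set k := |A| + 4 * B ^ 2 / C + 1 with hk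
  have hN0 : 0 ≤ N := by positivity
  have hT : |x ^ 2 + y ^ 2 - z ^ 2| ≤ N := by
    rw [abs_le]; constructor <;> nlinarith [sq_nonneg x, sq_nonneg y, sq_nonneg z]
  have h1 : -(2 * |B| * |z| * N) ≤ 2 * B * z * (x ^ 2 + y ^ 2 - z ^ 2) := by
    have : |2 * B * z * (x ^ 2 + y ^ 2 - z ^ 2)| ≤ 2 * |B| * |z| * N := by
      rw [abs_mul, abs_mul, abs_mul, abs_two]; gcongr
    exact (abs_le.1 this).1
  have h2 : 2 * |B| * |z| * N ≤ C / 4 * N ^ 2 + 4 * B ^ 2 / C * N := by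
    have h3 : C / 4 * N ^ 2 + 4 * B ^ 2 / C * z ^ 2 - 2 * |B| * |z| * N
        = (C * N / 2 - 2 * |B| * |z|) ^ 2 / C := by
      field_simp
      rw [← sq_abs B, ← sq_abs z]; ring
    have h4 : 0 ≤ (C * N / 2 - 2 * |B| * |z|) ^ 2 / C := by positivity
    have h5 : 4 * B ^ 2 / C * z ^ 2 ≤ 4 * B ^ 2 / C * N := by
      gcongr; nlinarith [sq_nonneg x, sq_nonneg y, sq_nonneg z]
    linarith
  have h6 : -|A| * N ≤ A * N := mul_le_mul_of_nonneg_right (neg_abs_le A) hN0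
  have h7 : k * N ≤ 3 * C / 4 * N ^ 2 + k ^ 2 / (3 * C) := by
    have h8 : 3 * C / 4 * N ^ 2 + k ^ 2 / (3 * C) - k * N = (3 * C * N / 2 - k) ^ 2 / (3 * C) := by
      field_simp; ring
    have h9 : 0 ≤ (3 * C * N / 2 - k) ^ 2 / (3 * C) := by positivity
    linarith
  have h10 : x ^ 2 + y ^ 2 + z ^ 2 ≤ N := by nlinarith [sq_nonneg z]
  have e : bulk A B C x y z = A * N + C * N ^ 2 + 2 * B * z * (x ^ 2 + y ^ 2 - z ^ 2) := rfl
  have e2 : k * N = |A| * N + 4 * B ^ 2 / C * N + N := by rw [hk]; ring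
  rw [e]
  linarith

/-- A bound for the second difference, at `m` in the direction `h`, of the cubic term of the bulk
energy. -/
theorem abs_cubic_second_difference_le {r m₁ m₂ m₃ : ℝ} (hm₁ : |m₁| ≤ r) (hm₂ : |m₂| ≤ r)
    (hm₃ : |m₃| ≤ r) (h₁ h₂ h₃ : ℝ) :
    |m₃ * (h₁ ^ 2 + h₂ ^ 2 - 3 * h₃ ^ 2) + 2 * h₃ * (m₁ * h₁ + m₂ * h₂)|
      ≤ 2 * r * (h₁ ^ 2 + h₂ ^ 2 + 3 * h₃ ^ 2) := by
  have hr0 : 0 ≤ r := (abs_nonneg _).trans hm₁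
  have t1 : |m₃ * (h₁ ^ 2 + h₂ ^ 2 - 3 * h₃ ^ 2)| ≤ r * (h₁ ^ 2 + h₂ ^ 2 + 3 * h₃ ^ 2) := by
    rw [abs_mul]
    refine mul_le_mul hm₃ ?_ (abs_nonneg _) hr0
    rw [abs_le]
    constructor <;> linarith [sq_nonneg h₁, sq_nonneg h₂, sq_nonneg h₃]
  have t2 : |2 * h₃ * (m₁ * h₁ + m₂ * h₂)| ≤ r * (h₁ ^ 2 + h₂ ^ 2 + 3 * h₃ ^ 2) := by
    have a1 : |m₁ * h₁ + m₂ * h₂| ≤ r * |h₁| + r * |h₂| := by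
      refine (abs_add_le _ _).trans ?_
      rw [abs_mul, abs_mul]
      gcongr
    calc |2 * h₃ * (m₁ * h₁ + m₂ * h₂)| = 2 * |h₃| * |m₁ * h₁ + m₂ * h₂| := by
          rw [abs_mul, abs_mul, abs_two]
      _ ≤ 2 * |h₃| * (r * |h₁| + r * |h₂|) := by gcongr
      _ = r * (2 * |h₃| * |h₁| + 2 * |h₃| * |h₂|) := by ring
      _ ≤ r * (h₁ ^ 2 + h₂ ^ 2 + 3 * h₃ ^ 2) := by
          refine mul_le_mul_of_nonneg_left ?_ hr0
          have b1 := two_mul_le_add_sq |h₃| |h₁|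
          have b2 := two_mul_le_add_sq |h₃| |h₂|
          rw [sq_abs, sq_abs] at b1 b2
          linarith [sq_nonneg h₃]
  calc _ ≤ _ := abs_add_le _ _
    _ ≤ 2 * r * (h₁ ^ 2 + h₂ ^ 2 + 3 * h₃ ^ 2) := by linarith

theorem four_mul_abs_mul_le (B : ℝ) {C : ℝ} (hC : 0 < C) (r : ℝ) :
    4 * |B| * r ≤ 2 * C * r ^ 2 + 2 * B ^ 2 / C := by
  have e : 2 * C * r ^ 2 + 2 * B ^ 2 / C - 4 * |B| * r = 2 * (C * r - |B|) ^ 2 / C := by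
    rw [← sq_abs B]; field_simp; ring
  have : 0 ≤ 2 * (C * r - |B|) ^ 2 / C := by positivity
  linarith

/-- The second differences of the bulk energy are bounded below, since the quartic term controls
the cubic one. -/
theorem bulk_second_difference_ge (A B : ℝ) {C : ℝ} (hC : 0 < C) (m₁ m₂ m₃ h₁ h₂ h₃ : ℝ) :
    bulk A B C m₁ m₂ m₃ - (|A| + 2 * B ^ 2 / C) * (h₁ ^ 2 + h₂ ^ 2 + 3 * h₃ ^ 2)
      ≤ (bulk A B C (m₁ + h₁) (m₂ + h₂) (m₃ + h₃)
        + bulk A B C (m₁ - h₁) (m₂ - h₂) (m₃ - h₃)) / 2 := by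
  have hN0 : 0 ≤ m₁ ^ 2 + m₂ ^ 2 + 3 * m₃ ^ 2 := by positivity
  obtain ⟨r, hr0, hr⟩ : ∃ r, 0 ≤ r ∧ r ^ 2 = m₁ ^ 2 + m₂ ^ 2 + 3 * m₃ ^ 2 :=
    ⟨_, Real.sqrt_nonneg _, Real.sq_sqrt hN0⟩
  have hT := abs_cubic_second_difference_le (r := r) (m₁ := m₁) (m₂ := m₂) (m₃ := m₃)
    (abs_le_of_sq_le_sq (by linarith [sq_nonneg m₂, sq_nonneg m₃]) hr0)
    (abs_le_of_sq_le_sq (by linarith [sq_nonneg m₁, sq_nonneg m₃]) hr0)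
    (abs_le_of_sq_le_sq (by linarith [sq_nonneg m₁, sq_nonneg m₂, sq_nonneg m₃]) hr0) h₁ h₂ h₃
  have e : (bulk A B C (m₁ + h₁) (m₂ + h₂) (m₃ + h₃)
      + bulk A B C (m₁ - h₁) (m₂ - h₂) (m₃ - h₃)) / 2
      = bulk A B C m₁ m₂ m₃ + A * (h₁ ^ 2 + h₂ ^ 2 + 3 * h₃ ^ 2)
        + 2 * C * (m₁ ^ 2 + m₂ ^ 2 + 3 * m₃ ^ 2) * (h₁ ^ 2 + h₂ ^ 2 + 3 * h₃ ^ 2)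
        + C * ((h₁ ^ 2 + h₂ ^ 2 + 3 * h₃ ^ 2) ^ 2 + 4 * (m₁ * h₁ + m₂ * h₂ + 3 * (m₃ * h₃)) ^ 2)
        + 2 * B * (m₃ * (h₁ ^ 2 + h₂ ^ 2 - 3 * h₃ ^ 2) + 2 * h₃ * (m₁ * h₁ + m₂ * h₂)) := by
    simp only [bulk]; ring
  have hquart : 0 ≤ C * ((h₁ ^ 2 + h₂ ^ 2 + 3 * h₃ ^ 2) ^ 2
    + 4 * (m₁ * h₁ + m₂ * h₂ + 3 * (m₃ * h₃)) ^ 2) := by positivity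
  have hP0 : 0 ≤ h₁ ^ 2 + h₂ ^ 2 + 3 * h₃ ^ 2 := by positivity
  rw [e, ← hr]
  generalize m₃ * (h₁ ^ 2 + h₂ ^ 2 - 3 * h₃ ^ 2) + 2 * h₃ * (m₁ * h₁ + m₂ * h₂) = T at *
  generalize C * ((h₁ ^ 2 + h₂ ^ 2 + 3 * h₃ ^ 2) ^ 2
    + 4 * (m₁ * h₁ + m₂ * h₂ + 3 * (m₃ * h₃)) ^ 2) = Q at *
  generalize h₁ ^ 2 + h₂ ^ 2 + 3 * h₃ ^ 2 = P at *
  have hA : -|A| * P ≤ A * P := mul_le_mul_of_nonneg_right (neg_abs_le A) hP0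
  have b1 : |2 * B * T| ≤ 2 * |B| * (2 * r * P) := by
    rw [abs_mul, abs_mul, abs_two]; gcongr
  have b2 := mul_le_mul_of_nonneg_right (four_mul_abs_mul_le B hC r) hP0
  have b3 := (abs_le.1 b1).1
  linarith

/-- The bulk energy is convex up to a multiple of `|q|²`. -/
theorem bulk_midpoint (A B : ℝ) {C : ℝ} (hC : 0 < C) : ∃ K : ℝ, 0 ≤ K ∧
    ∀ x y z x' y' z' : ℝ, bulk A B C ((x + x') / 2) ((y + y') / 2) ((z + z') / 2)
      ≤ (bulk A B C x y z + bulk A B C x' y' z') / 2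
        + K * ((x - x') ^ 2 + (y - y') ^ 2 + (z - z') ^ 2) := by
  refine ⟨|A| + 2 * B ^ 2 / C, by positivity, fun x y z x' y' z' => ?_⟩
  have h := bulk_second_difference_ge A B hC ((x + x') / 2) ((y + y') / 2) ((z + z') / 2)
    ((x - x') / 2) ((y - y') / 2) ((z - z') / 2)
  have e1 : ∀ s t : ℝ, (s + t) / 2 + (s - t) / 2 = s := fun s t => by ring
  have e2 : ∀ s t : ℝ, (s + t) / 2 - (s - t) / 2 = t := fun s t => by ring
  simp only [e1, e2] at h
  have hK : 0 ≤ |A| + 2 * B ^ 2 / C := by positivity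
  have h2 : (|A| + 2 * B ^ 2 / C) * (((x - x') / 2) ^ 2 + ((y - y') / 2) ^ 2
      + 3 * ((z - z') / 2) ^ 2)
      ≤ (|A| + 2 * B ^ 2 / C) * ((x - x') ^ 2 + (y - y') ^ 2 + (z - z') ^ 2) := by
    refine mul_le_mul_of_nonneg_left ?_ hK
    linarith [sq_nonneg (x - x'), sq_nonneg (y - y'), sq_nonneg (z - z')]
  linarith

/-- An abstract form of the direct method. A functional that is bounded below on `S` attains its
minimum there if it is uniformly midpoint convex up to a functional `N` of the difference, if a
sequence with bounded values has a subsequence along which `N` of the differences tends to `0`,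
and if it is lower semicontinuous along convergent sequences. The convexity makes a minimizing
sequence converge strongly, so that no weak topology is needed. -/
theorem exists_forall_le_of_midpoint {X : Type*} [SeminormedAddCommGroup X] [CompleteSpace X]
    {S : Set X} (hne : S.Nonempty) {F : X → ℝ} {N : X → ℝ} {c : ℝ} (hc : 0 < c)
    (hbdd : BddBelow (F '' S))
    (hmid : ∀ u ∈ S, ∀ v ∈ S, ∃ w ∈ S, F w + c * ‖u - v‖ ^ 2 ≤ (F u + F v) / 2 + N (u - v))
    (hcomp : ∀ (u : ℕ → X) (R : ℝ), (∀ n, u n ∈ S ∧ F (u n) ≤ R) → ∃ θ : ℕ → ℕ, StrictMono θ ∧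
      ∀ ε : ℝ, 0 < ε → ∃ K, ∀ n ≥ K, ∀ m ≥ K, N (u (θ n) - u (θ m)) < ε)
    (hlsc : ∀ (u : ℕ → X) (v : X) (a : ℝ), (∀ n, u n ∈ S) → Tendsto u atTop (𝓝 v) →
      Tendsto (fun n => F (u n)) atTop (𝓝 a) → ∃ w ∈ S, F w ≤ a) :
    ∃ w ∈ S, ∀ v ∈ S, F w ≤ F v := by
  set m := sInf (F '' S)
  have hm : ∀ v ∈ S, m ≤ F v := fun v hv => csInf_le hbdd ⟨v, hv, rfl⟩
  obtain ⟨a, -, ha, haS⟩ := exists_seq_tendsto_sInf (hne.image F) hbdd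
  choose u hu hFu using haS
  have hlim : Tendsto (fun n => F (u n)) atTop (𝓝 m) := by simpa only [hFu] using ha
  obtain ⟨R, hR⟩ := hlim.bddAbove_range
  obtain ⟨θ, hθ, hN⟩ := hcomp u R fun n => ⟨hu n, hR ⟨n, rfl⟩⟩
  have hlim' : Tendsto (fun n => F (u (θ n))) atTop (𝓝 m) := hlim.comp hθ.tendsto_atTop
  have hcauchy : CauchySeq fun n => u (θ n) := by
    rw [Metric.cauchySeq_iff]
    intro ε hε
    have hε2 : 0 < c * ε ^ 2 / 2 := by positivity
    obtain ⟨K₁, hK₁⟩ := hN _ hε2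
    obtain ⟨K₂, hK₂⟩ := eventually_atTop.1 (hlim'.eventually (gt_mem_nhds
      (show m < m + c * ε ^ 2 / 2 by linarith)))
    refine ⟨max K₁ K₂, fun i hi j hj => ?_⟩
    obtain ⟨w, hw, hle⟩ := hmid _ (hu (θ i)) _ (hu (θ j))
    have h1 := hm w hw
    have h2 := hK₁ i ((le_max_left _ _).trans hi) j ((le_max_left _ _).trans hj)
    have h3 := hK₂ i ((le_max_right _ _).trans hi)
    have h4 := hK₂ j ((le_max_right _ _).trans hj)
    rw [dist_eq_norm]
    have h5 : c * ‖u (θ i) - u (θ j)‖ ^ 2 < c * ε ^ 2 := by linarith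
    exact lt_of_pow_lt_pow_left₀ 2 hε.le (lt_of_mul_lt_mul_left h5 hc.le)
  obtain ⟨v, hv⟩ := cauchySeq_tendsto_of_complete hcauchy
  obtain ⟨w, hw, hle⟩ := hlsc _ v m (fun n => hu (θ n)) hv hlim'
  exact ⟨w, hw, fun v hv => hle.trans (hm v hv)⟩

/-- Fatou's lemma for a sequence of integrable functions with a common lower bound, on a finite
measure space. -/
theorem integral_le_of_tendsto_ae {α : Type*} [MeasurableSpace α] {μ : Measure α}
    [IsFiniteMeasure μ] {f : ℕ → α → ℝ} {g : α → ℝ} {a b : ℝ} (hf : ∀ n, Integrable (f n) μ)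
    (hg : Integrable g μ) (hb : ∀ n x, b ≤ f n x)
    (hlim : ∀ᵐ x ∂μ, Tendsto (fun n => f n x) atTop (𝓝 (g x)))
    (ha : Tendsto (fun n => ∫ x, f n x ∂μ) atTop (𝓝 a)) : ∫ x, g x ∂μ ≤ a := by
  have hgb : ∀ᵐ x ∂μ, 0 ≤ g x - b := by
    filter_upwards [hlim] with x hx
    exact sub_nonneg.2 (ge_of_tendsto' hx fun n => hb n x)
  have h1 : ∀ n, ENNReal.ofReal (∫ x, (f n x - b) ∂μ) = ∫⁻ x, ENNReal.ofReal (f n x - b) ∂μ :=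
    fun n => ofReal_integral_eq_lintegral_ofReal ((hf n).sub (integrable_const b))
      (Eventually.of_forall fun x => sub_nonneg.2 (hb n x))
  have h2 : ENNReal.ofReal (∫ x, (g x - b) ∂μ) = ∫⁻ x, ENNReal.ofReal (g x - b) ∂μ :=
    ofReal_integral_eq_lintegral_ofReal (hg.sub (integrable_const b)) hgb
  have h3 : ∫⁻ x, ENNReal.ofReal (g x - b) ∂μ
      ≤ liminf (fun n => ∫⁻ x, ENNReal.ofReal (f n x - b) ∂μ) atTop := by
    refine le_trans (le_of_eq (lintegral_congr_ae ?_)) (lintegral_liminf_le' fun n =>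
      ((hf n).sub (integrable_const b)).aestronglyMeasurable.aemeasurable.ennreal_ofReal)
    filter_upwards [hlim] with x hx
    exact (ENNReal.tendsto_ofReal (hx.sub_const b)).liminf_eq.symm
  have h4 : Tendsto (fun n => ENNReal.ofReal (∫ x, (f n x - b) ∂μ)) atTop
      (𝓝 (ENNReal.ofReal (a - ∫ _, b ∂μ))) := by
    refine ENNReal.tendsto_ofReal ?_
    simp only [fun n => integral_sub (hf n) (integrable_const b)]
    exact ha.sub_const _
  simp only [← h1] at h3
  rw [← h2, h4.liminf_eq, integral_sub hg (integrable_const b)] at h3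
  have h5 : 0 ≤ a - ∫ _, b ∂μ := by
    refine ge_of_tendsto' (ha.sub_const _) fun n => ?_
    rw [← integral_sub (hf n) (integrable_const b)]
    exact integral_nonneg fun x => sub_nonneg.2 (hb n x)
  linarith [(ENNReal.ofReal_le_ofReal_iff h5).1 h3]

/-! ### Minimization among symmetric triples -/

/-- The sum of the squares of `u` and of its first derivatives, whose integral is the squared
`W^{1,2}`-norm. -/
def W12.jetSq {Ω : Set (ℝ × ℝ)} (u : W12 Ω) (p : ℝ × ℝ) : ℝ :=
  u.toFun p ^ 2 + u.dx p ^ 2 + u.dy p ^ 2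

theorem W12.integrable_jetSq {Ω : Set (ℝ × ℝ)} (u : W12 Ω) :
    Integrable u.jetSq (volume.restrict Ω) :=
  (u.memLp_toFun.integrable_sq.add u.memLp_dx.integrable_sq).add u.memLp_dy.integrable_sq

section Pointwise

variable {Ω : Set (ℝ × ℝ)} {A B C L lam M : ℝ}

/-- Coercivity of the energy density in the function and its derivatives. -/
theorem density_ge (hC : 0 < C) (hL : 0 < L) (hlam : 0 < lam) (hM : -1 < M) :
    ∃ c K : ℝ, 0 < c ∧ ∀ (q : Fin 3 → W12 Ω) (p : ℝ × ℝ),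
      c * (∑ k, (q k).jetSq p) - K ≤ density A B C L lam M (q 0) (q 1) (q 2) p := by
  obtain ⟨K, hK⟩ := bulk_coercive A B hC
  set κ := lam ^ 2 / L
  have hκ : 0 < κ := by positivity
  set c₀ := min 1 (1 + M)
  have hc₀ : 0 < c₀ := lt_min one_pos (by linarith)
  refine ⟨min c₀ κ, κ * K, lt_min hc₀ hκ, fun q p => ?_⟩
  have h1 := elastic_ge M ((q 0).dx p) ((q 0).dy p) ((q 1).dx p) ((q 1).dy p) ((q 2).dx p)
    ((q 2).dy p)
  have h2 := mul_le_mul_of_nonneg_left (hK ((q 0).toFun p) ((q 1).toFun p) ((q 2).toFun p)) hκ.le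
  have h3 := mul_le_mul_of_nonneg_right (min_le_left c₀ κ)
    (show 0 ≤ (q 0).dx p ^ 2 + (q 0).dy p ^ 2 + (q 1).dx p ^ 2 + (q 1).dy p ^ 2 + (q 2).dx p ^ 2
      + (q 2).dy p ^ 2 by positivity)
  have h4 := mul_le_mul_of_nonneg_right (min_le_right c₀ κ)
    (show 0 ≤ (q 0).toFun p ^ 2 + (q 1).toFun p ^ 2 + (q 2).toFun p ^ 2 by positivity)
  have e : density A B C L lam M (q 0) (q 1) (q 2) p
    = elastic M ((q 0).dx p) ((q 0).dy p) ((q 1).dx p) ((q 1).dy p) ((q 2).dx p) ((q 2).dy p)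
      + κ * bulk A B C ((q 0).toFun p) ((q 1).toFun p) ((q 2).toFun p) := rfl
  rw [e, Fin.sum_univ_three]
  simp only [W12.jetSq]
  linarith

/-- The energy density is uniformly convex in the derivatives, up to a multiple of the square of
the difference of the functions. -/
theorem density_midpoint (hC : 0 < C) (hL : 0 < L) (hlam : 0 < lam) (hM : -1 < M) :
    ∃ c K : ℝ, 0 < c ∧ 0 < K ∧ ∀ (q q' : Fin 3 → W12 Ω) (p : ℝ × ℝ),
      density A B C L lam M ((1 / 2 : ℝ) • (q 0 + q' 0)) ((1 / 2 : ℝ) • (q 1 + q' 1))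
          ((1 / 2 : ℝ) • (q 2 + q' 2)) p + c * (∑ k, (q k - q' k).jetSq p)
        ≤ (density A B C L lam M (q 0) (q 1) (q 2) p
            + density A B C L lam M (q' 0) (q' 1) (q' 2) p) / 2
          + K * ∑ k, (q k - q' k).toFun p ^ 2 := by
  obtain ⟨K, hK0, hK⟩ := bulk_midpoint A B hC
  obtain ⟨κ, hκe⟩ : ∃ κ, κ = lam ^ 2 / L := ⟨_, rfl⟩
  have hκ : 0 < κ := by rw [hκe]; positivity
  set c₀ := min 1 (1 + M) / 4
  have hc₀ : 0 < c₀ := div_pos (lt_min one_pos (by linarith)) (by norm_num)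
  have hc₀e : min 1 (1 + M) = 4 * c₀ := by simp only [c₀]; ring
  clear_value c₀
  refine ⟨c₀, κ * K + c₀, hc₀, by positivity, fun q q' p => ?_⟩
  have h1 := elastic_ge M ((q 0).dx p - (q' 0).dx p) ((q 0).dy p - (q' 0).dy p)
    ((q 1).dx p - (q' 1).dx p) ((q 1).dy p - (q' 1).dy p) ((q 2).dx p - (q' 2).dx p)
    ((q 2).dy p - (q' 2).dy p)
  rw [hc₀e] at h1
  have h2 := elastic_midpoint M ((q 0).dx p) ((q 0).dy p) ((q 1).dx p) ((q 1).dy p) ((q 2).dx p)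
    ((q 2).dy p) ((q' 0).dx p) ((q' 0).dy p) ((q' 1).dx p) ((q' 1).dy p) ((q' 2).dx p)
    ((q' 2).dy p)
  have h3 := mul_le_mul_of_nonneg_left (hK ((q 0).toFun p) ((q 1).toFun p) ((q 2).toFun p)
    ((q' 0).toFun p) ((q' 1).toFun p) ((q' 2).toFun p)) hκ.le
  simp only [density, ← hκe, W12.smul_toFun, W12.add_toFun, W12.smul_dx, W12.add_dx,
    W12.smul_dy, W12.add_dy, one_div_mul_eq_div, Fin.sum_univ_three, W12.jetSq, W12.sub_toFun,
    W12.sub_dx, W12.sub_dy]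
  linarith

theorem tendsto_density {q : ℕ → Fin 3 → W12 Ω} {r : Fin 3 → W12 Ω} {p : ℝ × ℝ}
    (h : ∀ k, Tendsto (fun n => (q n k).toFun p) atTop (𝓝 ((r k).toFun p)) ∧
      Tendsto (fun n => (q n k).dx p) atTop (𝓝 ((r k).dx p)) ∧
      Tendsto (fun n => (q n k).dy p) atTop (𝓝 ((r k).dy p))) :
    Tendsto (fun n => density A B C L lam M (q n 0) (q n 1) (q n 2) p) atTop
      (𝓝 (density A B C L lam M (r 0) (r 1) (r 2) p)) := by
  have hjet : Tendsto (fun n (k : Fin 3) => ((q n k).toFun p, (q n k).dx p, (q n k).dy p)) atTop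
      (𝓝 fun k => ((r k).toFun p, (r k).dx p, (r k).dy p)) :=
    tendsto_pi_nhds.2 fun k => (h k).1.prodMk_nhds ((h k).2.1.prodMk_nhds (h k).2.2)
  have hcont : Continuous fun z : Fin 3 → ℝ × ℝ × ℝ =>
      elastic M (z 0).2.1 (z 0).2.2 (z 1).2.1 (z 1).2.2 (z 2).2.1 (z 2).2.2
        + lam ^ 2 / L * bulk A B C (z 0).1 (z 1).1 (z 2).1 := by
    unfold elastic bulk
    fun_prop
  have := (hcont.tendsto fun k => ((r k).toFun p, (r k).dx p, (r k).dy p)).comp hjet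
  simpa only [density, Function.comp_def] using this

end Pointwise

/-- The parities of `q₁`, `q₂`, `q₃` under the reflections about the axes. -/
def axisParity : Fin 3 → ℝ := ![1, -1, 1]

/-- The parities of `q₁`, `q₂`, `q₃` under the reflections about the diagonals. -/
def diagParity : Fin 3 → ℝ := ![-1, 1, 1]

theorem axisParity_mul_self (k : Fin 3) : axisParity k * axisParity k = 1 := by
  fin_cases k <;> simp [axisParity]

theorem diagParity_mul_self (k : Fin 3) : diagParity k * diagParity k = 1 := by
  fin_cases k <;> simp [diagParity]

/-- A triple has the parities of the theorem. -/
def IsSymmetric {ℓ : ℝ} (q : Fin 3 → W12 (square ℓ)) : Prop :=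
  ∀ k, HasParity (axisParity k) (diagParity k) (q k)

/-- The projection of the triples onto those with the parities of the theorem. -/
def symmetrizeTriple {ℓ : ℝ} (q : Fin 3 → W12 (square ℓ)) : Fin 3 → W12 (square ℓ) :=
  fun k => symmetrize ℓ (axisParity k) (diagParity k) (q k)

section

variable {ℓ : ℝ} {A B C L lam M : ℝ}

theorem isSymmetric_symmetrizeTriple (q : Fin 3 → W12 (square ℓ)) :
    IsSymmetric (symmetrizeTriple q) := fun k =>
  hasParity_symmetrize (axisParity_mul_self k) (diagParity_mul_self k) (q k)

theorem IsSymmetric.symmetrizeTriple_eq {q : Fin 3 → W12 (square ℓ)} (h : IsSymmetric q) :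
    symmetrizeTriple q = q := funext fun k =>
  (h k).symmetrize_eq (axisParity_mul_self k) (diagParity_mul_self k)

theorem continuous_symmetrizeTriple :
    Continuous (symmetrizeTriple : (Fin 3 → W12 (square ℓ)) → Fin 3 → W12 (square ℓ)) :=
  continuous_pi fun k => (symmetrize ℓ _ _).continuous.comp (continuous_apply k)

/-- The energy has a minimizer among the symmetric triples with given boundary values. -/
theorem exists_symmetric_minimizer (hℓ : 0 < ℓ) (hC : 0 < C) (hL : 0 < L) (hlam : 0 < lam)
    (hM : -1 < M) {G : Fin 3 → W12 (square ℓ)}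
    (hG4 : ∀ k, MemLp (G k).toFun 4 (volume.restrict (square ℓ))) :
    ∃ w : Fin 3 → W12 (square ℓ), ((∀ k, w k ∈ W12.zeroBd (square ℓ)) ∧ IsSymmetric w) ∧
      ∀ v : Fin 3 → W12 (square ℓ), ((∀ k, v k ∈ W12.zeroBd (square ℓ)) ∧ IsSymmetric v) →
        energy A B C L lam M (G 0 + w 0) (G 1 + w 1) (G 2 + w 2)
          ≤ energy A B C L lam M (G 0 + v 0) (G 1 + v 1) (G 2 + v 2) := by
  obtain ⟨c, K, hc, hge⟩ := density_ge (Ω := square ℓ) (A := A) (B := B) hC hL hlam hM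
  obtain ⟨c', K', hc', hK', hmid⟩ := density_midpoint (Ω := square ℓ) (A := A) (B := B) hC hL hlam hM
  have hint : ∀ v : Fin 3 → W12 (square ℓ), (∀ k, v k ∈ W12.zeroBd (square ℓ)) →
      Integrable (density A B C L lam M (G 0 + v 0) (G 1 + v 1) (G 2 + v 2))
        (volume.restrict (square ℓ)) := fun v hv =>
    integrable_density A B C L lam M ((hG4 0).add (memLp_four_of_mem_zeroBd (hv 0)))
      ((hG4 1).add (memLp_four_of_mem_zeroBd (hv 1)))
      ((hG4 2).add (memLp_four_of_mem_zeroBd (hv 2)))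
  set V := ∫ _ in square ℓ, K
  have hjet : ∀ q : Fin 3 → W12 (square ℓ),
      Integrable (fun p => ∑ k, (q k).jetSq p) (volume.restrict (square ℓ)) := fun q =>
    integrable_finsetSum _ fun k _ => (q k).integrable_jetSq
  have hjet_norm : ∀ q : Fin 3 → W12 (square ℓ), ∀ k,
      ‖q k‖ ^ 2 ≤ ∫ p in square ℓ, ∑ k, (q k).jetSq p := by
    intro q k
    rw [integral_finsetSum _ fun k _ => (q k).integrable_jetSq]
    refine (W12.norm_sq_le (q k)).trans ?_
    exact Finset.single_le_sum (f := fun k => ∫ p in square ℓ, (q k).jetSq p)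
      (fun k _ => integral_nonneg fun p => by simp only [W12.jetSq]; positivity)
      (Finset.mem_univ k)
  -- the energy controls the norm
  have hcoer : ∀ v : Fin 3 → W12 (square ℓ), (∀ k, v k ∈ W12.zeroBd (square ℓ)) →
      c * (∫ p in square ℓ, ∑ k, (G k + v k).jetSq p) - V
        ≤ energy A B C L lam M (G 0 + v 0) (G 1 + v 1) (G 2 + v 2) := by
    intro v hv
    have h := (hjet fun k => G k + v k).const_mul c
    rw [← integral_const_mul, ← integral_sub h (integrable_const K)]
    exact integral_mono (h.sub (integrable_const K)) (hint v hv) fun p => hge (fun k => G k + v k) p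
  refine exists_forall_le_of_midpoint
    (S := {w : Fin 3 → W12 (square ℓ) | (∀ k, w k ∈ W12.zeroBd (square ℓ)) ∧ IsSymmetric w})
    (F := fun v => energy A B C L lam M (G 0 + v 0) (G 1 + v 1) (G 2 + v 2))
    (N := fun z => K' * ∑ k, ∫ p in square ℓ, (z k).toFun p ^ 2) (c := c') ?_ hc' ?_ ?_ ?_ ?_
  · refine ⟨0, fun k => Submodule.zero_mem _, fun k => ?_⟩
    exact ⟨by simp, by simp, by simp⟩
  · refine ⟨-V, ?_⟩
    rintro _ ⟨v, hv, rfl⟩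
    have h1 := hcoer v hv.1
    have h2 : 0 ≤ ∫ p in square ℓ, ∑ k, (G k + v k).jetSq p :=
      (sq_nonneg _).trans (hjet_norm (fun k => G k + v k) 0)
    have := mul_nonneg hc.le h2
    change -V ≤ energy A B C L lam M (G 0 + v 0) (G 1 + v 1) (G 2 + v 2)
    linarith
  · rintro u ⟨hu, hus⟩ v ⟨hv, hvs⟩
    have hw : ∀ k, ((1 / 2 : ℝ) • (u + v)) k ∈ W12.zeroBd (square ℓ) := fun k =>
      Submodule.smul_mem _ _ (Submodule.add_mem _ (hu k) (hv k))
    refine ⟨(1 / 2 : ℝ) • (u + v), ⟨hw, fun k => ((hus k).add (hvs k)).smul _⟩, ?_⟩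
    have hsq : Integrable (fun p => ∑ k, (u k - v k).toFun p ^ 2) (volume.restrict (square ℓ)) :=
      integrable_finsetSum _ fun k _ => (u k - v k).memLp_toFun.integrable_sq
    have hj := (hjet fun k => u k - v k).const_mul c'
    have hnorm : ‖u - v‖ ^ 2 ≤ ∫ p in square ℓ, ∑ k, (u k - v k).jetSq p := by
      have h0 : 0 ≤ ∫ p in square ℓ, ∑ k, (u k - v k).jetSq p :=
        (sq_nonneg _).trans (hjet_norm (fun k => u k - v k) 0)
      rw [← Real.sqrt_le_sqrt_iff h0, Real.sqrt_sq (norm_nonneg _),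
        pi_norm_le_iff_of_nonneg (Real.sqrt_nonneg _)]
      exact fun k => Real.le_sqrt_of_sq_le (hjet_norm (fun k => u k - v k) k)
    have hpt : ∀ p, density A B C L lam M (G 0 + ((1 / 2 : ℝ) • (u + v)) 0)
        (G 1 + ((1 / 2 : ℝ) • (u + v)) 1) (G 2 + ((1 / 2 : ℝ) • (u + v)) 2) p
          + c' * (∑ k, (u k - v k).jetSq p)
        ≤ (density A B C L lam M (G 0 + u 0) (G 1 + u 1) (G 2 + u 2) p
            + density A B C L lam M (G 0 + v 0) (G 1 + v 1) (G 2 + v 2) p) / 2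
          + K' * ∑ k, (u k - v k).toFun p ^ 2 := by
      intro p
      have h := hmid (fun k => G k + u k) (fun k => G k + v k) p
      have e : ∀ k, (1 / 2 : ℝ) • (G k + u k + (G k + v k)) = G k + ((1 / 2 : ℝ) • (u + v)) k := by
        intro k
        rw [Pi.smul_apply, Pi.add_apply]
        module
      simpa only [e, add_sub_add_left_eq_sub] using h
    have hmono := integral_mono ((hint _ hw).add hj)
      ((((hint u hu).add (hint v hv)).div_const 2).add (hsq.const_mul K')) hpt
    have e1 := integral_add (hint _ hw) hj
    have e2 := integral_add (((hint u hu).add (hint v hv)).div_const 2) (hsq.const_mul K')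
    have e3 := integral_add (hint u hu) (hint v hv)
    rw [integral_div] at e2
    rw [integral_const_mul] at e1 e2
    rw [integral_finsetSum _ fun k _ => (u k - v k).memLp_toFun.integrable_sq] at e2
    have e1' := e1.symm.trans_le (hmono.trans_eq e2)
    have e3' : ∫ p in square ℓ, (density A B C L lam M (G 0 + u 0) (G 1 + u 1) (G 2 + u 2)
        + density A B C L lam M (G 0 + v 0) (G 1 + v 1) (G 2 + v 2)) p
        = energy A B C L lam M (G 0 + u 0) (G 1 + u 1) (G 2 + u 2)
          + energy A B C L lam M (G 0 + v 0) (G 1 + v 1) (G 2 + v 2) := e3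
    rw [e3'] at e1'
    refine le_trans ?_ e1'
    exact add_le_add le_rfl (mul_le_mul_of_nonneg_left hnorm hc'.le)
  · intro u R hu
    have hbound : ∀ n k, ‖u n k‖ ≤ √((R + V) / c) + ∑ k, ‖G k‖ := by
      intro n k
      have h1 := (hcoer (u n) (hu n).1.1).trans (hu n).2
      have h2 := hjet_norm (fun k => G k + u n k) k
      have h3 : ‖G k + u n k‖ ^ 2 ≤ (R + V) / c := by
        rw [le_div_iff₀ hc]
        have := mul_le_mul_of_nonneg_left h2 hc.le
        linarith
      have h4 : ‖u n k‖ ≤ ‖G k + u n k‖ + ‖G k‖ := by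
        simpa using norm_sub_le (G k + u n k) (G k)
      have h5 : ‖G k‖ ≤ ∑ k, ‖G k‖ :=
        Finset.single_le_sum (fun k _ => norm_nonneg _) (Finset.mem_univ k)
      linarith [Real.le_sqrt_of_sq_le h3]
    obtain ⟨θ, hθ, h⟩ := exists_subseq_integral_sq_lt hℓ u (fun n => (hu n).1.1) hbound
    refine ⟨θ, hθ, fun ε hε => ?_⟩
    obtain ⟨n₀, hn₀⟩ := h (ε / (3 * K')) (by positivity)
    refine ⟨n₀, fun n hn m hm => ?_⟩
    have h0 := hn₀ n hn m hm
    have : ∑ k, ∫ p in square ℓ, ((u (θ n) - u (θ m)) k).toFun p ^ 2 < 3 * (ε / (3 * K')) := by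
      rw [Fin.sum_univ_three]
      have a0 := h0 0
      have a1 := h0 1
      have a2 := h0 2
      simp only [Pi.sub_apply]
      linarith
    calc K' * ∑ k, ∫ p in square ℓ, ((u (θ n) - u (θ m)) k).toFun p ^ 2
        < K' * (3 * (ε / (3 * K'))) := mul_lt_mul_of_pos_left this hK'
      _ = ε := by field_simp
  · intro u v a hu hv ha
    have hvz : ∀ k, v k ∈ W12.zeroBd (square ℓ) := fun k =>
      (Submodule.isClosed_topologicalClosure _).mem_of_tendsto (tendsto_pi_nhds.1 hv k)
        (Eventually.of_forall fun n => (hu n).1 k)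
    have hwz : ∀ k, symmetrizeTriple v k ∈ W12.zeroBd (square ℓ) := fun k =>
      symmetrize_mem_zeroBd _ _ (hvz k)
    refine ⟨symmetrizeTriple v, ⟨hwz, isSymmetric_symmetrizeTriple v⟩, ?_⟩
    have hlim : Tendsto u atTop (𝓝 (symmetrizeTriple v)) :=
      ((continuous_symmetrizeTriple.tendsto v).comp hv).congr
        fun n => (hu n).2.symmetrizeTriple_eq
    obtain ⟨θ, hθ, hae⟩ := exists_subseq_tendsto_ae hlim
    refine integral_le_of_tendsto_ae (b := -K) (fun n => hint (u (θ n)) (hu (θ n)).1)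
      (hint _ hwz) (fun n p => ?_) ?_ (ha.comp hθ.tendsto_atTop)
    · have h1 := hge (fun k => G k + u (θ n) k) p
      have h2 : 0 ≤ ∑ k, (G k + u (θ n) k).jetSq p :=
        Finset.sum_nonneg fun k _ => by simp only [W12.jetSq]; positivity
      have := mul_nonneg hc.le h2
      exact (by linarith : -K ≤ c * (∑ k, (G k + u (θ n) k).jetSq p) - K).trans h1
    · filter_upwards [hae] with p hp
      exact tendsto_density (q := fun n k => G k + u (θ n) k)
        (r := fun k => G k + symmetrizeTriple v k) fun k =>
        ⟨(hp k).1.const_add _, (hp k).2.1.const_add _, (hp k).2.2.const_add _⟩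

/-- If the first variation at `q` is invariant under the reflection `σ` with signs `s`, it does not
change when the direction is averaged. -/
theorem integral_dDensity_avg {σ : Reflection (square ℓ)} {s : Fin 3 → ℝ}
    {q v : Fin 3 → W12 (square ℓ)}
    (hq : ∀ k, MemLp (q k).toFun 4 (volume.restrict (square ℓ)))
    (hv : ∀ k, v k ∈ W12.zeroBd (square ℓ))
    (hinv : ∀ p, dDensity A B C L lam M q (fun k => s k • σ.pull (v k)) p
      = dDensity A B C L lam M q v (σ.map p)) :
    ∫ p in square ℓ, dDensity A B C L lam M q (fun k => σ.avg (s k) (v k)) p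
      = ∫ p in square ℓ, dDensity A B C L lam M q v p := by
  have hi := integrable_dDensity A B C L lam M hq fun k => memLp_four_of_mem_zeroBd (hv k)
  have e : ∀ p, dDensity A B C L lam M q (fun k => σ.avg (s k) (v k)) p
      = 1 / 2 * dDensity A B C L lam M q v p
        + 1 / 2 * dDensity A B C L lam M q v (σ.map p) := by
    intro p
    rw [← hinv]
    simp only [dDensity, Reflection.avg_apply, W12.smul_toFun, W12.smul_dx, W12.smul_dy,
      W12.add_toFun, W12.add_dx, W12.add_dy]
    ring
  have hi' : Integrable (fun p => dDensity A B C L lam M q v (σ.map p))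
    (volume.restrict (square ℓ)) := σ.measurePreserving_restrict.integrable_comp_of_integrable hi
  simp only [e]
  rw [integral_add (hi.const_mul _) (hi'.const_mul _), integral_const_mul, integral_const_mul,
    σ.setIntegral_comp (dDensity A B C L lam M q v)]
  ring

section Invariance

variable {q : Fin 3 → W12 (square ℓ)}

theorem dDensity_symX (hq : IsSymmetric q) (v : Fin 3 → W12 (square ℓ)) (p : ℝ × ℝ) :
    dDensity A B C L lam M q (fun k => axisParity k • (symX ℓ).pull (v k)) p
      = dDensity A B C L lam M q v ((symX ℓ).map p) := by
  have h0 := fun k => congrFun (congrArg W12.toFun (hq k).pullX) p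
  have h1 := fun k => congrFun (congrArg W12.dx (hq k).pullX) p
  have h2 := fun k => congrFun (congrArg W12.dy (hq k).pullX) p
  simp only [Reflection.pull_toFun, symX_map, symX_pull_dx, symX_pull_dy, W12.smul_toFun,
    W12.smul_dx, W12.smul_dy, neg_eq_iff_eq_neg] at h0 h1 h2
  simp only [dDensity, h0, h1, h2, W12.smul_toFun, W12.smul_dx, W12.smul_dy,
    Reflection.pull_toFun, symX_map, symX_pull_dx, symX_pull_dy]
  simp only [axisParity, Matrix.cons_val]
  ring

theorem dDensity_symY (hq : IsSymmetric q) (v : Fin 3 → W12 (square ℓ)) (p : ℝ × ℝ) :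
    dDensity A B C L lam M q (fun k => axisParity k • (symY ℓ).pull (v k)) p
      = dDensity A B C L lam M q v ((symY ℓ).map p) := by
  have h0 := fun k => congrFun (congrArg W12.toFun (hq k).pullY) p
  have h1 := fun k => congrFun (congrArg W12.dx (hq k).pullY) p
  have h2 := fun k => congrFun (congrArg W12.dy (hq k).pullY) p
  simp only [Reflection.pull_toFun, symY_map, symY_pull_dx, symY_pull_dy, W12.smul_toFun,
    W12.smul_dx, W12.smul_dy, neg_eq_iff_eq_neg] at h0 h1 h2
  simp only [dDensity, h0, h1, h2, W12.smul_toFun, W12.smul_dx, W12.smul_dy,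
    Reflection.pull_toFun, symY_map, symY_pull_dx, symY_pull_dy]
  simp only [axisParity, Matrix.cons_val]
  ring

theorem dDensity_symD (hq : IsSymmetric q) (v : Fin 3 → W12 (square ℓ)) (p : ℝ × ℝ) :
    dDensity A B C L lam M q (fun k => diagParity k • (symD ℓ).pull (v k)) p
      = dDensity A B C L lam M q v ((symD ℓ).map p) := by
  have h0 := fun k => congrFun (congrArg W12.toFun (hq k).pullD) p
  have h1 := fun k => congrFun (congrArg W12.dx (hq k).pullD) p
  have h2 := fun k => congrFun (congrArg W12.dy (hq k).pullD) p
  simp only [Reflection.pull_toFun, symD_map, symD_pull_dx, symD_pull_dy, W12.smul_toFun,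
    W12.smul_dx, W12.smul_dy] at h0 h1 h2
  simp only [dDensity, h0, h1, h2, W12.smul_toFun, W12.smul_dx, W12.smul_dy,
    Reflection.pull_toFun, symD_map, symD_pull_dx, symD_pull_dy]
  simp only [diagParity, Matrix.cons_val]
  ring

end Invariance

/-- At a symmetric triple, the first variation does not see the asymmetric part of a direction. -/
theorem integral_dDensity_symmetrizeTriple {q v : Fin 3 → W12 (square ℓ)} (hq : IsSymmetric q)
    (hq4 : ∀ k, MemLp (q k).toFun 4 (volume.restrict (square ℓ)))
    (hv : ∀ k, v k ∈ W12.zeroBd (square ℓ)) :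
    ∫ p in square ℓ, dDensity A B C L lam M q (symmetrizeTriple v) p
      = ∫ p in square ℓ, dDensity A B C L lam M q v p := by
  have hX : ∀ k, (symX ℓ).avg (axisParity k) (v k) ∈ W12.zeroBd (square ℓ) := fun k =>
    Reflection.avg_mem_zeroBd _ _ (hv k)
  have hY : ∀ k, (symY ℓ).avg (axisParity k) ((symX ℓ).avg (axisParity k) (v k))
      ∈ W12.zeroBd (square ℓ) := fun k => Reflection.avg_mem_zeroBd _ _ (hX k)
  exact (integral_dDensity_avg hq4 hY (dDensity_symD hq _)).trans
    ((integral_dDensity_avg hq4 hX (dDensity_symY hq _)).trans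
      (integral_dDensity_avg hq4 hv (dDensity_symX hq _)))

/-- For symmetric boundary data there is a symmetric critical point. -/
theorem exists_symmetric_critical (hℓ : 0 < ℓ) (hC : 0 < C) (hL : 0 < L) (hlam : 0 < lam)
    (hM : -1 < M) {G : Fin 3 → W12 (square ℓ)} (hG : IsSymmetric G)
    (hG4 : ∀ k, MemLp (G k).toFun 4 (volume.restrict (square ℓ))) :
    ∃ w : Fin 3 → W12 (square ℓ), (∀ k, w k ∈ W12.zeroBd (square ℓ)) ∧ IsSymmetric w ∧
      IsCritical A B C L lam M (G 0 + w 0) (G 1 + w 1) (G 2 + w 2) := by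
  obtain ⟨w, ⟨hw, hws⟩, hmin⟩ :=
    exists_symmetric_minimizer (A := A) (B := B) hℓ hC hL hlam hM hG4
  refine ⟨w, hw, hws, ?_⟩
  set q : Fin 3 → W12 (square ℓ) := fun k => G k + w k
  have hqs : IsSymmetric q := fun k => (hG k).add (hws k)
  have hq4 : ∀ k, MemLp (q k).toFun 4 (volume.restrict (square ℓ)) := fun k =>
    (hG4 k).add (memLp_four_of_mem_zeroBd (hw k))
  have hzero : ∀ v : Fin 3 → W12 (square ℓ), (∀ k, v k ∈ W12.zeroBd (square ℓ)) →
      ∫ p in square ℓ, dDensity A B C L lam M q v p = 0 := by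
    intro v hv
    have hv' : ∀ k, symmetrizeTriple v k ∈ W12.zeroBd (square ℓ) := fun k =>
      symmetrize_mem_zeroBd _ _ (hv k)
    rw [← integral_dDensity_symmetrizeTriple hqs hq4 hv]
    refine IsLocalMin.hasDerivAt_eq_zero (Eventually.of_forall fun t => ?_)
      (hasDerivAt_energy A B C L lam M hq4 fun k => memLp_four_of_mem_zeroBd (hv' k))
    have h := hmin (fun k => w k + t • symmetrizeTriple v k)
      ⟨fun k => Submodule.add_mem _ (hw k) (Submodule.smul_mem _ _ (hv' k)),
        fun k => (hws k).add ((isSymmetric_symmetrizeTriple v k).smul t)⟩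
    simpa only [W12.lin_eq, zero_smul, add_zero, add_assoc, q] using h
  intro v₁ v₂ v₃ h₁ h₂ h₃
  have hv : ∀ k, (![v₁, v₂, v₃] : Fin 3 → W12 (square ℓ)) k ∈ W12.zeroBd (square ℓ) := by
    intro k
    fin_cases k
    exacts [W12.isZeroBoundary_iff.1 h₁, W12.isZeroBoundary_iff.1 h₂, W12.isZeroBoundary_iff.1 h₃]
  have hv4 := fun k => memLp_four_of_mem_zeroBd (hv k)
  have hd := hasDerivAt_energy A B C L lam M hq4 hv4
  rw [hzero _ hv] at hd
  exact ⟨fun t => integrable_lineDensity A B C L lam M hq4 hv4 t, hd⟩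

end

/-! ### Boundary data and traces -/

/-- A continuous piecewise `C¹` function on `[a, b]` is Lipschitz, as its right derivatives are
bounded. -/
theorem PiecewiseC1.lipschitzOnWith {f : ℝ → ℝ} {a b : ℝ} (h : PiecewiseC1 f a b) :
    ∃ K : ℝ≥0, LipschitzOnWith K f (Set.Icc a b) := by
  obtain ⟨hf, F, haF, hbF, hF⟩ := h
  have hst : ∀ s t : ℝ, ∃ c : ℝ, 0 ≤ c ∧ (s < t → ContDiffOn ℝ 1 f (Set.Icc s t) →
      ∀ x ∈ Set.Ico s t, ∃ f' : ℝ, HasDerivWithinAt f f' (Set.Ici x) x ∧ ‖f'‖ ≤ c) := by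
    intro s t
    by_cases hs : s < t ∧ ContDiffOn ℝ 1 f (Set.Icc s t)
    · obtain ⟨hlt, hcd⟩ := hs
      obtain ⟨c, hc⟩ := isCompact_Icc.exists_bound_of_continuousOn
        (hcd.continuousOn_derivWithin (uniqueDiffOn_Icc hlt) le_rfl)
      have hc0 : 0 ≤ c := (norm_nonneg _).trans (hc s (Set.left_mem_Icc.2 hlt.le))
      refine ⟨c, hc0, fun _ _ x hx => ⟨derivWithin f (Set.Icc s t) x, ?_,
        hc x (Set.Ico_subset_Icc_self hx)⟩⟩
      exact ((hcd.differentiableOn (by simp) x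
        (Set.Ico_subset_Icc_self hx)).hasDerivWithinAt).mono_of_mem_nhdsWithin
          (Icc_mem_nhdsGE_of_mem hx)
    · exact ⟨0, le_rfl, fun h1 h2 => absurd ⟨h1, h2⟩ hs⟩
  choose c hc0 hc using hst
  set K : ℝ := ∑ s ∈ F, ∑ t ∈ F, c s t
  have hK0 : 0 ≤ K := Finset.sum_nonneg fun s _ => Finset.sum_nonneg fun t _ => hc0 s t
  have hder : ∀ x ∈ Set.Ico a b, ∃ f' : ℝ, HasDerivWithinAt f f' (Set.Ici x) x ∧ ‖f'‖ ≤ K := by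
    intro x hx
    have hne1 : (F.filter (· ≤ x)).Nonempty := ⟨a, Finset.mem_filter.2 ⟨haF, hx.1⟩⟩
    have hne2 : (F.filter (x < ·)).Nonempty := ⟨b, Finset.mem_filter.2 ⟨hbF, hx.2⟩⟩
    obtain ⟨hsF, hsx⟩ := Finset.mem_filter.1 (Finset.max'_mem _ hne1)
    obtain ⟨htF, hxt⟩ := Finset.mem_filter.1 (Finset.min'_mem _ hne2)
    have hgap : ∀ r ∈ F, r ∉ Set.Ioo ((F.filter (· ≤ x)).max' hne1)
        ((F.filter (x < ·)).min' hne2) := by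
      rintro r hr ⟨h1, h2⟩
      rcases le_or_gt r x with h | h
      · exact absurd (Finset.le_max' _ r (Finset.mem_filter.2 ⟨hr, h⟩)) (not_le.2 h1)
      · exact absurd (Finset.min'_le _ r (Finset.mem_filter.2 ⟨hr, h⟩)) (not_le.2 h2)
    generalize (F.filter (· ≤ x)).max' hne1 = s at *
    generalize (F.filter (x < ·)).min' hne2 = t at *
    obtain ⟨f', h1, h2⟩ := hc s t (hsx.trans_lt hxt)
      (hF s hsF t htF (hsx.trans_lt hxt) hgap) x ⟨hsx, hxt⟩
    refine ⟨f', h1, h2.trans ?_⟩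
    exact (Finset.single_le_sum (fun t _ => hc0 s t) htF).trans
      (Finset.single_le_sum (f := fun s => ∑ t ∈ F, c s t)
        (fun s _ => Finset.sum_nonneg fun t _ => hc0 s t) hsF)
  have hle : ∀ x ∈ Set.Icc a b, ∀ y ∈ Set.Icc a b, x ≤ y → |f x - f y| ≤ K * |x - y| := by
    intro x hx y hy hxy
    choose! f' hf' using hder
    have := norm_image_sub_le_of_norm_deriv_right_le_segment (f := f) (f' := f') (C := K)
      (hf.mono (Set.Icc_subset_Icc hx.1 hy.2))
      (fun z hz => (hf' z ⟨hx.1.trans hz.1, hz.2.trans_le hy.2⟩).1)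
      (fun z hz => (hf' z ⟨hx.1.trans hz.1, hz.2.trans_le hy.2⟩).2) y (Set.right_mem_Icc.2 hxy)
    rwa [Real.norm_eq_abs, abs_sub_comm, ← abs_of_nonneg (sub_nonneg.2 hxy), abs_sub_comm y x]
      at this
  refine ⟨⟨K, hK0⟩, LipschitzOnWith.of_dist_le_mul fun x hx y hy => ?_⟩
  rw [Real.dist_eq, Real.dist_eq]
  rcases le_total x y with h | h
  · exact hle x hx y hy h
  · rw [abs_sub_comm, abs_sub_comm x y]
    exact hle y hy x hx h

/-- An even function that is Lipschitz on `[-ℓ, ℓ]` has an even Lipschitz extension to the line. -/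
theorem exists_even_lipschitz_extension {f : ℝ → ℝ} {ℓ : ℝ} {K : ℝ≥0}
    (hf : LipschitzOnWith K f (Set.Icc (-ℓ) ℓ)) (heven : ∀ t ∈ Set.Icc (-ℓ) ℓ, f (-t) = f t) :
    ∃ F : ℝ → ℝ, LipschitzWith K F ∧ (∀ t, F (-t) = F t) ∧ Set.EqOn F f (Set.Icc (-ℓ) ℓ) := by
  obtain ⟨h, hh, heq⟩ := hf.extend_real
  refine ⟨fun t => (h t + h (-t)) / 2, ?_, fun t => by simp [add_comm], fun t ht => ?_⟩
  · refine LipschitzWith.of_dist_le_mul fun x y => ?_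
    have h1 := hh.dist_le_mul x y
    have h2 := hh.dist_le_mul (-x) (-y)
    rw [dist_neg_neg] at h2
    rw [Real.dist_eq] at h1 h2 ⊢
    have e : (h x + h (-x)) / 2 - (h y + h (-y)) / 2
        = (h x - h y) / 2 + (h (-x) - h (-y)) / 2 := by ring
    have h3 := abs_add_le ((h x - h y) / 2) ((h (-x) - h (-y)) / 2)
    rw [abs_div, abs_div, abs_two] at h3
    rw [e]
    linarith
  · have ht' : -t ∈ Set.Icc (-ℓ) ℓ := ⟨neg_le_neg ht.2, by linarith [ht.1]⟩
    simp only [← heq ht, ← heq ht', heven t ht]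
    ring

section

variable {ℓ ε δ : ℝ}

theorem symmetrize_toFun (u : W12 (square ℓ)) (hε : ε * ε = 1) (hδ : δ * δ = 1)
    (hX : ∀ p, u.toFun (reflX p) = ε * u.toFun p) (hY : ∀ p, u.toFun (reflY p) = ε * u.toFun p)
    (hD : ∀ p, u.toFun (reflD p) = δ * u.toFun p) :
    (symmetrize ℓ ε δ u).toFun = u.toFun := by
  have avg_toFun : ∀ {σ : Reflection (square ℓ)} {s : ℝ} {v : W12 (square ℓ)}, s * s = 1 →
      v.toFun = u.toFun → (∀ p, u.toFun (σ.map p) = s * u.toFun p) →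
      (σ.avg s v).toFun = u.toFun := by
    intro σ s v hs hv h
    funext p
    simp only [Reflection.avg_apply, W12.smul_toFun, W12.add_toFun, Reflection.pull_toFun, hv, h]
    linear_combination 1 / 2 * u.toFun p * hs
  exact avg_toFun hδ (avg_toFun hε (avg_toFun hε rfl hX) hY) hD

/-- A Lipschitz function with parities is an element of `W^{1,2}` whose derivatives, chosen
suitably, have the corresponding parities everywhere. -/
theorem exists_hasParity_of_lipschitz {f : ℝ × ℝ → ℝ} {K : ℝ≥0} (hf : LipschitzWith K f)
    (hε : ε * ε = 1) (hδ : δ * δ = 1) (hX : ∀ p, f (reflX p) = ε * f p)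
    (hY : ∀ p, f (reflY p) = ε * f p) (hD : ∀ p, f (reflD p) = δ * f p) :
    ∃ u : W12 (square ℓ), u.toFun = f ∧ HasParity ε δ u := by
  obtain ⟨u, rfl, -, -⟩ := W12.exists_of_lipschitz (isOpen_square ℓ) (isBounded_square ℓ) hf
  exact ⟨symmetrize ℓ ε δ u, symmetrize_toFun u hε hδ hX hY hD, hasParity_symmetrize hε hδ u⟩

/-- A function with parities that force it to vanish on `S` has zero trace on `S`: its
approximations by smooth functions may be symmetrized. -/
theorem hasZeroTraceOn_of_hasParity {S : Set (ℝ × ℝ)} (hε : ε * ε = 1) (hδ : δ * δ = 1)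
    (hS : ∀ v : W12 (square ℓ), HasParity ε δ v → ∀ p ∈ S, v.toFun p = 0)
    {G w : W12 (square ℓ)} {K : ℝ≥0} (hGK : LipschitzWith K G.toFun) (hG : HasParity ε δ G)
    (hw : w ∈ W12.zeroBd (square ℓ)) (hws : HasParity ε δ w) : (G + w).HasZeroTraceOn S := by
  have hmem : G + symmetrize ℓ ε δ w ∈ closure {φ : W12 (square ℓ) |
      (∃ K : ℝ≥0, LipschitzWith K φ.toFun) ∧ ∀ p ∈ S, φ.toFun p = 0} := by
    refine map_mem_closure (f := fun v => G + symmetrize ℓ ε δ v) (s := W12.tests (square ℓ))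
      (continuous_const.add (symmetrize ℓ ε δ).continuous) hw fun φ hφ => ⟨?_, ?_⟩
    · have ht : IsTest (square ℓ) (symmetrize ℓ ε δ φ).toFun := symmetrize_mem_tests ε δ hφ
      obtain ⟨D, hD⟩ := (ht.smooth.of_le (by simp)).lipschitzWith_of_hasCompactSupport ht.compact
        (n := 1) (by simp)
      exact ⟨K + D, hGK.add hD⟩
    · exact hS _ (hG.add (hasParity_symmetrize hε hδ φ))
  rw [hws.symmetrize_eq hε hδ] at hmem
  intro η hη
  obtain ⟨φ, hφ, hd⟩ := W12.mem_closure_iff_distSq.1 hmem η hη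
  exact ⟨φ, hφ.1, hφ.2, hd⟩

theorem W12.hasBoundaryValue_add {Ω : Set (ℝ × ℝ)} {G w : W12 Ω} {g : ℝ × ℝ → ℝ} {K : ℝ≥0}
    (hGK : LipschitzWith K G.toFun) (hg : Set.EqOn G.toFun g (frontier Ω))
    (hw : w ∈ W12.zeroBd Ω) : (G + w).HasBoundaryValue g := by
  refine ⟨G, ⟨K, hGK⟩, hg, W12.isZeroBoundary_iff.2 ?_⟩
  rwa [W12.lin_eq, neg_one_smul, add_assoc, add_comm w, add_neg_cancel_left]

theorem mem_frontier_square (hℓ : 0 < ℓ) {p : ℝ × ℝ} (hp : p ∈ frontier (square ℓ)) :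
    (p.1 ∈ Set.Icc (-ℓ) ℓ ∧ (p.2 = -ℓ ∨ p.2 = ℓ)) ∨
      ((p.1 = -ℓ ∨ p.1 = ℓ) ∧ p.2 ∈ Set.Icc (-ℓ) ℓ) := by
  have h : -ℓ < ℓ := by linarith
  rw [square, frontier_prod_eq, frontier_Ioo h, closure_Ioo h.ne] at hp
  exact hp

/-- The extension `τ(x) - τ(y)` of a tangent boundary datum is odd about the diagonals and even
about the axes. It has the right boundary values because `τ` vanishes at the end points. -/
theorem IsTangentDatum.exists_extension (hℓ : 0 < ℓ) {s : ℝ} {g : ℝ × ℝ → ℝ}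
    (hg : IsTangentDatum ℓ s g) :
    ∃ (G : W12 (square ℓ)) (K : ℝ≥0), LipschitzWith K G.toFun ∧
      Set.EqOn G.toFun g (frontier (square ℓ)) ∧ HasParity 1 (-1) G := by
  obtain ⟨τ, d, -, -, hτ, heven, -, hval⟩ := hg
  obtain ⟨K, hK⟩ := hτ.lipschitzOnWith
  obtain ⟨T, hT, hTe, hTτ⟩ := exists_even_lipschitz_extension hK heven
  have hr : ℓ ∈ Set.Icc (-ℓ) ℓ := ⟨by linarith, le_rfl⟩
  have hTℓ : T ℓ = 0 := by
    rw [hTτ hr]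
    have := (hval ℓ hr).1.symm.trans (hval ℓ hr).2.2.1
    linarith
  have hTℓ' : T (-ℓ) = 0 := (hTe ℓ).trans hTℓ
  have hlip : LipschitzWith (K * 1 + K * 1) fun p : ℝ × ℝ => T p.1 - T p.2 :=
    (hT.comp LipschitzWith.prod_fst).sub (hT.comp LipschitzWith.prod_snd)
  obtain ⟨G, hG, hGs⟩ := exists_hasParity_of_lipschitz (ℓ := ℓ) (ε := 1) (δ := -1) hlip
    (by norm_num) (by norm_num) (fun p => by simp [reflX, hTe]) (fun p => by simp [reflY, hTe])
    (fun p => by simp [reflD])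
  refine ⟨G, _, hG ▸ hlip, fun p hp => ?_, hGs⟩
  obtain ⟨x, y⟩ := p
  rw [hG]
  rcases mem_frontier_square hℓ hp with ⟨h1, h2⟩ | ⟨h1, h2⟩
  · obtain ⟨v1, v2, -, -⟩ := hval x h1
    dsimp only at h1 h2 ⊢
    rcases h2 with rfl | rfl
    · rw [hTℓ', v2, hTτ h1, sub_zero]
    · rw [hTℓ, v1, hTτ h1, sub_zero]
  · obtain ⟨-, -, v3, v4⟩ := hval y h2
    dsimp only at h1 h2 ⊢
    rcases h1 with rfl | rfl
    · rw [hTℓ', v4, hTτ h2, zero_sub]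
    · rw [hTℓ, v3, hTτ h2, zero_sub]

theorem exists_const_hasParity (c : ℝ) (hε : ε * ε = 1) (hc : c = ε * c) :
    ∃ G : W12 (square ℓ), LipschitzWith 0 G.toFun ∧ G.toFun = (fun _ => c) ∧ HasParity ε 1 G := by
  obtain ⟨G, hG, hGs⟩ := exists_hasParity_of_lipschitz (ℓ := ℓ) (ε := ε) (δ := 1)
    (LipschitzWith.const c) hε (by norm_num) (fun _ => hc) (fun _ => hc)
    (fun _ => (one_mul c).symm)
  exact ⟨G, hG ▸ LipschitzWith.const c, hG, hGs⟩

end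

end NematicSquare


open NematicSquare in
theorem proposition3 (A B C L lam M ℓ : ℝ) (hA : A < 0) (hB : 0 < B) (hC : 0 < C) (hL : 0 < L)
    (hlam : 0 < lam) (hM : -1 < M) (hℓ : 0 < ℓ) (g : ℝ × ℝ → ℝ)
    (hg : IsTangentDatum ℓ (sPlus A B C) g) :
    ∃ q₁ q₂ q₃ : W12 (square ℓ),
      IsAdmissible A B C g q₁ q₂ q₃ ∧
      IsCritical A B C L lam M q₁ q₂ q₃ ∧
      (OddUnder (square ℓ) reflD q₁ ∧ OddUnder (square ℓ) reflD' q₁ ∧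
        EvenUnder (square ℓ) reflX q₁ ∧ EvenUnder (square ℓ) reflY q₁) ∧
      (EvenUnder (square ℓ) reflD q₂ ∧ EvenUnder (square ℓ) reflD' q₂ ∧
        OddUnder (square ℓ) reflX q₂ ∧ OddUnder (square ℓ) reflY q₂) ∧
      (EvenUnder (square ℓ) reflD q₃ ∧ EvenUnder (square ℓ) reflD' q₃ ∧
        EvenUnder (square ℓ) reflX q₃ ∧ EvenUnder (square ℓ) reflY q₃) ∧
      ((∀ p ∈ diagonals ℓ, q₁.toFun p = 0) ∧ q₁.HasZeroTraceOn (diagonals ℓ)) ∧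
      ((∀ p ∈ axes ℓ, q₂.toFun p = 0) ∧ q₂.HasZeroTraceOn (axes ℓ)) := by
  obtain ⟨G₁, K, hK, hG₁g, hG₁⟩ := hg.exists_extension hℓ
  obtain ⟨G₂, hK₂, hG₂c, hG₂⟩ := exists_const_hasParity (ℓ := ℓ) (ε := -1) 0 (by norm_num)
    (by norm_num)
  obtain ⟨G₃, hK₃, hG₃c, hG₃⟩ := exists_const_hasParity (ℓ := ℓ) (ε := 1) (-sPlus A B C / 6)
    (by norm_num) (one_mul _).symm
  have hsym : IsSymmetric ![G₁, G₂, G₃] := by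
    intro k
    fin_cases k
    exacts [hG₁, hG₂, hG₃]
  have hG4 : ∀ k, MemLp ((![G₁, G₂, G₃] : Fin 3 → W12 (square ℓ)) k).toFun 4
      (volume.restrict (square ℓ)) := by
    intro k
    fin_cases k
    exacts [W12.memLp_of_lipschitz (isOpen_square ℓ) (isBounded_square ℓ) hK 4,
      W12.memLp_of_lipschitz (isOpen_square ℓ) (isBounded_square ℓ) hK₂ 4,
      W12.memLp_of_lipschitz (isOpen_square ℓ) (isBounded_square ℓ) hK₃ 4]
  obtain ⟨w, hw, hws, hcrit⟩ :=
    exists_symmetric_critical (A := A) (B := B) hℓ hC hL hlam hM hsym hG4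
  have hw₁ : HasParity 1 (-1) (w 0) := hws 0
  have hw₂ : HasParity (-1) 1 (w 1) := hws 1
  have hq₁ := hG₁.add hw₁
  have hq₂ := hG₂.add hw₂
  have hq₃ : HasParity 1 1 (G₃ + w 2) := hG₃.add (hws 2)
  have h1 : (1 : ℝ) * 1 = 1 := one_mul 1
  have hn1 : (-1 : ℝ) * -1 = 1 := by norm_num
  refine ⟨G₁ + w 0, G₂ + w 1, G₃ + w 2,
    ⟨W12.hasBoundaryValue_add hK hG₁g (hw 0), W12.hasBoundaryValue_add hK₂ (fun p _ => by rw [hG₂c])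
      (hw 1), W12.hasBoundaryValue_add hK₃ (fun p _ => by rw [hG₃c]) (hw 2)⟩, hcrit,
    ⟨fun p _ => ?_, fun p _ => ?_, fun p _ => ?_, fun p _ => ?_⟩,
    ⟨fun p _ => ?_, fun p _ => ?_, fun p _ => ?_, fun p _ => ?_⟩,
    ⟨fun p _ => ?_, fun p _ => ?_, fun p _ => ?_, fun p _ => ?_⟩,
    ⟨fun p => hq₁.eq_zero_of_mem_diagonals h1,
      hasZeroTraceOn_of_hasParity h1 hn1 (fun v hv p => hv.eq_zero_of_mem_diagonals h1) hK hG₁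
        (hw 0) hw₁⟩,
    ⟨fun p => hq₂.eq_zero_of_mem_axes,
      hasZeroTraceOn_of_hasParity hn1 h1 (fun v hv p => hv.eq_zero_of_mem_axes) hK₂ hG₂
        (hw 1) hw₂⟩⟩
  · rw [hq₁.toFun_reflD, neg_one_mul]
  · rw [hq₁.toFun_reflD' h1, neg_one_mul]
  · rw [hq₁.toFun_reflX, one_mul]
  · rw [hq₁.toFun_reflY, one_mul]
  · rw [hq₂.toFun_reflD, one_mul]
  · rw [hq₂.toFun_reflD' hn1, one_mul]
  · rw [hq₂.toFun_reflX, neg_one_mul]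
  · rw [hq₂.toFun_reflY, neg_one_mul]
  · rw [hq₃.toFun_reflD, one_mul]
  · rw [hq₃.toFun_reflD' h1, one_mul]
  · rw [hq₃.toFun_reflX, one_mul]
  · rw [hq₃.toFun_reflY, one_mul]

end
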